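/- **Theorem 1.** Fix $x>0$ and let $L_{i\nu}(x)=\frac{\pi}{2\sinh \pi\nu}\{I_{i\nu}(x)+I_{-i\nu}(x)\}$ for real $\nu\neq 0$, where $I_\mu$ is the modified Bessel function of the first kind. The positive zeros of $\nu\mapsto L_{i\nu}(x)$ form an infinite increasing sequence $\nu_0<\nu_1<\nu_2<\cdots$ (all of them, numbered from $0$), and $$\nu_n\sim \frac{m_+}{W(\lambda m_+)}+\frac{B_0}{m_+}+\frac{B_1}{m_+^3}+\frac{B_2}{m_+^5}+\cdots\qquad(n\to\infty),$$ where $m_+=(n+\frac14)\pi$, $\lambda=2/(ex)$, and $W(z)>0$ is the solution of $We^W=z$ for $z>0$. Precisely, for every $N\ge 0$, $$\nu_n=\frac{m_+}{W(\lambda m_+)}+\sum_{k=0}^{N-1}\frac{B_k}{m_+^{2k+1}}+O\!\left(\frac{W(\lambda m_+)^{2N}}{m_+^{2N+1}}\right)\qquad(n\to\infty).$$ The coefficients $B_k$, which depend on $x$ and on $n$ (on $n$ only through $W(\lambda m_+)$), are obtained as follows. * $\gamma_k$ are the Stirling coefficients, $\frac{1}{\Gamma(1+z)}\sim\frac{e^{z}z^{-z}}{\sqrt{2\pi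 z}}\sum_k\gamma_kz^{-k}$, that is, as formal series in $t$, $\sum_k \gamma_k t^k=\exp\bigl(-\sum_{k\ge1}\frac{\mathcal B_{k+1}}{k(k+1)}t^k\bigr)$ with the Bernoulli numbers $\mathcal B_k$. The polynomials $C_k$ are defined by $\sum_{j\ge 0} \frac{c^j}{j!\,(1+z)_j}\sim\sum_k C_k(c)z^{-k}$ as $z\to\infty$ (expand each $1/(1+z)_j$ in powers of $1/z$), where $(a)_j=a(a+1)\cdots(a+j-1)$. Put $a_k=\sum_{r=0}^k\gamma_rC_{k-r}(x^2/4)$. * $A_k$ are the coefficients in the formal expansion $\arctan\dfrac{a_1t-a_3t^3+a_5t^5-\cdots}{1-a_2t^2+a_4t^4-\cdots}=\sum_{k\ge0}A_kt^{2k+1}$. In particular $A_0=a_1$, $A_1=a_1a_2-a_3-\frac13a_1^3$, $A_2=a_1a_2^2+a_1^2a_3-a_1^3a_2-a_2a_3-a_1a_4+a_5+\frac15a_1^5$. * Put $\xi=m_+/W(\lambda m_+)$, so that $\xi\log\lambda\xi=m_+$, and $\ell=1+\log\lambda\xi$. The numbers $b_k$ are determined recursively by substituting $\nu=\xi+b_0/\xi+b_1/\xi^3+\cdots$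 into $\nu\log\lambda\nu=m_+-A_0/\nu-A_1/\nu^3-\cdots$ and equating coefficients of like powers of $\xi$, with $\ell$ treated as a constant; that is, $y=\sum_{k\ge 0} b_ku^{k+1}$ is the formal power series solution without constant term of $\ell y=-\sum_{j\ge 0} A_ju^{j+1}(1+y)^{-2j-1}-\{(1+y)\log(1+y)-y\}$. * $B_k=b_k/\tau^{2k+1}$ with $\tau=\xi/m_+=1/W(\lambda m_+)$. Explicitly, with $b_0=-A_0/\ell$ and $b_1=(A_0b_0-A_1-\frac12b_0^2)/\ell$, $$B_0=\frac{-A_0}{1+\tau},\quad B_1=\frac{A_0b_0-A_1-\frac12b_0^2}{\tau^2(1+\tau)},\quad B_2=\frac{3A_1b_0-A_0(b_0^2-b_1)-A_2-b_0b_1+\frac16b_0^3}{\tau^4(1+\tau)}.$$ -/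

import Mathlib

namespace Dunster

noncomputable section

/-! ### Bessel functions -/

/-- The modified Bessel function of the first kind, for an order `μ` that is not a negative
integer: `I_μ(x) = (x/2)^μ / Γ(1+μ) * ∑ (x/2)^(2k) / (k! (1+μ)_k)`, with `(a)_k` the rising
factorial. -/
def besselI (μ : ℂ) (x : ℝ) : ℂ :=
  ((x : ℂ) / 2) ^ μ / Complex.Gamma (1 + μ) *
    ∑' k : ℕ, ((x : ℂ) / 2) ^ (2 * k) / ((k.factorial : ℂ) * (ascPochhammer ℂ k).eval (1 + μ))

/-- Dunster's function `L_{iν}(x) = π / (2 sinh πν) * (I_{iν}(x) + I_{-iν}(x))`, for `ν ≠ 0`. -/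
def besselL (ν x : ℝ) : ℂ :=
  (Real.pi : ℂ) / (2 * (Real.sinh (Real.pi * ν) : ℂ)) *
    (besselI (Complex.I * ν) x + besselI (-(Complex.I * ν)) x)

/-! ### The Lambert function on the positive half-line -/

theorem exists_lambert (z : ℝ) (hz : 0 < z) : ∃ w : ℝ, 0 < w ∧ w * Real.exp w = z := by
  have hc : ContinuousOn (fun w : ℝ => w * Real.exp w) (Set.Icc 0 z) := by fun_prop
  have hz' : z ∈ Set.Icc ((fun w : ℝ => w * Real.exp w) 0)
      ((fun w : ℝ => w * Real.exp w) z) := by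
    constructor
    · simpa using hz.le
    · have h1 : (1 : ℝ) ≤ Real.exp z := Real.one_le_exp hz.le
      show z ≤ z * Real.exp z
      nlinarith
  obtain ⟨w, hw, hwz⟩ := intermediate_value_Icc hz.le hc hz'
  have hwz' : w * Real.exp w = z := hwz
  refine ⟨w, lt_of_le_of_ne hw.1 ?_, hwz'⟩
  intro h
  rw [← h] at hwz'
  simp at hwz'
  exact hz.ne hwz'

/-- The Lambert function `W(z)` for `z > 0`: the (unique) positive solution of `w e^w = z`.
The value `0` elsewhere is not used. -/
def lambertW (z : ℝ) : ℝ := by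
  classical exact if h : 0 < z then (exists_lambert z h).choose else 0

/-! ### Formal power series -/

/-- The formal composition `∑ c_j s^j`, for a power series `s` without constant term (then
`s^j` does not contribute to the coefficient of `t^k` when `j > k`). -/
def formalComp (c : ℕ → ℝ) (s : PowerSeries ℝ) : PowerSeries ℝ :=
  PowerSeries.mk fun k => ∑ j ∈ Finset.range (k + 1), c j * PowerSeries.coeff k (s ^ j)

/-! ### The coefficients in the expansion of `I_{iν}(x)` -/

/-- The Stirling series of `-log Γ` in `t = 1/z`:
`log (√(2πz) e^{-z} z^z / Γ(1+z)) ~ -∑ B_{k+1} / (k (k+1)) t^k`, `k ≥ 1`, with Bernoulli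
numbers `B_{k+1}` (which vanish for even `k ≥ 2`). -/
def stirlingLog : PowerSeries ℝ :=
  PowerSeries.mk fun k =>
    if k = 0 then 0 else -((bernoulli (k + 1) : ℚ) : ℝ) / ((k : ℝ) * ((k : ℝ) + 1))

/-- The Stirling coefficients `γ_k` of `1/Γ`:
`1/Γ(1+z) ~ (2πz)^{-1/2} e^z z^{-z} ∑ γ_k z^{-k}`, that is `∑ γ_k t^k = exp(stirlingLog)`. -/
def stirlingGamma (k : ℕ) : ℝ :=
  PowerSeries.coeff k (formalComp (fun j => 1 / (j.factorial : ℝ)) stirlingLog)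

/-- The coefficients `C_k(χ)` in `∑_j χ^j / (j! (1+z)_j) ~ ∑_k C_k(χ) z^{-k}`; in `t = 1/z`,
`1/(1+z)_j = t^j / ((1+t)(1+2t)⋯(1+jt))`, so that only `j ≤ k` contributes to `t^k`. -/
def coeffC (χ : ℝ) (k : ℕ) : ℝ :=
  PowerSeries.coeff k (∑ j ∈ Finset.range (k + 1),
    PowerSeries.C (χ ^ j / (j.factorial : ℝ)) * PowerSeries.X ^ j *
      (∏ i ∈ Finset.range j, (1 + PowerSeries.C ((i : ℝ) + 1) * PowerSeries.X))⁻¹)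

/-- `a_k = ∑_{r ≤ k} γ_r C_{k-r}(x²/4)`. -/
def coeffa (x : ℝ) (k : ℕ) : ℝ :=
  ∑ r ∈ Finset.range (k + 1), stirlingGamma r * coeffC (x ^ 2 / 4) (k - r)

/-! ### The coefficients `A_k` of the phase correction -/

/-- `1 - a₂ t² + a₄ t⁴ - ⋯` -/
def evenSeries (x : ℝ) : PowerSeries ℝ :=
  PowerSeries.mk fun k => if Even k then (-1) ^ (k / 2) * coeffa x k else 0

/-- `a₁ t - a₃ t³ + a₅ t⁵ - ⋯` -/
def oddSeries (x : ℝ) : PowerSeries ℝ :=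
  PowerSeries.mk fun k => if Even k then 0 else (-1) ^ (k / 2) * coeffa x k

/-- `A_k` is the coefficient of `t^(2k+1)` in `arctan (oddSeries / evenSeries)`, where
`arctan s = s - s³/3 + s⁵/5 - ⋯`. -/
def coeffA (x : ℝ) (k : ℕ) : ℝ :=
  PowerSeries.coeff (2 * k + 1)
    (formalComp (fun j => if Even j then 0 else (-1) ^ (j / 2) / (j : ℝ))
      (oddSeries x * (evenSeries x)⁻¹))

/-! ### Inversion

With `ν = ξ (1 + y)`, `u = ξ^{-2}`, `ξ log (λξ) = m` and `ℓ = 1 + log (λξ)`, the equation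
`ν log (λν) = m - A₀/ν - A₁/ν³ - ⋯` reads
`ℓ y = - ∑ A_j u^(j+1) (1+y)^(-(2j+1)) - ((1+y) log (1+y) - y)`.
It is solved by `y = b₀ u + b₁ u² + ⋯`, equating coefficients, with `ℓ` kept as a parameter. -/

/-- The coefficient of `u^k` in
`- ∑ A_j u^(j+1) (1+y)^(-(2j+1)) - ((1+y) log (1+y) - y)` for a series `y` without constant
term; here `(1+y) log (1+y) - y = ∑_{j ≥ 2} (-1)^j y^j / (j (j-1))`. -/
def inversionCoeff (A : ℕ → ℝ) (y : PowerSeries ℝ) (k : ℕ) : ℝ :=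
  PowerSeries.coeff k
    (-(∑ j ∈ Finset.range k,
        PowerSeries.C (A j) * PowerSeries.X ^ (j + 1) * ((1 + y)⁻¹) ^ (2 * j + 1))
      - formalComp (fun j => if j < 2 then 0 else (-1) ^ j / ((j : ℝ) * ((j : ℝ) - 1))) y)

/-- `inversionPartial A ℓ k = b₀ u + b₁ u² + ⋯ + b_{k-1} u^k`. The coefficient of `u^(k+1)` on
the right of the equation involves only `b₀, …, b_{k-1}`, and equals `ℓ b_k`. -/
def inversionPartial (A : ℕ → ℝ) (ℓ : ℝ) : ℕ → PowerSeries ℝ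
  | 0 => 0
  | k + 1 => inversionPartial A ℓ k +
      PowerSeries.C (inversionCoeff A (inversionPartial A ℓ k) (k + 1) / ℓ) *
        PowerSeries.X ^ (k + 1)

/-- The coefficient `b_k` in `ν = ξ + b₀/ξ + b₁/ξ³ + b₂/ξ⁵ + ⋯`. -/
def inversionb (A : ℕ → ℝ) (ℓ : ℝ) (k : ℕ) : ℝ :=
  inversionCoeff A (inversionPartial A ℓ k) (k + 1) / ℓ

/-! ### The quantities in the expansion of the `n`-th zero -/

/-- `λ = 2 / (e x)` -/
def lam (x : ℝ) : ℝ := 2 / (Real.exp 1 * x)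

/-- `m₊ = (n + 1/4) π` -/
def mPlus (n : ℕ) : ℝ := ((n : ℝ) + 1 / 4) * Real.pi

/-- `W(λ m₊)` -/
def wPlus (x : ℝ) (n : ℕ) : ℝ := lambertW (lam x * mPlus n)

/-- `ξ = m₊ / W(λ m₊)` -/
def xiPlus (x : ℝ) (n : ℕ) : ℝ := mPlus n / wPlus x n

/-- `b_k` for the `n`-th zero -/
def coeffb (x : ℝ) (n k : ℕ) : ℝ :=
  inversionb (coeffA x) (1 + Real.log (lam x * xiPlus x n)) k

/-- `B_k`, normalized so that `b_k / ξ^(2k+1) = B_k / m₊^(2k+1)`; depends on `n` through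
`ξ / m₊ = 1 / W(λ m₊)`. -/
def coeffB (x : ℝ) (n k : ℕ) : ℝ :=
  coeffb x n k / (xiPlus x n / mPlus n) ^ (2 * k + 1)

end

end Dunster

/-!
With `s = x²/4` write `I_{iν}(x) = (x/2)^{iν} H(ν, s) / Γ(1 + iν)`. For `s ≥ 0` the power series of
`|H(ν, s)|²` has positive coefficients and constant term `1` (`hasSum_normSq_hyp`), so `I_{iν}(x)`
never vanishes and has a continuous phase `Φ`, with `I_{iν}(x) = |I_{iν}(x)| e^{-iΦ(ν, s)}` and
`Φ(0, s) = 0` (`phase`). As `I_{-iν}` is the conjugate of `I_{iν}`, the zeros of `L_{iν}(x)` are the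
solutions of `cos Φ = 0` (`besselL_eq_zero_iff`).

*The zeros are enumerated by `Φ = (n + 1/2) π`.* The Wronskian of `I_{iν}` and `I_{-iν}` gives
`∂Φ/∂s = -ν / (2 s |H|²)` (`hyp_wronskian`, `hasDerivAt_phase`). The coefficients of `|H|²` do not
increase with `ν`, so `∂Φ/∂s` is strictly decreasing in `ν`. Moreover `Φ → 0` as `s → ∞`
(`tendsto_phase_atTop`): the series of `I_{iν}` compared with that of `I_0`, whose weight
concentrates at `k ≈ √s` (`besselWeight_variance`), shows that `I_{iν} / I_0 → 1`, so that `Φ` tends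
to a multiple of `2π`, and this multiple cannot jump as `ν` varies from `0`. Hence `Φ` is strictly
increasing in `ν` (`phase_strictMono`), from `0` to `∞`.

*The expansion of the phase.* Summing the defects of the truncated Stirling series along
`iν + 1, iν + 2, …` gives Stirling's series for `arg Γ(1 + iν)` (`gammaArg_bound`); the defects are
small because of the recursion for the Bernoulli numbers (`coeff_defectSeries`). Together with the
expansion of `H` in powers of `1/(iν)` this gives `Φ = ν log (λν) + π/4 + ∑ A_k ν^{-2k-1}` to all
orders (`phaseDev_sub_isBigO`). The expansions are handled with `HasExpansion`, which is closed
under ring operations, inverses and composition with Taylor series.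

*Inversion.* With `ν = ξ (1 + y)` and `u = ξ^{-2}`, the equation `Φ = (n + 1/2) π` becomes
`ℓ y = F(y)` up to an error `O(u^(N+1))`. The truncated formal solution satisfies the same equation
with the same error, and `F` contracts near `0` while `ℓ → ∞`, so that the difference of the two
solutions is `O(u^(N+1)/ℓ)` (`inversion_error`); the factor `1/ℓ` is what the stated remainder
requires.
-/

section

open Filter Asymptotics PowerSeries Topology

namespace Dunster

/-! ### Asymptotic expansions in powers of a small quantity -/

section AsympExpansion

variable {α 𝕜 : Type*} [RCLike 𝕜] {l : Filter α} {t g g₁ g₂ : α → 𝕜} {p p₁ p₂ : α → PowerSeries 𝕜}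

/-- `g ~ ∑ p_k t^k` along `l`, to all orders: the error of the partial sum of `N` terms is
`O(t^N)`. The coefficients `p_k` may depend on the point, as long as each of them stays
bounded; this covers expansions that are uniform in a bounded parameter. -/
structure HasExpansion (l : Filter α) (t g : α → 𝕜) (p : α → PowerSeries 𝕜) : Prop where
  coeff_bdd : ∀ k, (fun a => coeff k (p a)) =O[l] (fun _ => (1 : 𝕜))
  sub_isBigO : ∀ N, (fun a => g a - ∑ k ∈ Finset.range N, coeff k (p a) * t a ^ k)
    =O[l] (fun a => t a ^ N)

theorem isBigO_one_of_tendsto_zero (ht : Tendsto t l (𝓝 0)) : t =O[l] (fun _ => (1 : 𝕜)) :=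
  ht.isBigO_one 𝕜

theorem isBigO_pow_of_le (ht : Tendsto t l (𝓝 0)) {m n : ℕ} (h : m ≤ n) :
    (fun a => t a ^ n) =O[l] (fun a => t a ^ m) := by
  obtain ⟨d, rfl⟩ := Nat.exists_eq_add_of_le h
  have h1 := (isBigO_refl (fun a => t a ^ m) l).mul ((isBigO_one_of_tendsto_zero ht).pow d)
  simpa [pow_add] using h1

theorem isBigO_mul_of_bdd {u v w : α → 𝕜} (h₁ : u =O[l] (fun _ => (1 : 𝕜))) (h₂ : v =O[l] w) :
    (fun a => u a * v a) =O[l] w := by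
  simpa using h₁.mul h₂

namespace HasExpansion

theorem congr' (h : HasExpansion l t g₁ p) (hg : g₁ =ᶠ[l] g₂) : HasExpansion l t g₂ p := by
  refine ⟨h.coeff_bdd, fun N => (h.sub_isBigO N).congr' ?_ EventuallyEq.rfl⟩
  filter_upwards [hg] with a ha
  rw [ha]

theorem congr_coeff (h : HasExpansion l t g p₁) (hp : ∀ a, p₁ a = p₂ a) :
    HasExpansion l t g p₂ := by
  rwa [← funext hp]

theorem partialSum_bdd (ht : Tendsto t l (𝓝 0)) (h : HasExpansion l t g p) (N : ℕ) :
    (fun a => ∑ k ∈ Finset.range N, coeff k (p a) * t a ^ k) =O[l] (fun _ => (1 : 𝕜)) := by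
  refine IsBigO.fun_sum fun k _ => isBigO_mul_of_bdd (h.coeff_bdd k) ?_
  simpa using isBigO_pow_of_le ht (Nat.zero_le k)

theorem isBigO_one (h : HasExpansion l t g p) : g =O[l] (fun _ => (1 : 𝕜)) := by
  simpa using h.sub_isBigO 0

/-- Expansions may be checked at each order against a series with the right leading terms. -/
theorem of_forall (hb : ∀ k, (fun a => coeff k (p a)) =O[l] (fun _ => (1 : 𝕜)))
    (h : ∀ N, ∃ q : α → PowerSeries 𝕜, ∃ g' : α → 𝕜, HasExpansion l t g' q ∧
      (∀ a, ∀ k < N, coeff k (q a) = coeff k (p a)) ∧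
      (fun a => g a - g' a) =O[l] (fun a => t a ^ N)) :
    HasExpansion l t g p := by
  refine ⟨hb, fun N => ?_⟩
  obtain ⟨q, g', hq, hc, hg⟩ := h N
  refine (hg.add (hq.sub_isBigO N)).congr_left fun a => ?_
  rw [Finset.sum_congr rfl fun k hk => by rw [hc a k (Finset.mem_range.1 hk)]]
  ring

theorem const {c : α → 𝕜} (hc : c =O[l] (fun _ => (1 : 𝕜))) :
    HasExpansion l t c (fun a => C (c a)) := by
  refine ⟨fun k => ?_, fun N => ?_⟩
  · rcases k with _ | k
    · simpa using hc
    · exact (isBigO_zero (fun _ : α => (1 : 𝕜)) l).congr_left fun a => by simp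
  · rcases N with _ | N
    · simpa using hc
    · refine (isBigO_zero (fun a => t a ^ (N + 1)) l).congr_left fun a => ?_
      simp [coeff_C]

theorem zero : HasExpansion l t (fun _ => 0) (fun _ => 0) :=
  (const (isBigO_zero _ _)).congr_coeff fun _ => by simp

theorem one : HasExpansion l t (fun _ => 1) (fun _ => 1) :=
  (const (isBigO_refl _ _)).congr_coeff fun _ => by simp

theorem X (ht : Tendsto t l (𝓝 0)) : HasExpansion l t t (fun _ => PowerSeries.X) := by
  refine ⟨fun k => isBigO_const_const _ one_ne_zero _, fun N => ?_⟩
  rcases N with _ | _ | N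
  · simpa using isBigO_one_of_tendsto_zero ht
  · simpa [coeff_X] using isBigO_refl t l
  · refine (isBigO_zero (fun a => t a ^ (N + 1 + 1)) l).congr_left fun a => ?_
    simp [coeff_X]

theorem add (h₁ : HasExpansion l t g₁ p₁) (h₂ : HasExpansion l t g₂ p₂) :
    HasExpansion l t (fun a => g₁ a + g₂ a) (fun a => p₁ a + p₂ a) := by
  refine ⟨fun k => by simpa using (h₁.coeff_bdd k).add (h₂.coeff_bdd k), fun N => ?_⟩
  refine ((h₁.sub_isBigO N).add (h₂.sub_isBigO N)).congr_left fun a => ?_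
  simp only [map_add, add_mul, Finset.sum_add_distrib]
  ring

theorem neg (h : HasExpansion l t g p) : HasExpansion l t (fun a => -g a) (fun a => -p a) := by
  refine ⟨fun k => by simpa using (h.coeff_bdd k).neg_left, fun N => ?_⟩
  refine (h.sub_isBigO N).neg_left.congr_left fun a => ?_
  simp only [map_neg, neg_mul, Finset.sum_neg_distrib]
  ring

theorem sub (h₁ : HasExpansion l t g₁ p₁) (h₂ : HasExpansion l t g₂ p₂) :
    HasExpansion l t (fun a => g₁ a - g₂ a) (fun a => p₁ a - p₂ a) := by
  simpa only [sub_eq_add_neg] using h₁.add h₂.neg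

theorem sum {ι : Type*} (s : Finset ι) {g : ι → α → 𝕜} {p : ι → α → PowerSeries 𝕜}
    (h : ∀ i ∈ s, HasExpansion l t (g i) (p i)) :
    HasExpansion l t (fun a => ∑ i ∈ s, g i a) (fun a => ∑ i ∈ s, p i a) := by
  classical
  induction s using Finset.induction_on with
  | empty => simpa using zero
  | insert i s hi ih =>
    simp only [Finset.sum_insert hi]
    exact (h i (by simp)).add (ih fun j hj => h j (by simp [hj]))

theorem mul (ht : Tendsto t l (𝓝 0)) (h₁ : HasExpansion l t g₁ p₁) (h₂ : HasExpansion l t g₂ p₂) :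
    HasExpansion l t (fun a => g₁ a * g₂ a) (fun a => p₁ a * p₂ a) := by
  refine ⟨fun k => ?_, fun N => ?_⟩
  · simp only [coeff_mul]
    exact IsBigO.fun_sum fun i _ => isBigO_mul_of_bdd (h₁.coeff_bdd _) (h₂.coeff_bdd _)
  · have key : ∀ a, (∑ i ∈ Finset.range N, coeff i (p₁ a) * t a ^ i) *
        (∑ j ∈ Finset.range N, coeff j (p₂ a) * t a ^ j) -
        ∑ k ∈ Finset.range N, coeff k (p₁ a * p₂ a) * t a ^ k =
        ∑ x ∈ (Finset.range N ×ˢ Finset.range N) with ¬ x.1 + x.2 < N,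
          (coeff x.1 (p₁ a) * coeff x.2 (p₂ a)) * t a ^ (x.1 + x.2) := by
      intro a
      rw [Finset.sum_mul_sum, ← Finset.sum_product', sub_eq_iff_eq_add',
        ← Finset.sum_filter_add_sum_filter_not _ (fun x : ℕ × ℕ => x.1 + x.2 < N)]
      congr 1
      · rw [← Finset.sum_fiberwise_of_maps_to (t := Finset.range N) (g := fun x => x.1 + x.2)
          (by intro x hx; simp at hx ⊢; exact hx.2)]
        refine Finset.sum_congr rfl fun k hk => ?_
        rw [coeff_mul, Finset.sum_mul]
        refine Finset.sum_congr ?_ fun x hx => ?_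
        · ext ⟨i, j⟩
          simp only [Finset.mem_range] at hk
          simp
          omega
        · rw [← Finset.HasAntidiagonal.mem_antidiagonal.1 hx, pow_add]
          ring
      · refine Finset.sum_congr rfl fun x _ => ?_
        rw [pow_add]
        ring
    have h3 : (fun a => ∑ x ∈ (Finset.range N ×ˢ Finset.range N) with ¬ x.1 + x.2 < N,
          (coeff x.1 (p₁ a) * coeff x.2 (p₂ a)) * t a ^ (x.1 + x.2)) =O[l] (fun a => t a ^ N) := by
      refine IsBigO.fun_sum fun x hx => ?_
      simp only [Finset.mem_filter, not_lt] at hx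
      exact isBigO_mul_of_bdd (isBigO_mul_of_bdd (h₁.coeff_bdd _) (h₂.coeff_bdd _))
        (isBigO_pow_of_le ht hx.2)
    have h4 := isBigO_mul_of_bdd h₂.isBigO_one (h₁.sub_isBigO N)
    have h5 := isBigO_mul_of_bdd (h₁.partialSum_bdd ht N) (h₂.sub_isBigO N)
    refine ((h4.add h5).add h3).congr_left fun a => ?_
    rw [← key a]
    ring

theorem pow (ht : Tendsto t l (𝓝 0)) (h : HasExpansion l t g p) (n : ℕ) :
    HasExpansion l t (fun a => g a ^ n) (fun a => p a ^ n) := by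
  induction n with
  | zero => simpa using one
  | succ n ih => simpa only [pow_succ] using ih.mul ht h

theorem prod (ht : Tendsto t l (𝓝 0)) {ι : Type*} (s : Finset ι) {g : ι → α → 𝕜}
    {p : ι → α → PowerSeries 𝕜} (h : ∀ i ∈ s, HasExpansion l t (g i) (p i)) :
    HasExpansion l t (fun a => ∏ i ∈ s, g i a) (fun a => ∏ i ∈ s, p i a) := by
  classical
  induction s using Finset.induction_on with
  | empty => simpa using one
  | insert i s hi ih =>
    simp only [Finset.prod_insert hi]
    exact (h i (by simp)).mul ht (ih fun j hj => h j (by simp [hj]))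

theorem sub_constantCoeff_isBigO (h : HasExpansion l t g p) :
    (fun a => g a - constantCoeff (p a)) =O[l] t := by
  simpa using h.sub_isBigO 1

theorem tendsto {c : 𝕜} (ht : Tendsto t l (𝓝 0)) (h : HasExpansion l t g p)
    (hc : ∀ a, constantCoeff (p a) = c) : Tendsto g l (𝓝 c) := by
  have := h.sub_constantCoeff_isBigO.trans_tendsto ht
  simp only [hc] at this
  simpa using this.add_const c

/-- The partial sums of a series with bounded coefficients have that series as expansion, up to
the order of truncation. -/
theorem partialSum (ht : Tendsto t l (𝓝 0))
    (hb : ∀ k, (fun a => coeff k (p a)) =O[l] (fun _ => (1 : 𝕜))) (N : ℕ) :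
    HasExpansion l t (fun a => ∑ k ∈ Finset.range N, coeff k (p a) * t a ^ k)
      (fun a => ∑ k ∈ Finset.range N, C (coeff k (p a)) * PowerSeries.X ^ k) :=
  sum _ fun k _ => (const (hb k)).mul ht ((X ht).pow ht k)

theorem coeff_inv_bdd (h : HasExpansion l t g p) {c : 𝕜} (hc : ∀ a, constantCoeff (p a) = c)
    (k : ℕ) : (fun a => coeff k (p a)⁻¹) =O[l] (fun _ => (1 : 𝕜)) := by
  induction k using Nat.strong_induction_on with
  | _ k ih =>
    rw [funext fun a => coeff_inv k (p a)]
    simp only [hc]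
    split_ifs with hk
    · exact isBigO_const_const _ one_ne_zero _
    · refine isBigO_mul_of_bdd (isBigO_const_const _ one_ne_zero _) (IsBigO.fun_sum fun x hx => ?_)
      split_ifs with hx'
      · exact isBigO_mul_of_bdd (h.coeff_bdd _) (ih _ hx')
      · exact isBigO_zero _ _

theorem coeff_sum_C_mul_X_pow (q : PowerSeries 𝕜) {N k : ℕ} (hk : k < N) :
    coeff k (∑ j ∈ Finset.range N, C (coeff j q) * PowerSeries.X ^ j) = coeff k q := by
  rw [map_sum, Finset.sum_eq_single k]
  · simp
  · intro j _ hj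
    simp [coeff_X_pow, hj.symm]
  · simp [hk]

theorem inv (ht : Tendsto t l (𝓝 0)) (h : HasExpansion l t g p) {c : 𝕜} (hc0 : c ≠ 0)
    (hc : ∀ a, constantCoeff (p a) = c) :
    HasExpansion l t (fun a => (g a)⁻¹) (fun a => (p a)⁻¹) := by
  have hb := fun k => h.coeff_inv_bdd hc k
  refine of_forall hb fun N => ⟨_, _, partialSum ht hb N, fun a k hk =>
    coeff_sum_C_mul_X_pow _ hk, ?_⟩
  have htend := h.tendsto ht hc
  have h1 := ((h.mul ht (partialSum ht hb N)).sub one).sub_isBigO N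
  -- the product of `p` with the truncation of `p⁻¹` is `1` up to order `N`
  have h2 : (fun a => g a * (∑ k ∈ Finset.range N, coeff k (p a)⁻¹ * t a ^ k) - 1)
      =O[l] (fun a => t a ^ N) := by
    refine h1.congr_left fun a => ?_
    refine (congrArg _ (Finset.sum_eq_zero fun k hk => ?_)).trans (sub_zero _)
    have hk := Finset.mem_range.1 hk
    have : coeff k (p a * ∑ j ∈ Finset.range N, C (coeff j (p a)⁻¹) * PowerSeries.X ^ j) =
        coeff k (p a * (p a)⁻¹) := by
      rw [coeff_mul, coeff_mul]
      refine Finset.sum_congr rfl fun x hx => ?_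
      rw [coeff_sum_C_mul_X_pow]
      have := Finset.HasAntidiagonal.mem_antidiagonal.1 hx
      omega
    rw [map_sub, this, PowerSeries.mul_inv_cancel _ (by rw [hc]; exact hc0)]
    simp
  have h3 : (fun a => (g a)⁻¹) =O[l] (fun _ => (1 : 𝕜)) := (htend.inv₀ hc0).isBigO_one 𝕜
  refine (isBigO_mul_of_bdd h3 h2).neg_left.congr' ?_ EventuallyEq.rfl
  filter_upwards [htend.eventually_ne hc0] with a ha
  field_simp
  ring

end HasExpansion

/-- The formal composition `∑ c_j s^j` over a general field; over `ℝ` it is `formalComp`. -/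
noncomputable def fcomp {R : Type*} [CommRing R] (c : ℕ → R) (s : PowerSeries R) : PowerSeries R :=
  PowerSeries.mk fun k => ∑ j ∈ Finset.range (k + 1), c j * coeff k (s ^ j)

theorem coeff_pow_eq_zero {R : Type*} [CommRing R] {s : PowerSeries R} (hs : constantCoeff s = 0)
    {k j : ℕ} (h : k < j) : coeff k (s ^ j) = 0 :=
  coeff_of_lt_order _ (lt_of_lt_of_le (by exact_mod_cast h)
    (le_order_pow_of_constantCoeff_eq_zero j hs))

theorem coeff_fcomp {R : Type*} [CommRing R] (c : ℕ → R) {s : PowerSeries R}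
    (hs : constantCoeff s = 0) {k N : ℕ} (h : k < N) :
    coeff k (fcomp c s) = coeff k (∑ j ∈ Finset.range N, C (c j) * s ^ j) := by
  simp only [fcomp, coeff_mk, map_sum, coeff_C_mul]
  refine Finset.sum_subset (by intro j; simp; omega) fun j _ hj => ?_
  simp only [Finset.mem_range, not_lt] at hj
  rw [coeff_pow_eq_zero hs (by omega), mul_zero]

theorem map_fcomp {R S : Type*} [CommRing R] [CommRing S] (f : R →+* S) (c : ℕ → R)
    (s : PowerSeries R) : PowerSeries.map f (fcomp c s) = fcomp (fun j => f (c j))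
      (PowerSeries.map f s) := by
  ext k
  simp [fcomp, ← map_pow]

/-- `φ` has the Taylor coefficients `c_j` at `0`, with remainders `O(z^N)`. -/
def HasTaylor (φ : 𝕜 → 𝕜) (c : ℕ → 𝕜) : Prop :=
  ∀ N, (fun z => φ z - ∑ j ∈ Finset.range N, c j * z ^ j) =O[𝓝 0] (fun z => z ^ N)

/-- Asymptotic series may be substituted into Taylor series. -/
theorem HasExpansion.comp (ht : Tendsto t l (𝓝 0)) (h : HasExpansion l t g p)
    (hp : ∀ a, constantCoeff (p a) = 0) {φ : 𝕜 → 𝕜} {c : ℕ → 𝕜} (hφ : HasTaylor φ c) :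
    HasExpansion l t (fun a => φ (g a)) (fun a => fcomp c (p a)) := by
  have hs : ∀ N, HasExpansion l t (fun a => ∑ j ∈ Finset.range N, c j * g a ^ j)
      (fun a => ∑ j ∈ Finset.range N, C (c j) * p a ^ j) := fun N =>
    sum _ fun j _ => (const (isBigO_const_const _ one_ne_zero _)).mul ht (h.pow ht j)
  refine of_forall (fun k => ?_) fun N => ⟨_, _, hs N, fun a k hk =>
    (coeff_fcomp c (hp a) hk).symm, ?_⟩
  · exact ((hs (k + 1)).coeff_bdd k).congr_left fun a => (coeff_fcomp c (hp a) k.lt_succ_self).symm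
  · have h1 := (hφ N).comp_tendsto (h.tendsto ht hp)
    have h2 : g =O[l] t := by simpa [hp] using h.sub_constantCoeff_isBigO
    exact h1.trans (h2.pow N)

/-- A convergent power series is a Taylor expansion. -/
theorem hasTaylor_of_hasSum {φ : 𝕜 → 𝕜} {c : ℕ → 𝕜} {r : ℝ} (hr : 0 < r)
    (h : ∀ z : 𝕜, ‖z‖ < r → HasSum (fun j => c j * z ^ j) (φ z)) : HasTaylor φ c := by
  intro N
  set ρ : ℝ := r / 2 with hρ
  have hρ0 : 0 < ρ := by positivity
  have hsum := h (ρ : 𝕜) (by rw [RCLike.norm_ofReal, abs_of_pos hρ0]; linarith)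
  obtain ⟨B, hB⟩ : ∃ B, ∀ j, ‖c j * (ρ : 𝕜) ^ j‖ ≤ B := by
    obtain ⟨B, hB⟩ := hsum.summable.tendsto_atTop_zero.norm.bddAbove_range
    exact ⟨B, fun j => hB ⟨j, rfl⟩⟩
  have hB' : ∀ j, ‖c j‖ ≤ B * (ρ⁻¹) ^ j := fun j => by
    have := hB j
    rw [norm_mul, norm_pow, RCLike.norm_ofReal, abs_of_pos hρ0] at this
    rw [inv_pow, ← div_eq_mul_inv, le_div_iff₀ (by positivity)]
    exact this
  have hB0 : 0 ≤ B := (norm_nonneg _).trans (hB 0)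
  refine IsBigO.of_bound (B * ρ⁻¹ ^ N * 2) ?_
  have hev : ∀ᶠ z : 𝕜 in 𝓝 0, ‖z‖ < ρ / 2 := by
    have := (continuous_norm (E := 𝕜)).tendsto 0
    rw [norm_zero] at this
    exact this.eventually_lt_const (by positivity)
  filter_upwards [hev] with z hz
  have hz' := (hasSum_nat_add_iff' N).2 (h z (by linarith))
  rw [← hz'.tsum_eq, norm_pow]
  have hq : ‖z‖ * ρ⁻¹ ≤ 1 / 2 := by
    rw [← div_eq_mul_inv, div_le_iff₀ hρ0]; linarith
  have hgeo : HasSum (fun j : ℕ => B * ρ⁻¹ ^ N * ‖z‖ ^ N * (1 / 2 : ℝ) ^ j)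
      (B * ρ⁻¹ ^ N * ‖z‖ ^ N * 2) := hasSum_geometric_two.mul_left _
  have := tsum_of_norm_bounded hgeo (f := fun j => c (j + N) * z ^ (j + N)) fun j => by
    rw [norm_mul, norm_pow, pow_add ‖z‖]
    calc ‖c (j + N)‖ * (‖z‖ ^ j * ‖z‖ ^ N) ≤ (B * ρ⁻¹ ^ (j + N)) * (‖z‖ ^ j * ‖z‖ ^ N) := by
          gcongr; exact hB' _
      _ = B * ρ⁻¹ ^ N * ‖z‖ ^ N * (‖z‖ * ρ⁻¹) ^ j := by rw [pow_add, mul_pow]; ring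
      _ ≤ _ := by gcongr
  linarith

theorem HasTaylor.hasExpansion {φ : 𝕜 → 𝕜} {c : ℕ → 𝕜} (hφ : HasTaylor φ c)
    (ht : Tendsto t l (𝓝 0)) : HasExpansion l t (fun a => φ (t a)) (fun _ => PowerSeries.mk c) :=
  ⟨fun k => isBigO_const_const _ one_ne_zero _, fun N => by
    simpa [Function.comp_def] using (hφ N).comp_tendsto ht⟩

/-- A fixed asymptotic power series at `0` gives Taylor coefficients. -/
theorem HasExpansion.hasTaylor {φ : 𝕜 → 𝕜} {q : PowerSeries 𝕜}
    (h : HasExpansion (𝓝 0) (fun z : 𝕜 => z) φ (fun _ => q)) : HasTaylor φ (fun j => coeff j q) :=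
  h.sub_isBigO

end AsympExpansion

/-! ### Formal identities for the coefficients -/

/-- A composition of odd series is odd. -/
theorem coeff_fcomp_eq_zero_of_odd {R : Type*} [Field R] [CharZero R] {c : ℕ → R}
    {s : PowerSeries R} (hc : ∀ j, Even j → c j = 0) (hs : rescale (-1) s = -s) {k : ℕ}
    (hk : Even k) : coeff k (fcomp c s) = 0 := by
  rw [fcomp, coeff_mk]
  refine Finset.sum_eq_zero fun j _ => ?_
  rcases Nat.even_or_odd j with hj | hj
  · rw [hc j hj, zero_mul]
  · have h1 : rescale (-1) (s ^ j) = -s ^ j := by rw [map_pow, hs, hj.neg_pow]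
    have h2 := congrArg (coeff k) h1
    rw [coeff_rescale, hk.neg_one_pow, one_mul, map_neg, eq_neg_iff_add_eq_zero, ← two_mul] at h2
    rw [(mul_eq_zero.1 h2).resolve_left two_ne_zero, mul_zero]

theorem coeffa_zero (x : ℝ) : coeffa x 0 = 1 := by
  simp [coeffa, stirlingGamma, coeffC, formalComp]

theorem constantCoeff_evenSeries (x : ℝ) : constantCoeff (evenSeries x) = 1 := by
  rw [← coeff_zero_eq_constantCoeff_apply]
  simp [evenSeries, coeffa_zero]

theorem constantCoeff_oddSeries (x : ℝ) : constantCoeff (oddSeries x) = 0 := by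
  rw [← coeff_zero_eq_constantCoeff_apply]
  simp [oddSeries]

/-- The argument of the arctangent in the definition of `A_k` is an odd series. -/
theorem rescale_ratio (x : ℝ) : rescale (-1) (oddSeries x * (evenSeries x)⁻¹) =
    -(oddSeries x * (evenSeries x)⁻¹) := by
  have hE : rescale (-1) (evenSeries x) = evenSeries x := by
    ext k
    rw [coeff_rescale, evenSeries, coeff_mk]
    split_ifs with h
    · rw [h.neg_one_pow, one_mul]
    · simp
  have hO : rescale (-1) (oddSeries x) = -oddSeries x := by
    ext k
    rw [coeff_rescale, map_neg, oddSeries, coeff_mk]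
    split_ifs with h
    · simp
    · rw [(Nat.not_even_iff_odd.1 h).neg_one_pow, neg_one_mul]
  have h1 : constantCoeff (evenSeries x) ≠ 0 := by rw [constantCoeff_evenSeries]; exact one_ne_zero
  have h2 : rescale (-1) ((evenSeries x)⁻¹) = (evenSeries x)⁻¹ := by
    rw [eq_inv_iff_mul_eq_one h1]
    nth_rw 2 [← hE]
    rw [← map_mul, PowerSeries.inv_mul_cancel _ h1, map_one]
  rw [map_mul, hO, h2, neg_mul]

/-- The Taylor coefficients of `arctan`. -/
noncomputable def arctanCoeff (j : ℕ) : ℝ := if Even j then 0 else (-1) ^ (j / 2) / (j : ℝ)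

theorem coeffA_explicit (x : ℝ) :
    let a : ℕ → ℝ := coeffa x
    coeffA x 0 = a 1 ∧
    coeffA x 1 = a 1 * a 2 - a 3 - 1 / 3 * a 1 ^ 3 ∧
    coeffA x 2 = a 1 * a 2 ^ 2 + a 1 ^ 2 * a 3 - a 1 ^ 3 * a 2 - a 2 * a 3 - a 1 * a 4
        + a 5 + 1 / 5 * a 1 ^ 5 := by
  intro a
  set s := oddSeries x * (evenSeries x)⁻¹ with hs
  have h1 : constantCoeff (evenSeries x) ≠ 0 := by rw [constantCoeff_evenSeries]; exact one_ne_zero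
  have hmul : s * evenSeries x = oddSeries x := by
    rw [hs, mul_assoc, PowerSeries.inv_mul_cancel _ h1, mul_one]
  have e0 : coeff 0 (evenSeries x) = 1 := by simp [evenSeries, coeffa_zero]
  have e1 : coeff 1 (evenSeries x) = 0 := by simp [evenSeries]
  have e2 : coeff 2 (evenSeries x) = -a 2 := by simp [evenSeries, a]
  have e3 : coeff 3 (evenSeries x) = 0 := by
    simp [evenSeries, show ¬ Even 3 by decide]
  have e4 : coeff 4 (evenSeries x) = a 4 := by simp [evenSeries, a, show Even 4 by decide]
  have e5 : coeff 5 (evenSeries x) = 0 := by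
    simp [evenSeries, show ¬ Even 5 by decide]
  have hk : ∀ k, coeff k (s * evenSeries x) = coeff k (oddSeries x) := fun k => by rw [hmul]
  have s0 : coeff 0 s = 0 := by simp [hs, constantCoeff_oddSeries]
  have s1 : coeff 1 s = a 1 := by
    have := hk 1
    simp [coeff_mul, Finset.Nat.antidiagonal_succ, oddSeries, e0, e1, s0] at this
    simpa [← coeff_zero_eq_constantCoeff_apply, e0, s0] using this
  have s2 : coeff 2 s = 0 := by
    have := hk 2
    simp [coeff_mul, Finset.Nat.antidiagonal_succ, oddSeries, e1, e2] at this
    simpa [← coeff_zero_eq_constantCoeff_apply, e0, s0] using this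
  have s3 : coeff 3 s = a 1 * a 2 - a 3 := by
    have := hk 3
    simp [coeff_mul, Finset.Nat.antidiagonal_succ, oddSeries, e1, e2, e3, s1, s2,
      show ¬ Even 3 by decide] at this
    simp [← coeff_zero_eq_constantCoeff_apply, e0] at this
    linarith
  have s4 : coeff 4 s = 0 := by
    have := hk 4
    simp [coeff_mul, Finset.Nat.antidiagonal_succ, oddSeries, e1, e2, e3, e4, s1, s2, s3,
      show Even 4 by decide] at this
    simpa [← coeff_zero_eq_constantCoeff_apply, e0, s0] using this
  have s5 : coeff 5 s = a 5 + (a 1 * a 2 - a 3) * a 2 - a 1 * a 4 := by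
    have := hk 5
    simp [coeff_mul, Finset.Nat.antidiagonal_succ, oddSeries, e1, e2, e3, e4, e5, s1, s2, s3, s4,
      show ¬ Even 5 by decide] at this
    simp [← coeff_zero_eq_constantCoeff_apply, e0] at this
    change _ = a 5 at this
    linarith
  have p3 : ∀ k, coeff k (s ^ 3) = coeff k (s * s * s) := fun k => by ring_nf
  have p5 : ∀ k, coeff k (s ^ 5) = coeff k (s * s * s * s * s) := fun k => by ring_nf
  have s0' : constantCoeff s = 0 := by rw [← coeff_zero_eq_constantCoeff_apply, s0]
  refine ⟨?_, ?_, ?_⟩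
  · simp [coeffA, formalComp, Finset.sum_range_succ, ← hs, s1]
  · simp only [coeffA, formalComp, ← hs, coeff_mk, Nat.reduceMul, Nat.reduceAdd,
      Finset.sum_range_succ, Finset.sum_range_zero, p3, pow_one]
    simp [coeff_mul, Finset.Nat.antidiagonal_succ, s0', s1, s2, s3, show ¬ Even 3 by decide]
    ring
  · have z4 : Even 4 := by decide
    have z3 : ¬ Even 3 := by decide
    have z5 : ¬ Even 5 := by decide
    simp only [coeffA, formalComp, ← hs, coeff_mk, Nat.reduceMul, Nat.reduceAdd,
      Finset.sum_range_succ, Finset.sum_range_zero, p3, p5, pow_one]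
    simp [coeff_mul, Finset.Nat.antidiagonal_succ, s0', s1, s2, s3, s4, s5, z3, z4, z5]
    ring

/-! ### The formal inversion -/

/-- The Taylor coefficients of `(1 + y) log (1 + y) - y`. -/
noncomputable def entropyCoeff (j : ℕ) : ℝ :=
  if j < 2 then 0 else (-1) ^ j / ((j : ℝ) * ((j : ℝ) - 1))

/-- The right-hand side of the inversion equation, with `M` terms of the phase correction. -/
noncomputable def inversionRhs (A : ℕ → ℝ) (M : ℕ) (y : PowerSeries ℝ) : PowerSeries ℝ :=
  -(∑ j ∈ Finset.range M, C (A j) * X ^ (j + 1) * ((1 + y)⁻¹) ^ (2 * j + 1)) - fcomp entropyCoeff y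

theorem coeff_inversionRhs (A : ℕ → ℝ) {k M : ℕ} (h : k ≤ M) (y : PowerSeries ℝ) :
    coeff k (inversionRhs A M y) = inversionCoeff A y k := by
  rw [inversionRhs, inversionCoeff]
  simp only [map_sub, map_neg, map_sum]
  congr 2
  symm
  refine Finset.sum_subset (by intro j; simp; omega) fun j _ hj => ?_
  simp only [Finset.mem_range, not_lt] at hj
  rw [mul_assoc, coeff_C_mul, coeff_X_pow_mul', if_neg (by omega), mul_zero]

/-- The coefficient of `u^k` on the right of the inversion equation involves only the
coefficients of lower order of the unknown. -/
theorem inversionCoeff_congr (A : ℕ → ℝ) {k : ℕ} {y y' : PowerSeries ℝ}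
    (hy : constantCoeff y = 0) (hy' : constantCoeff y' = 0) (h : X ^ k ∣ y - y') :
    inversionCoeff A y k = inversionCoeff A y' k := by
  have h1 : constantCoeff (1 + y) ≠ 0 := by simp [hy]
  have h1' : constantCoeff (1 + y') ≠ 0 := by simp [hy']
  have hinv : X ^ k ∣ (1 + y)⁻¹ - (1 + y')⁻¹ := by
    have : (1 + y)⁻¹ - (1 + y')⁻¹ = (y - y') * (-((1 + y)⁻¹ * (1 + y')⁻¹)) := by
      have e1 := PowerSeries.mul_inv_cancel _ h1
      have e1' := PowerSeries.mul_inv_cancel _ h1'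
      linear_combination (1 + y)⁻¹ * (-e1') - (1 + y')⁻¹ * (-e1)
    rw [this]
    exact h.mul_right _
  have hkey : X ^ (k + 1) ∣ inversionRhs A k y - inversionRhs A k y' +
      (fcomp entropyCoeff y - fcomp entropyCoeff y') := by
    have : inversionRhs A k y - inversionRhs A k y' +
      (fcomp entropyCoeff y - fcomp entropyCoeff y') = ∑ j ∈ Finset.range k,
        -(C (A j) * X ^ (j + 1) * (((1 + y)⁻¹) ^ (2 * j + 1) - ((1 + y')⁻¹) ^ (2 * j + 1))) := by
      simp only [inversionRhs, mul_sub, Finset.sum_neg_distrib, Finset.sum_sub_distrib]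
      ring
    rw [this]
    refine Finset.dvd_sum fun j _ => (Dvd.dvd.neg_right ?_)
    have h2 := mul_dvd_mul (dvd_mul_left (X : PowerSeries ℝ) (C (A j) * X ^ j))
      (hinv.trans (sub_dvd_pow_sub_pow _ _ (2 * j + 1)))
    rw [pow_succ' X k, pow_succ X j]
    convert h2 using 1
    ring
  have hcomp : coeff k (fcomp entropyCoeff y) = coeff k (fcomp entropyCoeff y') := by
    simp only [fcomp, coeff_mk]
    refine Finset.sum_congr rfl fun j _ => ?_
    rcases lt_or_ge j 2 with hj | hj
    · simp [entropyCoeff, hj]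
    · congr 1
      rw [← sub_eq_zero, ← map_sub]
      have hX : X ∣ (∑ i ∈ Finset.range j, y ^ i * y' ^ (j - 1 - i)) := by
        refine Finset.dvd_sum fun i hi => ?_
        rcases Nat.eq_zero_or_pos i with rfl | hi0
        · exact ((X_dvd_iff.2 hy').trans (dvd_pow_self _ (by omega))).mul_left _
        · exact ((X_dvd_iff.2 hy).trans (dvd_pow_self _ (by omega))).mul_right _
      have := mul_dvd_mul hX h
      rw [Commute.geom_sum₂_mul (Commute.all y y'), ← pow_succ'] at this
      exact X_pow_dvd_iff.1 this k k.lt_succ_self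
  have := X_pow_dvd_iff.1 hkey k k.lt_succ_self
  rw [map_add, map_sub, map_sub, hcomp, sub_self, add_zero, sub_eq_zero,
    coeff_inversionRhs A le_rfl, coeff_inversionRhs A le_rfl] at this
  exact this

theorem inversionPartial_eq_sum (A : ℕ → ℝ) (ℓ : ℝ) (N : ℕ) :
    inversionPartial A ℓ N = ∑ k ∈ Finset.range N, C (inversionb A ℓ k) * X ^ (k + 1) := by
  induction N with
  | zero => rfl
  | succ N ih => rw [Finset.sum_range_succ, ← ih]; rfl

theorem constantCoeff_inversionPartial (A : ℕ → ℝ) (ℓ : ℝ) (N : ℕ) :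
    constantCoeff (inversionPartial A ℓ N) = 0 := by
  rw [inversionPartial_eq_sum, map_sum]
  exact Finset.sum_eq_zero fun k _ => by simp

theorem coeff_succ_inversionPartial (A : ℕ → ℝ) (ℓ : ℝ) {N k : ℕ} (h : k < N) :
    coeff (k + 1) (inversionPartial A ℓ N) = inversionb A ℓ k := by
  rw [inversionPartial_eq_sum, map_sum, Finset.sum_eq_single k]
  · simp
  · intro j _ hj
    simp [coeff_X_pow, hj.symm]
  · simp [h]

theorem X_pow_dvd_inversionPartial_sub (A : ℕ → ℝ) (ℓ : ℝ) {N k : ℕ} (h : k ≤ N) :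
    X ^ (k + 1) ∣ inversionPartial A ℓ N - inversionPartial A ℓ k := by
  rw [X_pow_dvd_iff]
  intro m hm
  rcases m with _ | m
  · simp [constantCoeff_inversionPartial]
  · rw [map_sub, coeff_succ_inversionPartial A ℓ (by omega),
      coeff_succ_inversionPartial A ℓ (by omega), sub_self]

/-- The partial sums of the formal inversion solve the inversion equation to their order. -/
theorem coeff_inversionRhs_inversionPartial (A : ℕ → ℝ) {ℓ : ℝ} (hℓ : ℓ ≠ 0) {N k : ℕ}
    (h : k ≤ N) : coeff k (inversionRhs A N (inversionPartial A ℓ N)) =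
      ℓ * coeff k (inversionPartial A ℓ N) := by
  rw [coeff_inversionRhs A h]
  rcases k with _ | k
  · simp [inversionCoeff, formalComp, constantCoeff_inversionPartial]
  · rw [coeff_succ_inversionPartial A ℓ h, inversionb, mul_div_cancel₀ _ hℓ]
    exact inversionCoeff_congr A (constantCoeff_inversionPartial _ _ _)
      (constantCoeff_inversionPartial _ _ _) (X_pow_dvd_inversionPartial_sub A ℓ (by omega))

theorem inversionCoeff_small (A : ℕ → ℝ) {y : PowerSeries ℝ} (hy : constantCoeff y = 0) :
    inversionCoeff A y 1 = -A 0 ∧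
    inversionCoeff A y 2 = A 0 * coeff 1 y - A 1 - 1 / 2 * coeff 1 y ^ 2 ∧
    inversionCoeff A y 3 = 3 * A 1 * coeff 1 y - A 0 * (coeff 1 y ^ 2 - coeff 2 y) - A 2
      - coeff 1 y * coeff 2 y + 1 / 6 * coeff 1 y ^ 3 := by
  set v := (1 + y)⁻¹ with hv
  have h1 : constantCoeff (1 + y) ≠ 0 := by simp [hy]
  have hmul : v * (1 + y) = 1 := PowerSeries.inv_mul_cancel _ h1
  have v0 : constantCoeff v = 1 := by simp [hv, hy]
  have v1 : coeff 1 v = -coeff 1 y := by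
    have := congrArg (coeff 1) hmul
    simp [coeff_mul, Finset.Nat.antidiagonal_succ, v0, hy, coeff_one] at this
    linarith
  have v2 : coeff 2 v = coeff 1 y ^ 2 - coeff 2 y := by
    have := congrArg (coeff 2) hmul
    simp [coeff_mul, Finset.Nat.antidiagonal_succ, v0, v1, hy, coeff_one] at this
    linarith
  refine ⟨?_, ?_, ?_⟩
  · simp [inversionCoeff, formalComp, Finset.sum_range_succ, ← hv, mul_assoc, v0]
  · simp [inversionCoeff, formalComp, Finset.sum_range_succ, ← hv, mul_assoc, v0, pow_succ,
      coeff_mul, Finset.Nat.antidiagonal_succ, hy, v1, coeff_X]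
    ring
  · simp [inversionCoeff, formalComp, Finset.sum_range_succ, ← hv, mul_assoc, v0, pow_succ,
      coeff_mul, Finset.Nat.antidiagonal_succ, hy, v1, v2, coeff_X]
    ring

theorem inversionb_explicit (A : ℕ → ℝ) (ℓ : ℝ) :
    let b₀ : ℝ := -A 0 / ℓ
    let b₁ : ℝ := (A 0 * b₀ - A 1 - 1 / 2 * b₀ ^ 2) / ℓ
    inversionb A ℓ 0 = b₀ ∧ inversionb A ℓ 1 = b₁ ∧
    inversionb A ℓ 2 = (3 * A 1 * b₀ - A 0 * (b₀ ^ 2 - b₁) - A 2 - b₀ * b₁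
        + 1 / 6 * b₀ ^ 3) / ℓ := by
  intro b₀ b₁
  have hs := fun N => inversionCoeff_small A (constantCoeff_inversionPartial A ℓ N)
  have h0 : inversionb A ℓ 0 = b₀ := by rw [inversionb, (hs 0).1]
  have h1 : inversionb A ℓ 1 = b₁ := by
    rw [inversionb, (hs 1).2.1, coeff_succ_inversionPartial A ℓ (by norm_num : 0 < 1), h0]
  refine ⟨h0, h1, ?_⟩
  rw [inversionb, (hs 2).2.2, coeff_succ_inversionPartial A ℓ (by norm_num : 0 < 2), h0,
    coeff_succ_inversionPartial A ℓ (by norm_num : 1 < 2), h1]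

/-! ### The formal Stirling series -/

/-- The recursion for the Bernoulli numbers, in terms of the Stirling coefficients
`B_{i+2} / ((i+1)(i+2))`. -/
theorem sum_choose_mul_bernoulli (n : ℕ) :
    ∑ i ∈ Finset.range n, (n.choose i : ℚ) * (bernoulli (i + 2) / (((i : ℚ) + 1) * (i + 2))) =
      1 / ((n : ℚ) + 2) - 1 / (2 * (n + 1)) := by
  have h := sum_bernoulli (n + 2)
  rw [if_neg (by omega), Finset.sum_range_succ', Finset.sum_range_succ'] at h
  simp only [zero_add, Nat.choose_one_right, Nat.choose_zero_right, bernoulli_zero,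
    bernoulli_one] at h
  have h2 : ∀ i : ℕ, (n.choose i : ℚ) * (bernoulli (i + 2) / (((i : ℚ) + 1) * (i + 2))) =
      ((n + 2).choose (i + 1 + 1) : ℚ) * bernoulli (i + 1 + 1) / ((n + 1) * (n + 2)) := fun i => by
    have e1 : ((n : ℚ) + 1) * n.choose i = (n + 1).choose (i + 1) * (i + 1) := by
      exact_mod_cast Nat.add_one_mul_choose_eq n i
    have e2 : ((n : ℚ) + 2) * (n + 1).choose (i + 1) = (n + 2).choose (i + 2) * (i + 2) := by
      exact_mod_cast Nat.add_one_mul_choose_eq (n + 1) (i + 1)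
    have : ((n + 2).choose (i + 1 + 1) : ℚ) * ((i + 1) * (i + 2)) =
        (n + 1) * (n + 2) * n.choose i := by
      linear_combination -(i + 1 : ℚ) * e2 - ((n : ℚ) + 2) * e1
    field_simp
    linear_combination -bernoulli (i + 2) * this
  rw [Finset.sum_congr rfl fun i _ => h2 i, ← Finset.sum_div]
  have h3 : ∑ i ∈ Finset.range n, ((n + 2).choose (i + 1 + 1) : ℚ) * bernoulli (i + 1 + 1) =
      n / 2 := by
    push_cast at h
    linarith
  rw [h3]
  field_simp
  ring

/-- The coefficients `B_{k+2} / ((k+1)(k+2))` of `z^{-(k+1)}` in Stirling's series. -/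
noncomputable def stirlingBeta (k : ℕ) : ℂ :=
  ((bernoulli (k + 2) : ℚ) : ℂ) / (((k : ℂ) + 1) * (k + 2))

/-- With `t = 1/w` this is `t` times the formal defect `s(w) - s(w-1) - log w` of the truncated
Stirling series `s(z) = z log z - z + (log z)/2 + ∑_{k<M} β_k z^{-(k+1)}`. -/
noncomputable def defectSeries (M : ℕ) : PowerSeries ℂ :=
  (1 - C (1 / 2) * X) * PowerSeries.mk (fun n => 1 / (n : ℂ)) - X +
    ∑ k ∈ Finset.range M, C (stirlingBeta k) * (X ^ (k + 2) - X ^ (k + 2) * ((1 - X)⁻¹) ^ (k + 1))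

/-- The recursion for the Bernoulli numbers makes the defect of the truncated Stirling series
vanish to order `M + 2`. -/
theorem coeff_defectSeries (M m : ℕ) (h : m ≤ M + 2) : coeff m (defectSeries M) = 0 := by
  have hinv : (1 - X : PowerSeries ℂ)⁻¹ = PowerSeries.mk 1 :=
    (PowerSeries.inv_eq_iff_mul_eq_one (by simp)).2 (mk_one_mul_one_sub_eq_one ℂ)
  rw [defectSeries]
  simp only [hinv, mk_one_pow_eq_mk_choose_add, sub_mul, one_mul, mul_assoc, map_sub, map_add,
    map_sum, coeff_C_mul]
  rcases m with _ | _ | n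
  · simp
  · simp [coeff_X_pow_mul', coeff_X_pow]
  · have h1 : coeff (n + 2) (X * PowerSeries.mk (fun n => 1 / (n : ℂ))) = 1 / ((n : ℂ) + 1) := by
      rw [show n + 2 = (n + 1) + 1 from rfl, coeff_succ_X_mul, coeff_mk]
      push_cast; rfl
    have h2 : ∑ k ∈ Finset.range M, stirlingBeta k * (coeff (n + 2) (X ^ (k + 2)) -
        coeff (n + 2) (X ^ (k + 2) * PowerSeries.mk fun i => (((k + i).choose k : ℕ) : ℂ))) =
        -∑ k ∈ Finset.range n, stirlingBeta k * (n.choose k : ℂ) := by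
      rw [← Finset.sum_neg_distrib]
      symm
      refine (Finset.sum_congr rfl fun k hk => ?_).trans
        (Finset.sum_subset (s₁ := Finset.range n) (by intro j; simp; omega) fun k _ hk => ?_)
      · have := Finset.mem_range.1 hk
        rw [coeff_X_pow_mul', if_pos (by omega), coeff_X_pow, if_neg (by omega), coeff_mk,
          show k + (n + 2 - (k + 2)) = n by omega]
        ring
      · simp only [Finset.mem_range, not_lt] at hk
        rcases hk.eq_or_lt with rfl | hk
        · simp [coeff_X_pow_mul', coeff_X_pow]
        · rw [coeff_X_pow_mul', if_neg (by omega), coeff_X_pow, if_neg (by omega)]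
          simp
    have h3 := congrArg (fun q : ℚ => (q : ℂ)) (sum_choose_mul_bernoulli n)
    simp only [Rat.cast_sum, Rat.cast_mul, Rat.cast_div, Rat.cast_natCast, Rat.cast_add,
      Rat.cast_sub, Rat.cast_one, Rat.cast_ofNat] at h3
    rw [h2, h1, coeff_mk, coeff_X, if_neg (by omega),
      Finset.sum_congr rfl fun k _ => mul_comm (stirlingBeta k) _]
    simp only [stirlingBeta]
    rw [h3]
    have : (n : ℂ) + 1 ≠ 0 := by exact_mod_cast n.succ_ne_zero
    have : (n : ℂ) + 2 ≠ 0 := by exact_mod_cast (n + 1).succ_ne_zero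
    push_cast
    rw [show (n : ℂ) + 1 + 1 = n + 2 by ring]
    field_simp
    ring

end Dunster

end

section

open Filter Asymptotics Topology

namespace Dunster

theorem hasSum_of_eq {E : Type*} [AddCommMonoid E] [TopologicalSpace E] {f g : ℕ → E} {a b : E}
    (h : HasSum f a) (hf : ∀ k, g k = f k) (hab : b = a) : HasSum g b := by
  rw [funext hf, hab]
  exact h

/-! ### Entire functions with rapidly decreasing coefficients -/

/-- `∑ c_k s^k` for real `s`. -/
noncomputable def powerSum (c : ℕ → ℂ) (s : ℝ) : ℂ := ∑' k, c k * (s : ℂ) ^ k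

theorem summable_powerSum {c : ℕ → ℂ} (hc : ∀ k, ‖c k‖ ≤ 1 / k.factorial) (s : ℝ) :
    Summable fun k => ‖c k * (s : ℂ) ^ k‖ := by
  refine Summable.of_nonneg_of_le (fun k => norm_nonneg _) (fun k => ?_)
    (Real.summable_pow_div_factorial |s|)
  rw [norm_mul, norm_pow, Complex.norm_real, Real.norm_eq_abs, div_eq_inv_mul, inv_eq_one_div]
  gcongr
  exact hc k

theorem hasSum_powerSum {c : ℕ → ℂ} (hc : ∀ k, ‖c k‖ ≤ 1 / k.factorial) (s : ℝ) :
    HasSum (fun k => c k * (s : ℂ) ^ k) (powerSum c s) :=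
  (summable_powerSum hc s).of_norm.hasSum

theorem norm_powerSum_le {c : ℕ → ℂ} {B : ℝ} (hc : ∀ k, ‖c k‖ ≤ B / k.factorial) (s : ℝ) :
    ‖powerSum c s‖ ≤ B * Real.exp |s| := by
  have h : HasSum (fun k : ℕ => B * (|s| ^ k / k.factorial)) (B * Real.exp |s|) := by
    rw [Real.exp_eq_exp_ℝ]
    exact (NormedSpace.expSeries_div_hasSum_exp |s|).mul_left B
  refine tsum_of_norm_bounded h fun k => ?_
  rw [norm_mul, norm_pow, Complex.norm_real, Real.norm_eq_abs]
  calc ‖c k‖ * |s| ^ k ≤ B / k.factorial * |s| ^ k := by gcongr; exact hc k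
    _ = _ := by ring

theorem hasDerivAt_powerSum {c : ℕ → ℂ} (hc : ∀ k, ‖c k‖ ≤ 1 / k.factorial)
    (hc' : ∀ k : ℕ, ‖((k : ℂ) + 1) * c (k + 1)‖ ≤ 1 / k.factorial) (s : ℝ) :
    HasDerivAt (powerSum c) (powerSum (fun k : ℕ => ((k : ℂ) + 1) * c (k + 1)) s) s := by
  set R : ℝ := |s| + 1
  have hR : 0 ≤ R := by positivity
  have hu : Summable fun k : ℕ => (k : ℝ) * (1 / k.factorial * R ^ (k - 1)) := by
    rw [← summable_nat_add_iff 1]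
    refine (Real.summable_pow_div_factorial R).congr fun k => ?_
    rw [Nat.add_sub_cancel, Nat.factorial_succ]
    push_cast
    have : (k.factorial : ℝ) ≠ 0 := by positivity
    have : (k : ℝ) + 1 ≠ 0 := by positivity
    field_simp
  have h := hasDerivAt_tsum_of_isPreconnected (𝕜 := ℝ) (F := ℂ) (t := Metric.ball (0 : ℝ) R)
    (g := fun k (x : ℝ) => c k * (x : ℂ) ^ k)
    (g' := fun k (x : ℝ) => c k * ((k : ℂ) * (x : ℂ) ^ (k - 1))) (y₀ := 0) (y := s) hu
    Metric.isOpen_ball (convex_ball _ _).isPreconnected ?_ ?_ ?_ ?_ ?_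
  · have hs' : powerSum (fun k : ℕ => ((k : ℂ) + 1) * c (k + 1)) s =
        ∑' k : ℕ, c k * ((k : ℂ) * (s : ℂ) ^ (k - 1)) := by
      have h1 := hasSum_powerSum hc' s
      refine HasSum.tsum_eq ((hasSum_nat_add_iff' 1).1 ?_) |>.symm
      refine hasSum_of_eq h1 (fun k => ?_) (by simp)
      push_cast
      ring
    rw [hs']
    exact h
  · intro k x _
    have := ((hasDerivAt_pow k (x : ℂ)).comp_ofReal).const_mul (c k)
    simpa using this
  · intro k x hx
    have hx : |x| ≤ R := by simpa using (mem_ball_zero_iff.1 hx).le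
    rw [norm_mul, norm_mul, norm_pow, Complex.norm_real, Real.norm_eq_abs, Complex.norm_natCast]
    calc ‖c k‖ * (k * |x| ^ (k - 1)) ≤ (1 / k.factorial) * (k * R ^ (k - 1)) := by
          gcongr; exact hc k
      _ = _ := by ring
  · simp [R]; positivity
  · exact (summable_powerSum hc 0).of_norm
  · simp [R]

/-! ### The hypergeometric factor of the Bessel function -/

/-- The rising factorial `(1 + iν)_k`. -/
noncomputable def poch (ν : ℝ) (k : ℕ) : ℂ := (ascPochhammer ℂ k).eval (1 + Complex.I * ν)

theorem poch_zero (ν : ℝ) : poch ν 0 = 1 := by simp [poch]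

theorem poch_succ (ν : ℝ) (k : ℕ) :
    poch ν (k + 1) = poch ν k * ((k : ℂ) + 1 + Complex.I * ν) := by
  rw [poch, ascPochhammer_succ_eval, poch]
  ring

theorem normSq_factor (ν : ℝ) (k : ℕ) :
    Complex.normSq ((k : ℂ) + 1 + Complex.I * ν) = ((k : ℝ) + 1) ^ 2 + ν ^ 2 := by
  simp [Complex.normSq_apply]
  ring

theorem succ_le_norm_factor (ν : ℝ) (k : ℕ) :
    (k : ℝ) + 1 ≤ ‖(k : ℂ) + 1 + Complex.I * ν‖ := by
  have := Complex.re_le_norm ((k : ℂ) + 1 + Complex.I * ν)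
  simpa using this

theorem abs_le_norm_factor (ν : ℝ) (k : ℕ) : |ν| ≤ ‖(k : ℂ) + 1 + Complex.I * ν‖ := by
  have := Complex.abs_im_le_norm ((k : ℂ) + 1 + Complex.I * ν)
  simpa using this

theorem factor_ne_zero (ν : ℝ) (k : ℕ) : (k : ℂ) + 1 + Complex.I * ν ≠ 0 := by
  rw [← norm_pos_iff]
  exact lt_of_lt_of_le (by positivity) (succ_le_norm_factor ν k)

theorem factorial_le_norm_poch (ν : ℝ) (k : ℕ) : (k.factorial : ℝ) ≤ ‖poch ν k‖ := by
  induction k with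
  | zero => simp [poch_zero]
  | succ k ih =>
    rw [poch_succ, norm_mul, Nat.factorial_succ, mul_comm]
    push_cast
    exact mul_le_mul ih (succ_le_norm_factor ν k) (by positivity) (by positivity)

theorem poch_ne_zero (ν : ℝ) (k : ℕ) : poch ν k ≠ 0 := by
  rw [← norm_pos_iff]
  exact lt_of_lt_of_le (by positivity) (factorial_le_norm_poch ν k)

/-- The coefficients `1 / (k! (1 + iν)_k)`. -/
noncomputable def hcoef (ν : ℝ) (k : ℕ) : ℂ := 1 / ((k.factorial : ℂ) * poch ν k)

theorem norm_hcoef (ν : ℝ) (k : ℕ) : ‖hcoef ν k‖ = 1 / (k.factorial * ‖poch ν k‖) := by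
  rw [hcoef, norm_div, norm_mul, norm_one, Complex.norm_natCast]

theorem norm_hcoef_le (ν : ℝ) (k : ℕ) : ‖hcoef ν k‖ ≤ 1 / (k.factorial * k.factorial) := by
  rw [norm_hcoef]
  gcongr
  exact factorial_le_norm_poch ν k

theorem hcoef_zero (ν : ℝ) : hcoef ν 0 = 1 := by simp [hcoef, poch_zero]

theorem hcoef_succ (ν : ℝ) (k : ℕ) :
    ((k : ℂ) + 1) * ((k : ℂ) + 1 + Complex.I * ν) * hcoef ν (k + 1) = hcoef ν k := by
  rw [hcoef, hcoef, poch_succ, Nat.factorial_succ]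
  have := poch_ne_zero ν k
  have := factor_ne_zero ν k
  have : (k.factorial : ℂ) ≠ 0 := by exact_mod_cast k.factorial_ne_zero
  have : (k : ℂ) + 1 ≠ 0 := by exact_mod_cast k.succ_ne_zero
  push_cast
  field_simp

theorem norm_hcoef_le' (ν : ℝ) (k : ℕ) : ‖hcoef ν k‖ ≤ 1 / k.factorial := by
  refine (norm_hcoef_le ν k).trans ?_
  have : (1 : ℝ) ≤ k.factorial := by exact_mod_cast k.factorial_pos
  gcongr
  nlinarith

theorem norm_succ (k : ℕ) : ‖(k : ℂ) + 1‖ = (k : ℝ) + 1 := by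
  rw [← Nat.cast_succ, Complex.norm_natCast]
  push_cast
  rfl

theorem norm_hcoef_deriv_le (ν : ℝ) (k : ℕ) :
    ‖((k : ℂ) + 1) * hcoef ν (k + 1)‖ ≤ 1 / (k.factorial * (k + 1).factorial) := by
  rw [norm_mul, norm_succ]
  calc ((k : ℝ) + 1) * ‖hcoef ν (k + 1)‖ ≤
        ((k : ℝ) + 1) * (1 / ((k + 1).factorial * (k + 1).factorial)) := by
        gcongr; exact norm_hcoef_le ν (k + 1)
    _ = _ := by
      rw [Nat.factorial_succ]
      push_cast
      field_simp

theorem norm_hcoef_deriv_le' (ν : ℝ) (k : ℕ) :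
    ‖((k : ℂ) + 1) * hcoef ν (k + 1)‖ ≤ 1 / k.factorial := by
  refine (norm_hcoef_deriv_le ν k).trans ?_
  have : (1 : ℝ) ≤ (k + 1).factorial := by exact_mod_cast (k + 1).factorial_pos
  have : (0 : ℝ) < k.factorial := by exact_mod_cast k.factorial_pos
  gcongr
  nlinarith

theorem norm_hcoef_deriv2_le (ν : ℝ) (k : ℕ) :
    ‖((k : ℂ) + 1) * (((k + 1 : ℕ) : ℂ) + 1) * hcoef ν (k + 1 + 1)‖ ≤ 1 / k.factorial := by
  rw [mul_assoc, norm_mul, norm_succ]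
  calc ((k : ℝ) + 1) * ‖(((k + 1 : ℕ) : ℂ) + 1) * hcoef ν (k + 1 + 1)‖ ≤
        ((k : ℝ) + 1) * (1 / ((k + 1).factorial * (k + 1 + 1).factorial)) := by
        gcongr; exact norm_hcoef_deriv_le ν (k + 1)
    _ = 1 / (k.factorial * (k + 1 + 1).factorial) := by
      rw [Nat.factorial_succ k]
      push_cast
      field_simp
    _ ≤ 1 / k.factorial := by
      have : (1 : ℝ) ≤ (k + 1 + 1).factorial := by exact_mod_cast (k + 1 + 1).factorial_pos
      have : (0 : ℝ) < k.factorial := by exact_mod_cast k.factorial_pos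
      gcongr
      nlinarith

/-- `H(ν, s) = ∑ s^k / (k! (1 + iν)_k)`, so that
`I_{iν}(x) = (x/2)^{iν} / Γ(1 + iν) * H(ν, x²/4)`. -/
noncomputable def hyp (ν s : ℝ) : ℂ := powerSum (hcoef ν) s

/-- The derivative of `H` in `s`. -/
noncomputable def hyp' (ν s : ℝ) : ℂ := powerSum (fun k : ℕ => ((k : ℂ) + 1) * hcoef ν (k + 1)) s

/-- The second derivative of `H` in `s`. -/
noncomputable def hyp'' (ν s : ℝ) : ℂ :=
  powerSum (fun k : ℕ => ((k : ℂ) + 1) * (((k + 1 : ℕ) : ℂ) + 1) * hcoef ν (k + 1 + 1)) s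

theorem hasDerivAt_hyp (ν s : ℝ) : HasDerivAt (hyp ν) (hyp' ν s) s :=
  hasDerivAt_powerSum (norm_hcoef_le' ν) (norm_hcoef_deriv_le' ν) s

theorem hasDerivAt_hyp' (ν s : ℝ) : HasDerivAt (hyp' ν) (hyp'' ν s) s := by
  have h := hasDerivAt_powerSum (norm_hcoef_deriv_le' ν)
    (fun k => by simpa only [mul_assoc] using norm_hcoef_deriv2_le ν k) s
  simp only [← mul_assoc] at h
  exact h

theorem hyp_zero_right (ν : ℝ) : hyp ν 0 = 1 := by
  rw [hyp, powerSum, tsum_eq_single 0]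
  · simp [hcoef_zero]
  · intro k hk
    simp [hk]

/-- The equation of the confluent hypergeometric limit function, `s H'' + (1 + iν) H' = H`. -/
theorem hyp_ode (ν s : ℝ) : (s : ℂ) * hyp'' ν s + (1 + Complex.I * ν) * hyp' ν s = hyp ν s := by
  have h2 := (hasSum_powerSum (norm_hcoef_deriv2_le ν) s).mul_left (s : ℂ)
  have h1 := (hasSum_powerSum (norm_hcoef_deriv_le' ν) s).mul_left (1 + Complex.I * ν : ℂ)
  have h0 := hasSum_powerSum (norm_hcoef_le' ν) s
  have h2' : HasSum (fun k : ℕ => (k : ℂ) * ((k : ℂ) + 1) * hcoef ν (k + 1) * (s : ℂ) ^ k)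
      ((s : ℂ) * hyp'' ν s) := by
    refine (hasSum_nat_add_iff' 1).1 ?_
    refine hasSum_of_eq h2 (fun k => ?_) (by simp [hyp''])
    push_cast
    ring
  refine (h2'.add h1).unique ?_
  refine hasSum_of_eq h0 (fun k => ?_) rfl
  rw [← hcoef_succ ν k]
  ring

theorem hasDerivAt_re {f : ℝ → ℂ} {f' : ℂ} {s : ℝ} (h : HasDerivAt f f' s) :
    HasDerivAt (fun s => (f s).re) f'.re s :=
  (Complex.reCLM.hasFDerivAt (x := f s)).comp_hasDerivAt s h

theorem hasDerivAt_im {f : ℝ → ℂ} {f' : ℂ} {s : ℝ} (h : HasDerivAt f f' s) :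
    HasDerivAt (fun s => (f s).im) f'.im s :=
  (Complex.imCLM.hasFDerivAt (x := f s)).comp_hasDerivAt s h

/-- The Wronskian of `I_{iν}` and `I_{-iν}`, in terms of `H`. -/
theorem hyp_wronskian (ν s : ℝ) :
    s * ((hyp' ν s).im * (hyp ν s).re - (hyp' ν s).re * (hyp ν s).im) =
      -(ν / 2) * (Complex.normSq (hyp ν s) - 1) := by
  set w : ℝ → ℝ := fun s => s * ((hyp' ν s).im * (hyp ν s).re - (hyp' ν s).re * (hyp ν s).im) +
    (ν / 2) * ((hyp ν s).re * (hyp ν s).re + (hyp ν s).im * (hyp ν s).im - 1) with hw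
  have hd : ∀ s, HasDerivAt w 0 s := by
    intro s
    have a0 := hasDerivAt_re (hasDerivAt_hyp ν s)
    have b0 := hasDerivAt_im (hasDerivAt_hyp ν s)
    have a1 := hasDerivAt_re (hasDerivAt_hyp' ν s)
    have b1 := hasDerivAt_im (hasDerivAt_hyp' ν s)
    have h := ((hasDerivAt_id s).mul ((b1.mul a0).sub (a1.mul b0))).add
      ((((a0.mul a0).add (b0.mul b0)).sub_const 1).const_mul (ν / 2))
    have ode := hyp_ode ν s
    have er := congrArg Complex.re ode
    have ei := congrArg Complex.im ode
    simp at er ei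
    refine HasDerivAt.congr_deriv h ?_
    simp only [id, Pi.sub_apply, Pi.mul_apply, one_mul]
    linear_combination (hyp ν s).re * ei - (hyp ν s).im * er
  have hconst := is_const_of_deriv_eq_zero (fun s => (hd s).differentiableAt)
    (fun s => (hd s).deriv) s 0
  have h0 : w 0 = 0 := by simp [hw, hyp_zero_right]
  rw [h0] at hconst
  simp only [hw] at hconst
  rw [Complex.normSq_apply]
  linarith

/-! ### The square of the modulus -/

theorem poch_add (ν : ℝ) (i j : ℕ) :
    poch ν (i + j) = poch ν i * (ascPochhammer ℂ j).eval (1 + Complex.I * ν + i) := by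
  rw [poch, ← ascPochhammer_mul, Polynomial.eval_mul, Polynomial.eval_comp, poch]
  simp

/-- The Chu–Vandermonde identity behind the product formula for `I_{iν} I_{-iν}`. -/
theorem sum_hcoef_mul (ν : ℝ) (k : ℕ) :
    ∑ ij ∈ Finset.HasAntidiagonal.antidiagonal k, hcoef ν ij.1 * hcoef (-ν) ij.2 =
      (Nat.centralBinom k : ℂ) / (poch ν k * poch (-ν) k) := by
  have hD : ∀ (r : ℂ) (n : ℕ), (descPochhammer ℤ n).smeval r =
      (ascPochhammer ℂ n).eval (r - n + 1) := fun r n => by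
    rw [Polynomial.descPochhammer_smeval_eq_ascPochhammer, Polynomial.ascPochhammer_smeval_eq_eval]
  have h := Ring.descPochhammer_smeval_add (R := ℂ) (r := k + Complex.I * ((-ν : ℝ) : ℂ))
    (s := k + Complex.I * (ν : ℂ)) k (Commute.all _ _)
  simp only [hD] at h
  have hsum : (ascPochhammer ℂ k).eval ((k : ℂ) + Complex.I * ((-ν : ℝ) : ℂ) +
      (k + Complex.I * (ν : ℂ)) - k + 1) = k.factorial * Nat.centralBinom k := by
    have : (k : ℂ) + Complex.I * ((-ν : ℝ) : ℂ) + (k + Complex.I * (ν : ℂ)) - k + 1 =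
        ((k + 1 : ℕ) : ℂ) := by push_cast; ring
    rw [this, ← ascPochhammer_eval_cast, ascPochhammer_nat_eq_ascFactorial,
      Nat.ascFactorial_eq_factorial_mul_choose, Nat.centralBinom, two_mul]
    push_cast
    rfl
  rw [hsum] at h
  have hk : (k.factorial : ℂ) ≠ 0 := by exact_mod_cast k.factorial_ne_zero
  rw [eq_div_iff (mul_ne_zero (poch_ne_zero _ _) (poch_ne_zero _ _)), ← mul_right_inj' hk, h,
    Finset.sum_mul, Finset.mul_sum]
  refine Finset.sum_congr rfl fun ij hij => ?_
  obtain ⟨i, j⟩ := ij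
  have hij : i + j = k := Finset.HasAntidiagonal.mem_antidiagonal.1 hij
  subst hij
  have e1 := poch_add ν i j
  have e2 := poch_add (-ν) j i
  have hc : (((i + j).factorial : ℕ) : ℂ) = (i + j).choose i * i.factorial * j.factorial := by
    rw [Nat.choose_symm_add]
    exact_mod_cast (Nat.add_choose_mul_factorial_mul_factorial i j).symm
  have e3 : ((i + j : ℕ) : ℂ) + Complex.I * ((-ν : ℝ) : ℂ) - i + 1 =
      1 + Complex.I * ((-ν : ℝ) : ℂ) + j := by push_cast; ring
  have e4 : ((i + j : ℕ) : ℂ) + Complex.I * (ν : ℂ) - j + 1 =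
      1 + Complex.I * (ν : ℂ) + i := by push_cast; ring
  dsimp only
  rw [e3, e4, hc, e1, add_comm i j, e2, hcoef, hcoef]
  have := poch_ne_zero ν i
  have := poch_ne_zero (-ν) j
  have : (i.factorial : ℂ) ≠ 0 := by exact_mod_cast i.factorial_ne_zero
  have : (j.factorial : ℂ) ≠ 0 := by exact_mod_cast j.factorial_ne_zero
  field_simp

theorem poch_neg (ν : ℝ) (k : ℕ) : poch (-ν) k = (starRingEnd ℂ) (poch ν k) := by
  induction k with
  | zero => simp [poch_zero]
  | succ k ih => simp [poch_succ, ih]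

theorem hcoef_neg (ν : ℝ) (k : ℕ) : hcoef (-ν) k = (starRingEnd ℂ) (hcoef ν k) := by
  simp [hcoef, poch_neg]

theorem hyp_neg (ν s : ℝ) : hyp (-ν) s = (starRingEnd ℂ) (hyp ν s) := by
  simp [hyp, powerSum, Complex.conj_tsum, hcoef_neg]

/-- The power series of `|H(ν, s)|²`. Its coefficients are positive and do not increase with
`|ν|`. -/
theorem hasSum_normSq_hyp (ν s : ℝ) :
    HasSum (fun k => (Nat.centralBinom k : ℝ) / Complex.normSq (poch ν k) * s ^ k)
      (Complex.normSq (hyp ν s)) := by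
  have h1 := summable_powerSum (norm_hcoef_le' ν) s
  have h2 := summable_powerSum (norm_hcoef_le' (-ν)) s
  have h := (summable_norm_sum_mul_antidiagonal_of_summable_norm h1 h2).of_norm.hasSum
  rw [← tsum_mul_tsum_eq_tsum_sum_antidiagonal_of_summable_norm h1 h2] at h
  change HasSum _ (hyp ν s * hyp (-ν) s) at h
  rw [hyp_neg, Complex.mul_conj] at h
  rw [← Complex.hasSum_ofReal]
  convert h using 1
  ext k
  have : ∑ ij ∈ Finset.HasAntidiagonal.antidiagonal k, hcoef ν ij.1 * (s : ℂ) ^ ij.1 *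
      (hcoef (-ν) ij.2 * (s : ℂ) ^ ij.2) =
      (∑ ij ∈ Finset.HasAntidiagonal.antidiagonal k, hcoef ν ij.1 * hcoef (-ν) ij.2) *
        (s : ℂ) ^ k := by
    rw [Finset.sum_mul]
    refine Finset.sum_congr rfl fun ij hij => ?_
    rw [← Finset.HasAntidiagonal.mem_antidiagonal.1 hij, pow_add]
    ring
  rw [this, sum_hcoef_mul, poch_neg, Complex.mul_conj]
  push_cast
  rfl

theorem normSq_poch_succ (ν : ℝ) (k : ℕ) : Complex.normSq (poch ν (k + 1)) =
    Complex.normSq (poch ν k) * (((k : ℝ) + 1) ^ 2 + ν ^ 2) := by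
  rw [poch_succ, Complex.normSq_mul, normSq_factor]

theorem normSq_poch_pos (ν : ℝ) (k : ℕ) : 0 < Complex.normSq (poch ν k) :=
  Complex.normSq_pos.2 (poch_ne_zero ν k)

theorem normSq_poch_mono {ν₁ ν₂ : ℝ} (h0 : 0 ≤ ν₁) (h : ν₁ ≤ ν₂) (k : ℕ) :
    Complex.normSq (poch ν₁ k) ≤ Complex.normSq (poch ν₂ k) := by
  induction k with
  | zero => simp [poch_zero]
  | succ k ih =>
    rw [normSq_poch_succ, normSq_poch_succ]
    have := normSq_poch_pos ν₂ k
    gcongr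

theorem normSq_hyp_anti {ν₁ ν₂ s : ℝ} (h0 : 0 ≤ ν₁) (h : ν₁ ≤ ν₂) (hs : 0 ≤ s) :
    Complex.normSq (hyp ν₂ s) ≤ Complex.normSq (hyp ν₁ s) := by
  refine hasSum_le (fun k => ?_) (hasSum_normSq_hyp ν₂ s) (hasSum_normSq_hyp ν₁ s)
  have := normSq_poch_pos ν₁ k
  gcongr
  exact normSq_poch_mono h0 h k

theorem le_normSq_hyp (ν : ℝ) {s : ℝ} (hs : 0 ≤ s) :
    1 + 2 * s / (1 + ν ^ 2) ≤ Complex.normSq (hyp ν s) := by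
  have h := sum_le_hasSum (Finset.range 2) (fun k _ => by
    have := normSq_poch_pos ν k; positivity) (hasSum_normSq_hyp ν s)
    (f := fun k => (Nat.centralBinom k : ℝ) / Complex.normSq (poch ν k) * s ^ k)
  simp only [Finset.sum_range_succ, Finset.sum_range_zero, normSq_poch_succ, poch_zero] at h
  simp [Nat.centralBinom] at h
  rwa [mul_div_right_comm]

theorem one_le_normSq_hyp (ν : ℝ) {s : ℝ} (hs : 0 ≤ s) : 1 ≤ Complex.normSq (hyp ν s) := by
  refine le_trans ?_ (le_normSq_hyp ν hs)
  have : 0 ≤ 2 * s / (1 + ν ^ 2) := by positivity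
  linarith

theorem one_le_norm_hyp (ν : ℝ) {s : ℝ} (hs : 0 ≤ s) : 1 ≤ ‖hyp ν s‖ := by
  have := one_le_normSq_hyp ν hs
  rw [Complex.normSq_eq_norm_sq] at this
  nlinarith [norm_nonneg (hyp ν s)]

theorem hyp_ne_zero (ν : ℝ) {s : ℝ} (hs : 0 ≤ s) : hyp ν s ≠ 0 :=
  norm_pos_iff.1 (lt_of_lt_of_le one_pos (one_le_norm_hyp ν hs))

theorem norm_hyp'_le {ν : ℝ} (hν : 0 < ν) (s : ℝ) : ‖hyp' ν s‖ ≤ 1 / ν * Real.exp |s| := by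
  refine norm_powerSum_le (fun k => ?_) s
  rw [norm_mul, norm_succ, norm_hcoef, poch_succ, norm_mul, Nat.factorial_succ]
  have h1 := factorial_le_norm_poch ν k
  have h2 := abs_le_norm_factor ν k
  rw [abs_of_pos hν] at h2
  have hk : (1 : ℝ) ≤ k.factorial := by exact_mod_cast k.factorial_pos
  have h3 : k.factorial * ν ≤ k.factorial * (‖poch ν k‖ * ‖(k : ℂ) + 1 + Complex.I * ν‖) := by
    have : (1 : ℝ) * ν ≤ ‖poch ν k‖ * ‖(k : ℂ) + 1 + Complex.I * ν‖ :=
      mul_le_mul (hk.trans h1) h2 hν.le (by positivity)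
    gcongr
    linarith
  calc ((k : ℝ) + 1) * (1 / (((k + 1) * k.factorial : ℕ) *
        (‖poch ν k‖ * ‖(k : ℂ) + 1 + Complex.I * ν‖)))
      = 1 / (k.factorial * (‖poch ν k‖ * ‖(k : ℂ) + 1 + Complex.I * ν‖)) := by
        have : ‖poch ν k‖ ≠ 0 := norm_ne_zero_iff.2 (poch_ne_zero ν k)
        have : ‖(k : ℂ) + 1 + Complex.I * ν‖ ≠ 0 := norm_ne_zero_iff.2 (factor_ne_zero ν k)
        push_cast
        field_simp
    _ ≤ 1 / (k.factorial * ν) := by gcongr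
    _ = 1 / ν / k.factorial := by field_simp

theorem continuous_poch (k : ℕ) : Continuous fun ν => poch ν k := by
  induction k with
  | zero => simpa [poch_zero] using continuous_const
  | succ k ih => simp only [poch_succ]; fun_prop

theorem continuous_hcoef (k : ℕ) : Continuous fun ν => hcoef ν k := by
  simp only [hcoef]
  refine continuous_const.div (continuous_const.mul (continuous_poch k)) fun ν => ?_
  exact mul_ne_zero (by exact_mod_cast k.factorial_ne_zero) (poch_ne_zero ν k)

theorem continuous_powerSum {c : ℝ → ℕ → ℂ} (hc : ∀ k, Continuous fun ν => c ν k)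
    (hb : ∀ ν k, ‖c ν k‖ ≤ 1 / k.factorial) :
    Continuous fun q : ℝ × ℝ => powerSum (c q.1) q.2 := by
  rw [continuous_iff_continuousAt]
  intro q₀
  obtain ⟨R, hR⟩ : ∃ R : ℝ, |q₀.2| < R := exists_gt _
  have hopen : IsOpen {q : ℝ × ℝ | |q.2| < R} :=
    isOpen_lt (continuous_abs.comp continuous_snd) continuous_const
  have hcont : ∀ k : ℕ, Continuous fun q : ℝ × ℝ => c q.1 k * (q.2 : ℂ) ^ k := fun k =>
    ((hc k).comp continuous_fst).mul ((Complex.continuous_ofReal.comp continuous_snd).pow k)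
  have hbound : ∀ (k : ℕ) (q : ℝ × ℝ), q ∈ {q : ℝ × ℝ | |q.2| < R} →
      ‖c q.1 k * (q.2 : ℂ) ^ k‖ ≤ R ^ k / k.factorial := by
    intro k q hq
    have hq : |q.2| < R := hq
    rw [norm_mul, norm_pow, Complex.norm_real, Real.norm_eq_abs, div_eq_inv_mul]
    have h1 := hb q.1 k
    rw [one_div] at h1
    exact mul_le_mul h1 (pow_le_pow_left₀ (abs_nonneg _) hq.le k) (by positivity) (by positivity)
  have h := continuousOn_tsum (f := fun (k : ℕ) (q : ℝ × ℝ) => c q.1 k * (q.2 : ℂ) ^ k)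
    (fun k => (hcont k).continuousOn) (Real.summable_pow_div_factorial R) hbound
  exact h.continuousAt (hopen.mem_nhds hR)

theorem continuous_hyp : Continuous fun q : ℝ × ℝ => hyp q.1 q.2 :=
  continuous_powerSum continuous_hcoef norm_hcoef_le'

theorem continuous_hyp' : Continuous fun q : ℝ × ℝ => hyp' q.1 q.2 :=
  continuous_powerSum (c := fun ν k => ((k : ℂ) + 1) * hcoef ν (k + 1))
    (fun k => continuous_const.mul (continuous_hcoef (k + 1))) norm_hcoef_deriv_le'

/-! ### A continuous argument of the hypergeometric factor -/

/-- The integrand `H'/H`, extended evenly to negative `s`, where `H` may vanish. -/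
noncomputable def hypLogDeriv (ν s : ℝ) : ℂ := hyp' ν |s| / hyp ν |s|

theorem continuous_hypLogDeriv : Continuous fun q : ℝ × ℝ => hypLogDeriv q.1 q.2 := by
  have hq : Continuous fun q : ℝ × ℝ => (q.1, |q.2|) :=
    continuous_fst.prodMk (continuous_abs.comp continuous_snd)
  exact (continuous_hyp'.comp hq).div (continuous_hyp.comp hq) fun q => hyp_ne_zero _ (abs_nonneg _)

/-- The logarithm `∫₀^s H'/H` of `H(ν, s)`, continuous in `s ≥ 0` and in `ν`, zero at `s = 0`. -/
noncomputable def hypLog (ν s : ℝ) : ℂ := ∫ σ in (0 : ℝ)..s, hypLogDeriv ν σ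

theorem continuous_hypLogDeriv_right (ν : ℝ) : Continuous (hypLogDeriv ν) :=
  show Continuous ((fun q : ℝ × ℝ => hypLogDeriv q.1 q.2) ∘ fun σ => (ν, σ)) from
    continuous_hypLogDeriv.comp (continuous_const.prodMk continuous_id)

theorem hasDerivAt_hypLog (ν s : ℝ) : HasDerivAt (hypLog ν) (hypLogDeriv ν s) s :=
  intervalIntegral.integral_hasDerivAt_right
    ((continuous_hypLogDeriv_right ν).intervalIntegrable _ _)
    ((continuous_hypLogDeriv_right ν).stronglyMeasurableAtFilter _ _)
    (continuous_hypLogDeriv_right ν).continuousAt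

theorem continuous_hypLog_left (s : ℝ) : Continuous fun ν => hypLog ν s :=
  intervalIntegral.continuous_parametric_intervalIntegral_of_continuous'
    (f := hypLogDeriv) continuous_hypLogDeriv 0 s

theorem hyp_eq_exp (ν : ℝ) {s : ℝ} (hs : 0 ≤ s) : hyp ν s = Complex.exp (hypLog ν s) := by
  have hd : ∀ t, 0 ≤ t → HasDerivAt (fun t => hyp ν t * Complex.exp (-hypLog ν t)) 0 t := by
    intro t ht
    have h := (hasDerivAt_hyp ν t).mul (hasDerivAt_hypLog ν t).neg.cexp
    refine h.congr_deriv ?_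
    rw [hypLogDeriv, abs_of_nonneg ht]
    have := hyp_ne_zero ν ht
    simp only [Pi.neg_apply]
    field_simp
    ring
  have hc := constant_of_has_deriv_right_zero (a := 0) (b := s)
    (fun t ht => (hd t ht.1).continuousAt.continuousWithinAt)
    (fun t ht => (hd t ht.1).hasDerivWithinAt) s ⟨hs, le_rfl⟩
  simp only [hyp_zero_right, hypLog, intervalIntegral.integral_same, neg_zero, Complex.exp_zero,
    mul_one] at hc
  change hyp ν s * Complex.exp (-hypLog ν s) = 1 at hc
  rw [Complex.exp_neg] at hc
  field_simp at hc
  exact hc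

theorem norm_hypLog_le {ν : ℝ} (hν : 0 < ν) {s : ℝ} (hs : 0 ≤ s) :
    ‖hypLog ν s‖ ≤ s * Real.exp s / ν := by
  have h : ∀ t ∈ Set.uIoc 0 s, ‖hypLogDeriv ν t‖ ≤ 1 / ν * Real.exp s := by
    intro t ht
    rw [Set.uIoc_of_le hs] at ht
    rw [hypLogDeriv, norm_div, abs_of_nonneg ht.1.le]
    calc ‖hyp' ν t‖ / ‖hyp ν t‖ ≤ ‖hyp' ν t‖ :=
          div_le_self (norm_nonneg _) (one_le_norm_hyp ν ht.1.le)
      _ ≤ 1 / ν * Real.exp |t| := norm_hyp'_le hν t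
      _ ≤ 1 / ν * Real.exp s := by rw [abs_of_nonneg ht.1.le]; gcongr; exact ht.2
  refine (intervalIntegral.norm_integral_le_of_norm_le_const h).trans (le_of_eq ?_)
  rw [sub_zero, abs_of_nonneg hs]
  ring

theorem hypLog_zero_left_im (s : ℝ) : (hypLog 0 s).im = 0 := by
  have hr : ∀ k, (starRingEnd ℂ) (hcoef 0 k) = hcoef 0 k := fun k => by
    rw [← hcoef_neg, neg_zero]
  have h0 : ∀ t, (hypLogDeriv 0 t).im = 0 := by
    intro t
    rw [← Complex.conj_eq_iff_im]
    simp [hypLogDeriv, hyp, hyp', powerSum, Complex.conj_tsum, hr]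
  have h := Complex.imCLM.intervalIntegral_comp_comm
    ((continuous_hypLogDeriv_right 0).intervalIntegrable (μ := MeasureTheory.volume) 0 s)
  simp only [Complex.imCLM_apply, h0, intervalIntegral.integral_zero] at h
  exact h.symm

/-! ### The argument of `Γ(1 + iν)` -/

theorem arctan_le_self_of_nonneg {a : ℝ} (ha : 0 ≤ a) : Real.arctan a ≤ a := by
  have hd : ∀ x, HasDerivAt (fun a => a - Real.arctan a) (1 - 1 / (1 + x ^ 2)) x := fun x =>
    (hasDerivAt_id x).sub (Real.hasDerivAt_arctan x)
  have h : MonotoneOn (fun a => a - Real.arctan a) (Set.Ici 0) := by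
    refine monotoneOn_of_deriv_nonneg (convex_Ici 0)
      (fun x _ => (hd x).continuousAt.continuousWithinAt)
      (fun x _ => (hd x).differentiableAt.differentiableWithinAt) fun x _ => ?_
    rw [(hd x).deriv, sub_nonneg, div_le_one (by positivity)]
    nlinarith
  simpa using h (Set.mem_Ici.2 le_rfl) ha ha

theorem sub_sq_le_arctan {a : ℝ} (ha : 0 ≤ a) : a - a ^ 2 ≤ Real.arctan a := by
  have hd : ∀ x, HasDerivAt (fun a => Real.arctan a - a + a ^ 2)
      (1 / (1 + x ^ 2) - 1 + 2 * x) x := fun x => by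
    exact (((Real.hasDerivAt_arctan x).sub (hasDerivAt_id x)).add (hasDerivAt_pow 2 x)).congr_deriv
      (by norm_num)
  have h : MonotoneOn (fun a => Real.arctan a - a + a ^ 2) (Set.Ici 0) := by
    refine monotoneOn_of_deriv_nonneg (convex_Ici 0)
      (fun x _ => (hd x).continuousAt.continuousWithinAt)
      (fun x _ => (hd x).differentiableAt.differentiableWithinAt) fun x hx => ?_
    have hx : 0 ≤ x := by simpa using interior_subset hx
    have h1 : 1 / (1 + x ^ 2) = 1 - x ^ 2 / (1 + x ^ 2) := by field_simp; ring
    have h2 : x ^ 2 / (1 + x ^ 2) ≤ x := by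
      rw [div_le_iff₀ (by positivity)]
      nlinarith [sq_nonneg (x - 1), mul_nonneg hx (sq_nonneg (x - 1)), mul_nonneg hx (sq_nonneg x)]
    rw [(hd x).deriv, h1]
    linarith
  have := h (Set.mem_Ici.2 le_rfl) ha ha
  simp at this
  linarith

/-- The terms of the series for `arg Γ(1 + iν)` that comes from Euler's limit formula. -/
noncomputable def gammaArgTerm (ν : ℝ) (k : ℕ) : ℝ :=
  ν * (Real.log (k + 2) - Real.log (k + 1)) - Real.arctan (ν / (k + 1))

/-- The continuous argument of `Γ(1 + iν)`, `ν ≥ 0`, that vanishes at `ν = 0`. -/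
noncomputable def gammaArg (ν : ℝ) : ℝ := ∑' k, gammaArgTerm ν k

theorem abs_gammaArgTerm_le {ν V : ℝ} (h0 : 0 ≤ ν) (hV : ν ≤ V) (k : ℕ) :
    |gammaArgTerm ν k| ≤ (V + V ^ 2) * (1 / ((k : ℝ) + 1) ^ 2) := by
  have hk : (0 : ℝ) < (k : ℝ) + 1 := by positivity
  have hlog : Real.log (k + 2) - Real.log (k + 1) = Real.log (1 + 1 / ((k : ℝ) + 1)) := by
    rw [← Real.log_div (by positivity) hk.ne']
    congr 1
    field_simp
    ring
  have hpos : (0 : ℝ) < 1 + 1 / ((k : ℝ) + 1) := by positivity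
  have l1 := Real.log_le_sub_one_of_pos hpos
  have l2 := Real.one_sub_inv_le_log_of_pos hpos
  have l3 : 1 / ((k : ℝ) + 1) - 1 / ((k : ℝ) + 1) ^ 2 ≤ 1 - (1 + 1 / ((k : ℝ) + 1))⁻¹ := by
    rw [← sub_nonneg]
    have : 1 - (1 + 1 / ((k : ℝ) + 1))⁻¹ - (1 / ((k : ℝ) + 1) - 1 / ((k : ℝ) + 1) ^ 2) =
        1 / (((k : ℝ) + 1) ^ 2 * (k + 2)) := by
      have : (k : ℝ) + 1 + 1 ≠ 0 := by positivity
      have : (k : ℝ) + 2 ≠ 0 := by positivity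
      field_simp
      ring
    rw [this]
    positivity
  have ha : 0 ≤ ν / ((k : ℝ) + 1) := by positivity
  have a1 := arctan_le_self_of_nonneg ha
  have a2 := sub_sq_le_arctan ha
  have hq : (ν / ((k : ℝ) + 1)) ^ 2 = ν ^ 2 * (1 / ((k : ℝ) + 1) ^ 2) := by
    rw [div_pow]; ring
  have hν : ν / ((k : ℝ) + 1) = ν * (1 / ((k : ℝ) + 1)) := by ring
  set q : ℝ := 1 / ((k : ℝ) + 1) ^ 2
  set L : ℝ := Real.log (1 + 1 / ((k : ℝ) + 1))
  have hq0 : 0 ≤ q := by positivity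
  have m1 : ν * L ≤ ν * (1 / ((k : ℝ) + 1)) := by gcongr; linarith
  have m2 : ν * (1 / ((k : ℝ) + 1) - q) ≤ ν * L := by gcongr; linarith
  have m3 : ν ^ 2 * q ≤ V ^ 2 * q := by gcongr
  have m4 : ν * q ≤ V * q := by gcongr
  have m5 : 0 ≤ V ^ 2 * q := by positivity
  have m6 : 0 ≤ ν * q := by positivity
  rw [gammaArgTerm, hlog, abs_le]
  constructor <;> nlinarith

theorem summable_one_div_succ_sq : Summable fun k : ℕ => 1 / ((k : ℝ) + 1) ^ 2 := by
  have := (summable_nat_add_iff 1).2 (Real.summable_one_div_nat_pow.2 (one_lt_two))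
  simpa using this

theorem summable_gammaArgTerm {ν : ℝ} (h0 : 0 ≤ ν) : Summable (gammaArgTerm ν) :=
  Summable.of_norm_bounded (summable_one_div_succ_sq.mul_left (ν + ν ^ 2))
    (abs_gammaArgTerm_le h0 le_rfl)

theorem continuousOn_gammaArg (V : ℝ) : ContinuousOn gammaArg (Set.Icc 0 V) := by
  refine continuousOn_tsum (fun k => ?_) (summable_one_div_succ_sq.mul_left (V + V ^ 2))
    fun k ν hν => abs_gammaArgTerm_le hν.1 hν.2 k
  simp only [gammaArgTerm]
  exact Continuous.continuousOn (by fun_prop)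

theorem gammaArg_zero : gammaArg 0 = 0 := by simp [gammaArg, gammaArgTerm]

theorem sum_gammaArgTerm (ν : ℝ) (n : ℕ) : ∑ k ∈ Finset.range n, gammaArgTerm ν k =
    ν * Real.log (n + 1) - ∑ k ∈ Finset.range n, Real.arctan (ν / (k + 1)) := by
  induction n with
  | zero => simp
  | succ n ih =>
    rw [Finset.sum_range_succ, Finset.sum_range_succ, ih, gammaArgTerm]
    push_cast
    rw [show (n : ℝ) + 1 + 1 = n + 2 by ring]
    ring

theorem factor_eq_norm_mul_exp (ν : ℝ) (k : ℕ) : (k : ℂ) + 1 + Complex.I * ν =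
    ‖(k : ℂ) + 1 + Complex.I * ν‖ * Complex.exp (Complex.I * (Real.arctan (ν / (k + 1)) : ℝ)) := by
  have hk : (0 : ℝ) < (k : ℝ) + 1 := by positivity
  have hn : ‖(k : ℂ) + 1 + Complex.I * ν‖ = (k + 1) * √(1 + (ν / (k + 1)) ^ 2) := by
    rw [Complex.norm_def, normSq_factor]
    have : ((k : ℝ) + 1) ^ 2 + ν ^ 2 = (k + 1) ^ 2 * (1 + (ν / (k + 1)) ^ 2) := by field_simp
    rw [this, Real.sqrt_mul (by positivity), Real.sqrt_sq hk.le]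
  have hs : √(1 + (ν / ((k : ℝ) + 1)) ^ 2) ≠ 0 := by positivity
  rw [hn, mul_comm Complex.I (Real.arctan _ : ℂ), Complex.exp_mul_I, ← Complex.ofReal_cos,
    ← Complex.ofReal_sin, Real.cos_arctan, Real.sin_arctan]
  apply Complex.ext
  · simp [-Complex.ofReal_div, -Complex.ofReal_mul]
    field_simp
  · simp [-Complex.ofReal_div, -Complex.ofReal_mul]
    field_simp

theorem poch_eq_norm_mul_exp (ν : ℝ) (n : ℕ) : poch ν n = ‖poch ν n‖ *
    Complex.exp (Complex.I * (∑ k ∈ Finset.range n, Real.arctan (ν / (k + 1)) : ℝ)) := by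
  induction n with
  | zero => simp [poch_zero]
  | succ n ih =>
    rw [poch_succ, norm_mul, Finset.sum_range_succ]
    conv_lhs => rw [ih, factor_eq_norm_mul_exp ν n]
    push_cast
    rw [mul_add, Complex.exp_add]
    ring

/-- Euler's limit formula for `Γ(1 + iν)`. -/
theorem tendsto_gamma (ν : ℝ) : Tendsto (fun n : ℕ => (n.factorial : ℂ) *
    Complex.exp (Complex.I * (ν * Real.log (n + 1) : ℝ)) / poch ν n) atTop
    (𝓝 (Complex.Gamma (1 + Complex.I * ν))) := by
  have h1 := Complex.GammaSeq_tendsto_Gamma (1 + Complex.I * ν)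
  have hprod : ∀ n : ℕ, ∏ j ∈ Finset.range (n + 1), (1 + Complex.I * ν + j) =
      poch ν (n + 1) := fun n => by
    induction n with
    | zero => simp [poch_succ, poch_zero]
    | succ n ih => rw [Finset.prod_range_succ, ih, poch_succ ν (n + 1)]; push_cast; ring
  have hinv : Tendsto (fun n : ℕ => ((n : ℂ))⁻¹) atTop (𝓝 0) := tendsto_inv_atTop_nhds_zero_nat
  have h2 : Tendsto (fun n : ℕ => 1 + (1 + Complex.I * ν) * ((n : ℂ))⁻¹) atTop (𝓝 1) := by
    simpa using (hinv.const_mul (1 + Complex.I * ν)).const_add 1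
  have h3 : Tendsto (fun n : ℕ => Complex.exp (Complex.I *
      (ν * Real.log (1 + ((n : ℝ))⁻¹) : ℝ))) atTop (𝓝 1) := by
    have a1 : Tendsto (fun n : ℕ => 1 + ((n : ℝ))⁻¹) atTop (𝓝 1) := by
      simpa using (tendsto_inv_atTop_nhds_zero_nat (𝕜 := ℝ)).const_add 1
    have a2 : Tendsto (fun n : ℕ => ν * Real.log (1 + ((n : ℝ))⁻¹)) atTop (𝓝 0) := by
      simpa using ((Real.continuousAt_log one_ne_zero).tendsto.comp a1).const_mul ν
    have a3 : Continuous fun r : ℝ => Complex.exp (Complex.I * (r : ℂ)) := by fun_prop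
    simpa [Function.comp_def] using (a3.tendsto 0).comp a2
  have h4 := (h1.mul h2).mul h3
  rw [mul_one, mul_one] at h4
  refine h4.congr' ?_
  filter_upwards [eventually_gt_atTop 0] with n hn
  have hn0 : (n : ℂ) ≠ 0 := by exact_mod_cast hn.ne'
  have hnr : (0 : ℝ) < n := by exact_mod_cast hn
  have hp := poch_ne_zero ν n
  have hf := factor_ne_zero ν n
  rw [Complex.GammaSeq, hprod, poch_succ, Complex.cpow_add _ _ hn0, Complex.cpow_one,
    Complex.cpow_def_of_ne_zero hn0, ← Complex.natCast_log]
  have hl : Real.log ((n : ℝ) + 1) = Real.log n + Real.log (1 + ((n : ℝ))⁻¹) := by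
    rw [← Real.log_mul hnr.ne' (by positivity)]
    congr 1
    field_simp
  have he : Complex.exp (Complex.I * (ν * Real.log (n + 1) : ℝ)) =
      Complex.exp ((Real.log n : ℝ) * (Complex.I * ν)) *
        Complex.exp (Complex.I * (ν * Real.log (1 + ((n : ℝ))⁻¹) : ℝ)) := by
    rw [← Complex.exp_add, hl]
    congr 1
    push_cast
    ring
  rw [he]
  field_simp
  ring

theorem gamma_ne_zero (ν : ℝ) : Complex.Gamma (1 + Complex.I * ν) ≠ 0 :=
  Complex.Gamma_ne_zero_of_re_pos (by simp)

theorem gamma_eq_norm_mul_exp {ν : ℝ} (hν : 0 ≤ ν) : Complex.Gamma (1 + Complex.I * ν) =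
    ‖Complex.Gamma (1 + Complex.I * ν)‖ * Complex.exp (Complex.I * gammaArg ν) := by
  have h := tendsto_gamma ν
  have h1 := (Complex.continuous_ofReal.tendsto _).comp h.norm
  have h2 : Tendsto (fun n => Complex.exp (Complex.I *
      (∑ k ∈ Finset.range n, gammaArgTerm ν k : ℝ))) atTop
      (𝓝 (Complex.exp (Complex.I * gammaArg ν))) := by
    have a3 : Continuous fun r : ℝ => Complex.exp (Complex.I * (r : ℂ)) := by fun_prop
    exact (a3.tendsto _).comp (summable_gammaArgTerm hν).hasSum.tendsto_sum_nat
  refine tendsto_nhds_unique h ((h1.mul h2).congr fun n => ?_)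
  have e1 : ‖Complex.exp (Complex.I * (ν * Real.log (n + 1) : ℝ))‖ = 1 := by
    rw [mul_comm, Complex.norm_exp_ofReal_mul_I]
  have hp : (‖poch ν n‖ : ℂ) ≠ 0 := by exact_mod_cast norm_ne_zero_iff.2 (poch_ne_zero ν n)
  simp only [Function.comp_apply, norm_div, norm_mul, e1, Complex.norm_natCast, mul_one]
  conv_rhs => rw [poch_eq_norm_mul_exp ν n]
  rw [sum_gammaArgTerm, Complex.ofReal_sub, mul_sub, Complex.exp_sub]
  have := Complex.exp_ne_zero (Complex.I *
    (∑ k ∈ Finset.range n, Real.arctan (ν / (k + 1)) : ℝ))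
  push_cast
  field_simp

/-! ### The phase of `I_{iν}` -/

/-- `Φ(ν, s)` with `I_{iν}(x) = |I_{iν}(x)| e^{-iΦ}`, `s = x²/4`: the continuous branch that
vanishes at `ν = 0`. -/
noncomputable def phase (ν s : ℝ) : ℝ := gammaArg ν - ν / 2 * Real.log s - (hypLog ν s).im

/-- `I_{iν}(x)` in terms of `s = x²/4`. -/
noncomputable def besselS (ν s : ℝ) : ℂ :=
  Complex.exp (Complex.I * (ν / 2 * Real.log s : ℝ)) / Complex.Gamma (1 + Complex.I * ν) * hyp ν s

theorem besselS_ne_zero (ν : ℝ) {s : ℝ} (hs : 0 ≤ s) : besselS ν s ≠ 0 :=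
  mul_ne_zero (div_ne_zero (Complex.exp_ne_zero _) (gamma_ne_zero ν)) (hyp_ne_zero ν hs)

theorem besselS_eq {ν s : ℝ} (hν : 0 ≤ ν) (hs : 0 ≤ s) :
    besselS ν s = ‖besselS ν s‖ * Complex.exp (-(Complex.I * phase ν s)) := by
  have e1 : ‖Complex.exp (Complex.I * (ν / 2 * Real.log s : ℝ))‖ = 1 := by
    rw [mul_comm, Complex.norm_exp_ofReal_mul_I]
  have hH : hyp ν s = ‖hyp ν s‖ * Complex.exp (Complex.I * (hypLog ν s).im) := by
    rw [hyp_eq_exp ν hs, Complex.norm_exp, Complex.ofReal_exp, ← Complex.exp_add]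
    congr 1
    conv_lhs => rw [← Complex.re_add_im (hypLog ν s)]
    ring
  have hG : (‖Complex.Gamma (1 + Complex.I * ν)‖ : ℂ) ≠ 0 := by
    exact_mod_cast norm_ne_zero_iff.2 (gamma_ne_zero ν)
  have hsplit : Complex.exp (-(Complex.I * phase ν s)) =
      Complex.exp (Complex.I * (ν / 2 * Real.log s : ℝ)) *
      Complex.exp (Complex.I * (hypLog ν s).im) / Complex.exp (Complex.I * gammaArg ν) := by
    rw [← Complex.exp_add, ← Complex.exp_sub, phase]
    congr 1
    push_cast
    ring
  have := Complex.exp_ne_zero (Complex.I * gammaArg ν)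
  rw [hsplit, besselS, norm_mul, norm_div, e1]
  conv_lhs => rw [hH, gamma_eq_norm_mul_exp hν]
  push_cast
  field_simp

theorem hasDerivAt_phase (ν : ℝ) {s : ℝ} (hs : 0 < s) :
    HasDerivAt (phase ν) (-(ν / (2 * s * Complex.normSq (hyp ν s)))) s := by
  have h := (((Real.hasDerivAt_log hs.ne').const_mul (ν / 2)).const_sub (gammaArg ν)).sub
    (hasDerivAt_im (hasDerivAt_hypLog ν s))
  refine h.congr_deriv ?_
  have hP : Complex.normSq (hyp ν s) ≠ 0 := (Complex.normSq_pos.2 (hyp_ne_zero ν hs.le)).ne'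
  have hw := hyp_wronskian ν s
  rw [hypLogDeriv, abs_of_pos hs, Complex.div_im]
  field_simp
  linear_combination (-2) * hw

theorem continuousOn_phase (s V : ℝ) : ContinuousOn (fun ν => phase ν s) (Set.Icc 0 V) := by
  refine ((continuousOn_gammaArg V).sub (Continuous.continuousOn (by fun_prop))).sub ?_
  exact (Complex.continuous_im.comp (continuous_hypLog_left s)).continuousOn

theorem phase_zero_left (s : ℝ) : phase 0 s = 0 := by
  simp [phase, gammaArg_zero, hypLog_zero_left_im]

/-! ### The phase for large argument -/

/-- The terms `s^k / (k!)²` of the series of `I_0`. -/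
noncomputable def besselWeight (s : ℝ) (k : ℕ) : ℝ := s ^ k / ((k.factorial : ℝ) * k.factorial)

/-- The sum `∑ s^k / (k!)²`, which is `I_0(2√s)`. -/
noncomputable def besselZ (s : ℝ) : ℝ := ∑' k, besselWeight s k

theorem besselWeight_nonneg {s : ℝ} (hs : 0 ≤ s) (k : ℕ) : 0 ≤ besselWeight s k := by
  rw [besselWeight]; positivity

theorem besselWeight_succ (s : ℝ) (k : ℕ) :
    ((k : ℝ) + 1) ^ 2 * besselWeight s (k + 1) = s * besselWeight s k := by
  rw [besselWeight, besselWeight, Nat.factorial_succ]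
  push_cast
  field_simp
  ring

theorem summable_besselWeight {s : ℝ} (hs : 0 ≤ s) : Summable (besselWeight s) := by
  refine Summable.of_nonneg_of_le (besselWeight_nonneg hs) (fun k => ?_)
    (Real.summable_pow_div_factorial s)
  have : (1 : ℝ) ≤ k.factorial := by exact_mod_cast k.factorial_pos
  rw [besselWeight]
  gcongr
  nlinarith

theorem besselZ_pos {s : ℝ} (hs : 0 ≤ s) : 0 < besselZ s :=
  (summable_besselWeight hs).tsum_pos (besselWeight_nonneg hs) 0 (by simp [besselWeight])

/-- The weights `s^k/(k!)²` concentrate at `k ≈ √s`. The first moment is bounded below by the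
nonnegativity of `∑ w_k ((k+1)/y - 1)² / (k+1)`, and the second is `s I_0` exactly. -/
theorem besselWeight_variance {y : ℝ} (hy : 0 < y) :
    Summable (fun k : ℕ => besselWeight (y ^ 2) k * ((k : ℝ) / y - 1) ^ 2) ∧
    ∑' k : ℕ, besselWeight (y ^ 2) k * ((k : ℝ) / y - 1) ^ 2 ≤ besselZ (y ^ 2) / y := by
  set s := y ^ 2 with hs
  have hs0 : 0 < s := by positivity
  have hw := besselWeight_nonneg hs0.le
  have hZ : HasSum (besselWeight s) (besselZ s) := (summable_besselWeight hs0.le).hasSum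
  have hR : Summable fun k : ℕ => besselWeight s k / ((k : ℝ) + 1) := by
    refine Summable.of_nonneg_of_le (fun k => div_nonneg (hw k) (by positivity)) (fun k => ?_)
      hZ.summable
    exact div_le_self (hw k) (by linarith [(Nat.cast_nonneg k : (0 : ℝ) ≤ k)])
  obtain ⟨R, hR⟩ := hR
  have hA : HasSum (fun k : ℕ => (k : ℝ) * besselWeight s k) (s * R) := by
    refine (hasSum_nat_add_iff' 1).1 ?_
    refine hasSum_of_eq (hR.mul_left s) (fun k => ?_) (by simp)
    have h := besselWeight_succ s k
    rw [← mul_div_assoc, eq_div_iff (by positivity), ← h]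
    push_cast
    ring
  have hB : HasSum (fun k : ℕ => (k : ℝ) ^ 2 * besselWeight s k) (s * besselZ s) := by
    refine (hasSum_nat_add_iff' 1).1 ?_
    refine hasSum_of_eq (hZ.mul_left s) (fun k => ?_) (by simp)
    rw [← besselWeight_succ]
    push_cast
    rfl
  have hlow : 0 ≤ (s * R + besselZ s) / y ^ 2 - 2 * (besselZ s / y) + R := by
    have h := (((hA.add hZ).div_const (y ^ 2)).sub ((hZ.div_const y).mul_left 2)).add hR
    refine h.nonneg fun k => ?_
    have : ((k : ℝ) * besselWeight s k + besselWeight s k) / y ^ 2 - 2 * (besselWeight s k / y) +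
        besselWeight s k / ((k : ℝ) + 1) =
        besselWeight s k * (((k : ℝ) + 1) / y - 1) ^ 2 / ((k : ℝ) + 1) := by
      field_simp
      ring
    rw [this]
    exact div_nonneg (mul_nonneg (hw k) (sq_nonneg _)) (by positivity)
  have hvar := ((hB.div_const (y ^ 2)).sub ((hA.div_const y).mul_left 2)).add hZ
  have hvar' : HasSum (fun k : ℕ => besselWeight s k * ((k : ℝ) / y - 1) ^ 2)
      (s * besselZ s / y ^ 2 - 2 * (s * R / y) + besselZ s) := by
    refine hasSum_of_eq hvar (fun k => ?_) rfl
    field_simp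
    ring
  refine ⟨hvar'.summable, hvar'.tsum_eq.trans_le ?_⟩
  rw [hs] at hlow ⊢
  have e1 : (y ^ 2 * R + besselZ (y ^ 2)) / y ^ 2 - 2 * (besselZ (y ^ 2) / y) + R =
      (2 * (y ^ 2 * R) - 2 * y * besselZ (y ^ 2) + besselZ (y ^ 2)) / y ^ 2 := by
    field_simp
    ring
  have e2 : besselZ (y ^ 2) / y - (y ^ 2 * besselZ (y ^ 2) / y ^ 2 - 2 * (y ^ 2 * R / y) +
      besselZ (y ^ 2)) =
      (2 * (y ^ 2 * R) - 2 * y * besselZ (y ^ 2) + besselZ (y ^ 2)) / y := by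
    field_simp
    ring
  rw [e1] at hlow
  rw [← sub_nonneg, e2]
  refine div_nonneg ?_ hy.le
  have := mul_nonneg hlow (sq_nonneg y)
  rwa [div_mul_cancel₀ _ (by positivity)] at this

/-- The ratio of the `k`-th terms of the series of `I_{iν}` and `I_0` at `s = y²`. -/
noncomputable def termRatio (ν y : ℝ) (k : ℕ) : ℂ :=
  (k.factorial : ℂ) * Complex.exp (Complex.I * (ν * Real.log y : ℝ)) /
    (Complex.Gamma (1 + Complex.I * ν) * poch ν k)

theorem norm_exp_I_mul (r : ℝ) : ‖Complex.exp (Complex.I * (r : ℂ))‖ = 1 := by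
  rw [mul_comm, Complex.norm_exp_ofReal_mul_I]

theorem norm_exp_I_mul_sub_one_le (r : ℝ) : ‖Complex.exp (Complex.I * (r : ℂ)) - 1‖ ≤ |r| := by
  simpa using Real.norm_exp_I_mul_ofReal_sub_one_le (x := r)

theorem norm_termRatio_le (ν y : ℝ) (k : ℕ) :
    ‖termRatio ν y k‖ ≤ 1 / ‖Complex.Gamma (1 + Complex.I * ν)‖ := by
  rw [termRatio, norm_div, norm_mul, norm_mul, norm_exp_I_mul, Complex.norm_natCast, mul_one]
  have h1 := norm_pos_iff.2 (gamma_ne_zero ν)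
  have h2 := norm_pos_iff.2 (poch_ne_zero ν k)
  rw [div_le_div_iff₀ (by positivity) h1, one_mul, mul_comm]
  gcongr
  exact factorial_le_norm_poch ν k

/-- The ratio of terms is close to `1` for `k` near `y`, by Euler's limit formula, and bounded
elsewhere; a multiple of `(k/y - 1)²` absorbs the second case. -/
theorem termRatio_sub_one_le (ν : ℝ) {ε : ℝ} (hε : 0 < ε) : ∃ C : ℝ, ∀ᶠ y : ℝ in atTop,
    ∀ k : ℕ, ‖termRatio ν y k - 1‖ ≤ ε + C * ((k : ℝ) / y - 1) ^ 2 := by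
  set B := 1 / ‖Complex.Gamma (1 + Complex.I * ν)‖ with hB
  have hB0 : 0 ≤ B := by positivity
  have hg := (tendsto_gamma ν).div_const (Complex.Gamma (1 + Complex.I * ν))
  rw [div_self (gamma_ne_zero ν)] at hg
  obtain ⟨K, hK⟩ := eventually_atTop.1 (Metric.tendsto_nhds.1 hg (ε / 2) (by positivity))
  have hlog : Tendsto (fun u : ℝ => ν * Real.log u) (𝓝 1) (𝓝 0) := by
    simpa using ((Real.continuousAt_log one_ne_zero).tendsto).const_mul ν
  obtain ⟨η, hη, hη'⟩ := Metric.eventually_nhds_iff.1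
    (Metric.tendsto_nhds.1 hlog (ε / 2) (by positivity))
  set δ := min (η / 2) (1 / 2) with hδ
  have hδ0 : 0 < δ := by positivity
  have hδ1 : δ ≤ 1 / 2 := min_le_right _ _
  have hδ2 : δ ≤ η / 2 := min_le_left _ _
  refine ⟨(B + 1) / δ ^ 2, ?_⟩
  filter_upwards [eventually_gt_atTop 0, eventually_ge_atTop (2 * K : ℝ),
    eventually_gt_atTop (1 / δ)] with y hy hyK hyδ k
  by_cases hk : |(k : ℝ) / y - 1| < δ
  · have hC : 0 ≤ (B + 1) / δ ^ 2 * ((k : ℝ) / y - 1) ^ 2 := by positivity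
    refine le_trans ?_ (le_add_of_nonneg_right hC)
    have hk1 := (abs_lt.1 hk).1
    have hkK : K ≤ k := by
      have : y * (1 / 2) ≤ (k : ℝ) := by
        have : 1 / 2 ≤ (k : ℝ) / y := by linarith
        rw [le_div_iff₀ hy] at this
        linarith
      have : (K : ℝ) ≤ k := by linarith
      exact_mod_cast this
    have hu : dist (((k : ℝ) + 1) / y) 1 < η := by
      rw [Real.dist_eq, add_div]
      have h1 : 1 / y < δ := by rw [div_lt_iff₀ hy]; rw [div_lt_iff₀ hδ0] at hyδ; linarith
      have h0 : 0 < 1 / y := by positivity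
      have := abs_lt.1 hk
      rw [abs_lt]
      constructor <;> linarith
    have h1 := hK k hkK
    have h2 := hη' hu
    rw [Real.dist_eq, sub_zero, Real.log_div (by positivity) hy.ne'] at h2
    rw [dist_eq_norm] at h1
    set g := (k.factorial : ℂ) * Complex.exp (Complex.I * (ν * Real.log (k + 1) : ℝ)) /
      poch ν k / Complex.Gamma (1 + Complex.I * ν) with hgdef
    have hsplit : termRatio ν y k = g * Complex.exp (Complex.I *
        (-(ν * (Real.log (k + 1) - Real.log y)) : ℝ)) := by
      have : Complex.exp (Complex.I * (ν * Real.log y : ℝ)) =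
          Complex.exp (Complex.I * (ν * Real.log (k + 1) : ℝ)) * Complex.exp (Complex.I *
            (-(ν * (Real.log (k + 1) - Real.log y)) : ℝ)) := by
        rw [← Complex.exp_add]
        congr 1
        push_cast
        ring
      rw [termRatio, this, hgdef]
      have := gamma_ne_zero ν
      have := poch_ne_zero ν k
      field_simp
    set e := Complex.exp (Complex.I * (-(ν * (Real.log (k + 1) - Real.log y)) : ℝ)) with he
    have he1 : ‖e‖ = 1 := norm_exp_I_mul _
    have he2 : ‖e - 1‖ ≤ ε / 2 := by
      refine (norm_exp_I_mul_sub_one_le _).trans ?_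
      rw [abs_neg]
      exact h2.le
    calc ‖termRatio ν y k - 1‖ = ‖(g - 1) * e + (e - 1)‖ := by rw [hsplit]; ring_nf
      _ ≤ ‖g - 1‖ * ‖e‖ + ‖e - 1‖ := (norm_add_le _ _).trans (by rw [norm_mul])
      _ ≤ ε := by rw [he1]; linarith
  · have hk : δ ≤ |(k : ℝ) / y - 1| := not_lt.1 hk
    have hsq : δ ^ 2 ≤ ((k : ℝ) / y - 1) ^ 2 := by
      rw [← sq_abs ((k : ℝ) / y - 1)]
      gcongr
    have h1 : B + 1 ≤ (B + 1) / δ ^ 2 * ((k : ℝ) / y - 1) ^ 2 := by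
      rw [div_mul_eq_mul_div, le_div_iff₀ (by positivity)]
      gcongr
    have h2 : ‖termRatio ν y k - 1‖ ≤ B + 1 := by
      refine (norm_sub_le _ _).trans ?_
      rw [norm_one]
      gcongr
      exact norm_termRatio_le ν y k
    linarith

theorem hasSum_besselS (ν : ℝ) {y : ℝ} :
    HasSum (fun k => (besselWeight (y ^ 2) k : ℂ) * termRatio ν y k) (besselS ν (y ^ 2)) := by
  have h := (hasSum_powerSum (norm_hcoef_le' ν) (y ^ 2)).mul_left
    (Complex.exp (Complex.I * (ν / 2 * Real.log (y ^ 2) : ℝ)) / Complex.Gamma (1 + Complex.I * ν))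
  refine hasSum_of_eq h (fun k => ?_) rfl
  have h1 := gamma_ne_zero ν
  have h2 := poch_ne_zero ν k
  have h3 : (k.factorial : ℂ) ≠ 0 := by exact_mod_cast k.factorial_ne_zero
  have h4 : ν / 2 * Real.log (y ^ 2) = ν * Real.log y := by
    rw [Real.log_pow]; push_cast; ring
  rw [besselWeight, termRatio, hcoef, h4]
  push_cast
  field_simp

/-- `I_{iν}(x) / I_0(x) → 1` as `x → ∞`. -/
theorem tendsto_besselS_div (ν : ℝ) :
    Tendsto (fun y : ℝ => besselS ν (y ^ 2) / besselZ (y ^ 2)) atTop (𝓝 1) := by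
  rw [Metric.tendsto_nhds]
  intro ε hε
  obtain ⟨C, hC⟩ := termRatio_sub_one_le ν (half_pos hε)
  have hCy : ∀ᶠ y : ℝ in atTop, C / y < ε / 2 := by
    have : Tendsto (fun y : ℝ => C / y) atTop (𝓝 0) := tendsto_const_nhds.div_atTop tendsto_id
    exact this.eventually_lt_const (by positivity)
  filter_upwards [hC, hCy, eventually_gt_atTop 0] with y hy hCy hy0
  have hs0 : 0 ≤ y ^ 2 := by positivity
  have hZ : 0 < besselZ (y ^ 2) := besselZ_pos hs0
  have hZs : HasSum (besselWeight (y ^ 2)) (besselZ (y ^ 2)) := (summable_besselWeight hs0).hasSum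
  obtain ⟨hvs, hv⟩ := besselWeight_variance hy0
  have hd := (hasSum_besselS ν (y := y)).sub (Complex.hasSum_ofReal.2 hZs)
  have hb := (hZs.mul_left (ε / 2)).add (hvs.hasSum.mul_left (max C 0))
  have hle : ‖besselS ν (y ^ 2) - besselZ (y ^ 2)‖ ≤ ε / 2 * besselZ (y ^ 2) +
      max C 0 * ∑' k : ℕ, besselWeight (y ^ 2) k * ((k : ℝ) / y - 1) ^ 2 := by
    rw [← hd.tsum_eq]
    refine tsum_of_norm_bounded hb fun k => ?_
    have hw := besselWeight_nonneg hs0 k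
    have : (besselWeight (y ^ 2) k : ℂ) * termRatio ν y k - (besselWeight (y ^ 2) k : ℂ) =
        besselWeight (y ^ 2) k * (termRatio ν y k - 1) := by ring
    rw [this, norm_mul, Complex.norm_real, Real.norm_eq_abs, abs_of_nonneg hw]
    calc besselWeight (y ^ 2) k * ‖termRatio ν y k - 1‖ ≤
          besselWeight (y ^ 2) k * (ε / 2 + max C 0 * ((k : ℝ) / y - 1) ^ 2) := by
          gcongr
          refine (hy k).trans ?_
          gcongr
          exact le_max_left _ _
      _ = _ := by ring
  have hm : max C 0 / y < ε / 2 := by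
    rcases max_choice C 0 with h | h <;> rw [h]
    · exact hCy
    · simpa using hε
  have hZ' : (besselZ (y ^ 2) : ℂ) ≠ 0 := by exact_mod_cast hZ.ne'
  rw [dist_eq_norm, div_sub_one hZ', norm_div, Complex.norm_real, Real.norm_eq_abs, abs_of_pos hZ,
    div_lt_iff₀ hZ]
  refine hle.trans_lt ?_
  have h1 : max C 0 * ∑' k : ℕ, besselWeight (y ^ 2) k * ((k : ℝ) / y - 1) ^ 2 ≤
      max C 0 / y * besselZ (y ^ 2) := by
    rw [div_mul_eq_mul_div, ← mul_div_assoc']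
    gcongr
  have h2 : max C 0 / y * besselZ (y ^ 2) < ε / 2 * besselZ (y ^ 2) := by gcongr
  linarith

/-- As `I_0 > 0`, the unit vectors `I_{iν} / |I_{iν}|` inherit the limit of `I_{iν} / I_0`. -/
theorem tendsto_exp_phase {ν : ℝ} (hν : 0 ≤ ν) :
    Tendsto (fun s => Complex.exp (-(Complex.I * phase ν s))) atTop (𝓝 1) := by
  have h1 : Tendsto (fun s => besselS ν s / besselZ s) atTop (𝓝 1) := by
    refine ((tendsto_besselS_div ν).comp Real.tendsto_sqrt_atTop).congr' ?_
    filter_upwards [eventually_ge_atTop 0] with s hs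
    simp [Real.sq_sqrt hs]
  have h2 := h1.div ((Complex.continuous_ofReal.tendsto _).comp h1.norm) (by simp)
  simp only [norm_one, Complex.ofReal_one, div_one] at h2
  refine h2.congr' ?_
  filter_upwards [eventually_ge_atTop 0] with s hs
  have hZ := besselZ_pos hs
  have hZ' : (besselZ s : ℂ) ≠ 0 := by exact_mod_cast hZ.ne'
  have hb : (‖besselS ν s‖ : ℂ) ≠ 0 := by exact_mod_cast norm_ne_zero_iff.2 (besselS_ne_zero ν hs)
  simp only [Function.comp_apply, Pi.div_apply, norm_div, Complex.norm_real, Real.norm_eq_abs,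
    abs_of_pos hZ, Complex.ofReal_div]
  rw [div_div_div_cancel_right₀ hZ', div_eq_iff hb, mul_comm]
  exact besselS_eq hν hs

/-- The phase decreases in `s`, at most at the rate `ν (1 + ν²) / (4 s²)`. -/
theorem phase_sub_mem {ν V s t : ℝ} (hν : 0 ≤ ν) (hV : ν ≤ V) (hs : 0 < s) (hst : s ≤ t) :
    0 ≤ phase ν s - phase ν t ∧ phase ν s - phase ν t ≤ V * (1 + V ^ 2) / 4 / s := by
  set C := V * (1 + V ^ 2) / 4 with hC
  have hV0 : 0 ≤ V := hν.trans hV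
  have hC0 : 0 ≤ C := by positivity
  have hP : ∀ r, 0 < r → 0 < Complex.normSq (hyp ν r) := fun r hr =>
    lt_of_lt_of_le one_pos (one_le_normSq_hyp ν hr.le)
  constructor
  · have h : AntitoneOn (phase ν) (Set.Ioi 0) := by
      refine antitoneOn_of_deriv_nonpos (convex_Ioi 0)
        (fun r hr => (hasDerivAt_phase ν hr).continuousAt.continuousWithinAt)
        (fun r hr => ?_) fun r hr => ?_
      · rw [interior_Ioi] at hr
        exact (hasDerivAt_phase ν hr).differentiableAt.differentiableWithinAt
      · rw [interior_Ioi] at hr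
        have hr : 0 < r := hr
        rw [(hasDerivAt_phase ν hr).deriv, neg_nonpos]
        have := hP r hr
        positivity
    have := h hs (hs.trans_le hst) hst
    linarith
  · have hd : ∀ r, 0 < r → HasDerivAt (fun r => phase ν r - C * r⁻¹)
        (-(ν / (2 * r * Complex.normSq (hyp ν r))) - C * (-(r ^ 2)⁻¹)) r := fun r hr =>
      (hasDerivAt_phase ν hr).sub ((hasDerivAt_inv hr.ne').const_mul C)
    have h : MonotoneOn (fun r => phase ν r - C * r⁻¹) (Set.Ioi 0) := by
      refine monotoneOn_of_deriv_nonneg (convex_Ioi 0)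
        (fun r hr => (hd r hr).continuousAt.continuousWithinAt)
        (fun r hr => ?_) fun r hr => ?_
      · rw [interior_Ioi] at hr
        exact (hd r hr).differentiableAt.differentiableWithinAt
      · rw [interior_Ioi] at hr
        have hr : 0 < r := hr
        rw [(hd r hr).deriv]
        have h1 := le_normSq_hyp ν hr.le
        have h2 : 2 * r / (1 + ν ^ 2) ≤ Complex.normSq (hyp ν r) := by linarith
        have h3 : ν / (2 * r * Complex.normSq (hyp ν r)) ≤ C * (r ^ 2)⁻¹ := by
          calc ν / (2 * r * Complex.normSq (hyp ν r)) ≤ ν / (2 * r * (2 * r / (1 + ν ^ 2))) := by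
                gcongr
            _ = ν * (1 + ν ^ 2) / 4 * (r ^ 2)⁻¹ := by field_simp; ring
            _ ≤ C * (r ^ 2)⁻¹ := by rw [hC]; gcongr
        linarith
    have h1 := h hs (hs.trans_le hst) hst
    have h2 : 0 ≤ C * t⁻¹ := by have := hs.trans_le hst; positivity
    simp only at h1
    rw [div_eq_mul_inv]
    linarith

/-- The limit of the phase for large argument is a multiple of `2π`, approached at a rate that
is locally uniform in `ν`. -/
theorem exists_phase_near {ν : ℝ} (hν : 0 ≤ ν) : ∃ n : ℤ,
    Tendsto (phase ν) atTop (𝓝 (n * (2 * Real.pi))) ∧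
    ∀ V s, ν ≤ V → 0 < s → |phase ν s - n * (2 * Real.pi)| ≤ V * (1 + V ^ 2) / 4 / s := by
  have hanti : AntitoneOn (phase ν) (Set.Ici 1) := fun s hs t _ hst => by
    have hs : 1 ≤ s := hs
    have := (phase_sub_mem hν le_rfl (by linarith) hst).1
    linarith
  obtain ⟨L, hL⟩ : ∃ L, Tendsto (phase ν) atTop (𝓝 L) := by
    have h : Antitone fun s => phase ν (max s 1) := fun s t hst =>
      hanti (Set.mem_Ici.2 (le_max_right _ _)) (Set.mem_Ici.2 (le_max_right _ _))
        (max_le_max_right 1 hst)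
    have hb : BddBelow (Set.range fun s => phase ν (max s 1)) := by
      refine ⟨phase ν 1 - ν * (1 + ν ^ 2) / 4 / 1, ?_⟩
      rintro _ ⟨s, rfl⟩
      have := (phase_sub_mem hν le_rfl one_pos (le_max_right s 1)).2
      dsimp only
      linarith
    refine ⟨_, (tendsto_atTop_ciInf h hb).congr' ?_⟩
    filter_upwards [eventually_ge_atTop 1] with s hs
    rw [max_eq_left hs]
  have hc : Continuous fun r : ℝ => Complex.exp (-(Complex.I * (r : ℂ))) := by fun_prop
  have he := tendsto_nhds_unique ((hc.tendsto L).comp hL) (tendsto_exp_phase hν)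
  obtain ⟨n, hn⟩ := Complex.exp_eq_one_iff.1 he
  have hLn : L = (-n : ℤ) * (2 * Real.pi) := by
    have : -(Complex.I * (L : ℂ)) = -(Complex.I * (((-n : ℤ) * (2 * Real.pi) : ℝ) : ℂ)) := by
      rw [hn]; push_cast; ring
    have := mul_left_cancel₀ Complex.I_ne_zero (neg_injective this)
    exact_mod_cast this
  refine ⟨-n, hLn ▸ hL, fun V s hV hs => ?_⟩
  rw [← hLn]
  have hle : ∀ᶠ t in atTop, |phase ν s - phase ν t| ≤ V * (1 + V ^ 2) / 4 / s := by
    filter_upwards [eventually_ge_atTop s] with t ht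
    have := phase_sub_mem hν hV hs ht
    rw [abs_of_nonneg this.1]
    exact this.2
  exact le_of_tendsto (hL.const_sub _).abs hle

/-- The phase tends to `0` for large argument: the multiple of `2π` in the limit depends
continuously on `ν` and is `0` for `ν = 0`. -/
theorem tendsto_phase_atTop {ν : ℝ} (hν : 0 ≤ ν) : Tendsto (phase ν) atTop (𝓝 0) := by
  obtain ⟨n, hn, hn'⟩ := exists_phase_near hν
  suffices n = 0 by simpa [this] using hn
  by_contra hn0
  set s := ν * (1 + ν ^ 2) / 4 + 1 with hs
  have hs0 : 0 < s := by positivity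
  have hb : ν * (1 + ν ^ 2) / 4 / s ≤ 1 := by
    rw [div_le_one hs0]; linarith
  have hpi := Real.pi_gt_three
  have h1 : Real.pi ≤ |phase ν s| := by
    have h2 := (hn' ν s le_rfl hs0).trans hb
    have h3 : (1 : ℝ) ≤ |(n : ℝ)| := by exact_mod_cast Int.one_le_abs hn0
    have h4 : |(n : ℝ) * (2 * Real.pi)| = |(n : ℝ)| * (2 * Real.pi) := by
      rw [abs_mul, abs_of_pos (by positivity : 0 < 2 * Real.pi)]
    have h5 := abs_sub_abs_le_abs_sub ((n : ℝ) * (2 * Real.pi)) (phase ν s)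
    rw [abs_sub_comm] at h5
    nlinarith
  have hcont : ContinuousOn (fun ν => |phase ν s|) (Set.Icc 0 ν) := (continuousOn_phase s ν).abs
  obtain ⟨μ, hμ, hμ'⟩ := intermediate_value_Icc hν hcont
    (show Real.pi ∈ Set.Icc |phase 0 s| |phase ν s| by
      rw [phase_zero_left, abs_zero]; exact ⟨Real.pi_pos.le, h1⟩)
  obtain ⟨m, -, hm⟩ := exists_phase_near hμ.1
  have h6 := (hm ν s hμ.2 hs0).trans hb
  have hodd : ∀ k : ℤ, Odd k → (1 : ℝ) ≤ |(k : ℝ)| := fun k hk => by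
    exact_mod_cast Int.one_le_abs (by rintro rfl; simp at hk)
  rcases eq_or_eq_neg_of_abs_eq hμ' with h | h
  · have h7 := hodd (1 - 2 * m) ⟨-m, by ring⟩
    have h8 : phase μ s - m * (2 * Real.pi) = ((1 - 2 * m : ℤ) : ℝ) * Real.pi := by
      rw [h]; push_cast; ring
    rw [h8, abs_mul, abs_of_pos Real.pi_pos] at h6
    nlinarith
  · have h7 := hodd (-1 - 2 * m) ⟨-m - 1, by ring⟩
    have h8 : phase μ s - m * (2 * Real.pi) = ((-1 - 2 * m : ℤ) : ℝ) * Real.pi := by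
      rw [h]; push_cast; ring
    rw [h8, abs_mul, abs_of_pos Real.pi_pos] at h6
    nlinarith

/-- The phase is strictly increasing in the order: the difference for two orders is strictly
decreasing in the argument, because `ν / |H(ν, s)|²` increases with `ν`, and it tends to `0`. -/
theorem phase_strictMono {ν₁ ν₂ s : ℝ} (h1 : 0 ≤ ν₁) (h12 : ν₁ < ν₂) (hs : 0 < s) :
    phase ν₁ s < phase ν₂ s := by
  have hd : ∀ r, 0 < r → HasDerivAt (fun r => phase ν₂ r - phase ν₁ r)
      (-(ν₂ / (2 * r * Complex.normSq (hyp ν₂ r))) -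
        -(ν₁ / (2 * r * Complex.normSq (hyp ν₁ r)))) r := fun r hr =>
    (hasDerivAt_phase ν₂ hr).sub (hasDerivAt_phase ν₁ hr)
  have h : StrictAntiOn (fun r => phase ν₂ r - phase ν₁ r) (Set.Ioi 0) := by
    refine strictAntiOn_of_deriv_neg (convex_Ioi 0)
      (fun r hr => (hd r hr).continuousAt.continuousWithinAt) fun r hr => ?_
    rw [interior_Ioi] at hr
    have hr : 0 < r := hr
    rw [(hd r hr).deriv]
    have hP1 := one_le_normSq_hyp ν₁ hr.le
    have hP2 := one_le_normSq_hyp ν₂ hr.le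
    have hP := normSq_hyp_anti h1 h12.le hr.le
    have h3 : ν₁ / (2 * r * Complex.normSq (hyp ν₁ r)) ≤
        ν₁ / (2 * r * Complex.normSq (hyp ν₂ r)) := by
      gcongr
    have h4 : ν₁ / (2 * r * Complex.normSq (hyp ν₂ r)) <
        ν₂ / (2 * r * Complex.normSq (hyp ν₂ r)) := by
      gcongr
    linarith
  have hlim : Tendsto (fun r => phase ν₂ r - phase ν₁ r) atTop (𝓝 0) := by
    simpa using (tendsto_phase_atTop (h1.trans h12.le)).sub (tendsto_phase_atTop h1)
  have h5 : 0 ≤ phase ν₂ (s + 1) - phase ν₁ (s + 1) := by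
    refine le_of_tendsto hlim ?_
    filter_upwards [eventually_ge_atTop (s + 1)] with r hr
    exact h.antitoneOn (show (0 : ℝ) < s + 1 by linarith) (show (0 : ℝ) < r by linarith) hr
  have h6 := h hs (show (0 : ℝ) < s + 1 by linarith) (lt_add_one s)
  simp only at h6
  linarith

/-! ### The zeros in terms of the phase -/

theorem besselI_eq (ν : ℝ) {x : ℝ} (hx : 0 < x) :
    besselI (Complex.I * ν) x = besselS ν (x ^ 2 / 4) := by
  have hx2 : ((x : ℂ) / 2) ≠ 0 := by
    rw [div_ne_zero_iff]; exact ⟨by exact_mod_cast hx.ne', two_ne_zero⟩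
  have hlog : Complex.log ((x : ℂ) / 2) = (Real.log (x / 2) : ℝ) := by
    rw [Complex.ofReal_log (by positivity)]
    push_cast
    rfl
  have hlog2 : ν / 2 * Real.log (x ^ 2 / 4) = ν * Real.log (x / 2) := by
    rw [show x ^ 2 / 4 = (x / 2) ^ 2 by ring, Real.log_pow]
    push_cast
    ring
  rw [besselI, besselS, hyp, powerSum, Complex.cpow_def_of_ne_zero hx2, hlog, hlog2]
  have he : ((Real.log (x / 2) : ℝ) : ℂ) * (Complex.I * ν) =
      Complex.I * (ν * Real.log (x / 2) : ℝ) := by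
    push_cast
    ring
  rw [he]
  congr 1
  · refine tsum_congr fun k => ?_
    rw [hcoef, poch, pow_mul]
    push_cast
    rw [show ((x : ℂ) / 2) ^ 2 = (x : ℂ) ^ 2 / 4 by ring]
    ring

theorem besselS_neg (ν s : ℝ) : besselS (-ν) s = (starRingEnd ℂ) (besselS ν s) := by
  rw [besselS, besselS, map_mul, map_div₀, hyp_neg, ← Complex.exp_conj, ← Complex.Gamma_conj]
  simp [neg_div, Complex.conj_ofNat]

theorem besselL_eq_zero_iff {ν x : ℝ} (hν : 0 < ν) (hx : 0 < x) :
    besselL ν x = 0 ↔ Real.cos (phase ν (x ^ 2 / 4)) = 0 := by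
  have hs : (0 : ℝ) ≤ x ^ 2 / 4 := by positivity
  have h1 : besselI (-(Complex.I * ν)) x = (starRingEnd ℂ) (besselS ν (x ^ 2 / 4)) := by
    rw [← besselS_neg, ← besselI_eq (-ν) hx]
    congr 1
    push_cast
    ring
  have hsinh : (Real.sinh (Real.pi * ν) : ℂ) ≠ 0 := by
    exact_mod_cast (Real.sinh_pos_iff.2 (by positivity)).ne'
  have hpre : (Real.pi : ℂ) / (2 * (Real.sinh (Real.pi * ν) : ℂ)) ≠ 0 :=
    div_ne_zero (by exact_mod_cast Real.pi_ne_zero) (mul_ne_zero two_ne_zero hsinh)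
  have hre : (besselS ν (x ^ 2 / 4)).re =
      ‖besselS ν (x ^ 2 / 4)‖ * Real.cos (phase ν (x ^ 2 / 4)) := by
    conv_lhs => rw [besselS_eq hν.le hs]
    rw [show -(Complex.I * (phase ν (x ^ 2 / 4) : ℂ)) =
      ((-phase ν (x ^ 2 / 4) : ℝ) : ℂ) * Complex.I by push_cast; ring, Complex.re_ofReal_mul,
      Complex.exp_ofReal_mul_I_re, Real.cos_neg]
  rw [besselL, besselI_eq ν hx, h1, mul_eq_zero, or_iff_right hpre, Complex.add_conj,
    Complex.ofReal_eq_zero, hre]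
  have hn : ‖besselS ν (x ^ 2 / 4)‖ ≠ 0 := norm_ne_zero_iff.2 (besselS_ne_zero ν hs)
  simp [hn]

/-! ### Stirling's series on the imaginary axis -/

/-- The truncated Stirling approximation of `log Γ(1+z) - log √(2π)`. -/
noncomputable def stirlingApprox (M : ℕ) (z : ℂ) : ℂ :=
  z * Complex.log z - z + 1 / 2 * Complex.log z +
    ∑ k ∈ Finset.range M, stirlingBeta k * z⁻¹ ^ (k + 1)

/-- `t` times the defect of the truncated Stirling series, as a function of `t = 1/w`. -/
noncomputable def defectFun (M : ℕ) (t : ℂ) : ℂ :=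
  (1 - 1 / 2 * t) * (-Complex.log (1 - t)) - t +
    ∑ k ∈ Finset.range M, stirlingBeta k * (t ^ (k + 2) - t ^ (k + 2) * ((1 - t)⁻¹) ^ (k + 1))

theorem hasTaylor_neg_log : HasTaylor (fun t : ℂ => -Complex.log (1 - t)) (fun n => 1 / (n : ℂ)) :=
  hasTaylor_of_hasSum one_pos fun z hz =>
    hasSum_of_eq (Complex.hasSum_taylorSeries_neg_log hz) (fun k => by ring) rfl

theorem hasExpansion_defectFun (M : ℕ) :
    HasExpansion (𝓝 0) (fun t : ℂ => t) (defectFun M) (fun _ => defectSeries M) := by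
  have ht : Tendsto (fun t : ℂ => t) (𝓝 0) (𝓝 0) := tendsto_id
  have hX := HasExpansion.X ht
  have hc : ∀ c : ℂ, HasExpansion (𝓝 0) (fun t : ℂ => t) (fun _ => c) (fun _ => PowerSeries.C c) :=
    fun c => HasExpansion.const (isBigO_const_const _ one_ne_zero _)
  have hinv := (HasExpansion.one.sub hX).inv ht one_ne_zero (fun _ => by simp)
  refine (((HasExpansion.one.sub ((hc (1 / 2)).mul ht hX)).mul ht
    (hasTaylor_neg_log.hasExpansion ht)).sub hX).add (HasExpansion.sum _ fun k _ =>
    (hc _).mul ht ((hX.pow ht _).sub ((hX.pow ht _).mul ht (hinv.pow ht _))))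

theorem defectFun_bound (M : ℕ) : ∃ C r : ℝ, 0 < r ∧ 0 ≤ C ∧
    ∀ t : ℂ, ‖t‖ < r → ‖defectFun M t‖ ≤ C * ‖t‖ ^ (M + 3) := by
  have h := (hasExpansion_defectFun M).sub_isBigO (M + 3)
  obtain ⟨C, hC0, hC⟩ := h.exists_nonneg
  obtain ⟨r, hr, hr'⟩ := Metric.eventually_nhds_iff.1 hC.bound
  refine ⟨C, r, hr, hC0, fun t ht => ?_⟩
  have := hr' (y := t) (by simpa using ht)
  rw [Finset.sum_eq_zero, sub_zero, norm_pow] at this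
  · exact this
  · intro k hk
    rw [coeff_defectSeries M k (by have := Finset.mem_range.1 hk; omega), zero_mul]

theorem log_sub_one {w : ℂ} (hw : 1 < ‖w‖) (hre : 0 < w.re) :
    Complex.log (w - 1) = Complex.log w + Complex.log (1 - w⁻¹) := by
  have hw0 : w ≠ 0 := norm_pos_iff.1 (one_pos.trans hw)
  have hlt : ‖w⁻¹‖ < 1 := by rw [norm_inv]; exact inv_lt_one_of_one_lt₀ hw
  have hre2 : 0 < (1 - w⁻¹).re := by
    have := (Complex.re_le_norm w⁻¹).trans_lt hlt
    rw [Complex.sub_re, Complex.one_re]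
    linarith
  have hne : 1 - w⁻¹ ≠ 0 := fun h => by rw [h] at hre2; simp at hre2
  have h1 := abs_lt.1 (Complex.abs_arg_lt_pi_div_two_iff.2 (Or.inl hre))
  have h2 := abs_lt.1 (Complex.abs_arg_lt_pi_div_two_iff.2 (Or.inl hre2))
  have h := (Complex.log_mul_eq_add_log_iff hw0 hne).2
    ⟨by linarith [h1.1, h2.1], by linarith [h1.2, h2.2]⟩
  rw [← h]
  congr 1
  field_simp

theorem stirlingApprox_defect (M : ℕ) {w : ℂ} (hw : 1 < ‖w‖) (hre : 0 < w.re) :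
    stirlingApprox M w - stirlingApprox M (w - 1) - Complex.log w = w * defectFun M w⁻¹ := by
  have hw0 : w ≠ 0 := norm_pos_iff.1 (one_pos.trans hw)
  have hw1 : w - 1 ≠ 0 := fun h => by
    rw [sub_eq_zero] at h
    rw [h, norm_one] at hw
    exact lt_irrefl _ hw
  have hinv : (w - 1)⁻¹ = w⁻¹ * (1 - w⁻¹)⁻¹ := by
    rw [← mul_inv]
    congr 1
    field_simp
  have hsum : w * ∑ k ∈ Finset.range M, stirlingBeta k *
        (w⁻¹ ^ (k + 2) - w⁻¹ ^ (k + 2) * ((1 - w⁻¹)⁻¹) ^ (k + 1)) =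
      ∑ k ∈ Finset.range M, stirlingBeta k * w⁻¹ ^ (k + 1) -
        ∑ k ∈ Finset.range M, stirlingBeta k * (w - 1)⁻¹ ^ (k + 1) := by
    rw [← Finset.sum_sub_distrib, Finset.mul_sum]
    refine Finset.sum_congr rfl fun k _ => ?_
    have : w * w⁻¹ ^ (k + 2) = w⁻¹ ^ (k + 1) := by
      rw [pow_succ' _ (k + 1), mul_inv_cancel_left₀ hw0]
    rw [hinv, mul_pow]
    linear_combination (stirlingBeta k - stirlingBeta k * (1 - w⁻¹)⁻¹ ^ (k + 1)) * this
  rw [defectFun, mul_add, hsum, stirlingApprox, stirlingApprox, log_sub_one hw hre]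
  field_simp
  ring

theorem log_factor_im (ν : ℝ) (k : ℕ) :
    (Complex.log ((k : ℂ) + 1 + Complex.I * ν)).im = Real.arctan (ν / (k + 1)) := by
  have h := factor_eq_norm_mul_exp ν k
  have hn : 0 < ‖(k : ℂ) + 1 + Complex.I * ν‖ := norm_pos_iff.2 (factor_ne_zero ν k)
  have h1 := Real.neg_pi_div_two_lt_arctan (ν / (k + 1))
  have h2 := Real.arctan_lt_pi_div_two (ν / (k + 1))
  have hpi := Real.pi_pos
  rw [h, Complex.log_im, Complex.arg_real_mul _ hn, mul_comm Complex.I, Complex.arg_exp_mul_I,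
    toIocMod_eq_self]
  constructor <;> linarith

/-- Summation of the defects of the truncated Stirling series along `iν, 1 + iν, 2 + iν, …`. -/
theorem stirling_partial_bound (M : ℕ) : ∃ C R : ℝ, 0 < R ∧ ∀ ν : ℝ, R < ν → ∀ n : ℕ,
    |(stirlingApprox M (n + Complex.I * ν)).im - (stirlingApprox M (Complex.I * ν)).im -
      ∑ k ∈ Finset.range n, Real.arctan (ν / (k + 1))| ≤ C * ν⁻¹ ^ M := by
  obtain ⟨C, r, hr, hC0, hC⟩ := defectFun_bound M
  refine ⟨C * ∑' k : ℕ, 1 / ((k : ℝ) + 1) ^ 2, max 1 (1 / r), by positivity, fun ν hν n => ?_⟩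
  have hν1 : 1 < ν := (le_max_left _ _).trans_lt hν
  have hν0 : 0 < ν := by linarith
  have hνr : 1 / r < ν := (le_max_right _ _).trans_lt hν
  set w : ℕ → ℂ := fun k => (k : ℂ) + 1 + Complex.I * ν with hw
  have hwν : ∀ k, ν ≤ ‖w k‖ := fun k => by
    have := abs_le_norm_factor ν k
    rwa [abs_of_pos hν0] at this
  have htel : ∀ n : ℕ, stirlingApprox M (n + Complex.I * ν) - stirlingApprox M (Complex.I * ν) -
      ∑ k ∈ Finset.range n, Complex.log (w k) =
      ∑ k ∈ Finset.range n, w k * defectFun M (w k)⁻¹ := by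
    intro n
    induction n with
    | zero => simp
    | succ n ih =>
      rw [Finset.sum_range_succ, Finset.sum_range_succ, ← ih, ← stirlingApprox_defect M
        (hν1.trans_le (hwν n)) (by simp [hw]; positivity)]
      have e1 : ((n + 1 : ℕ) : ℂ) + Complex.I * ν = w n := by simp [hw]
      have e2 : w n - 1 = n + Complex.I * ν := by simp only [hw]; ring
      rw [e1, e2]
      ring
  have him := congrArg Complex.im (htel n)
  rw [Complex.sub_im, Complex.sub_im, Complex.im_sum] at him
  simp only [hw, log_factor_im] at him
  rw [him]
  refine (Complex.abs_im_le_norm _).trans ((norm_sum_le _ _).trans ?_)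
  have hb : ∀ k, ‖w k * defectFun M (w k)⁻¹‖ ≤ C * ν⁻¹ ^ M * (1 / ((k : ℝ) + 1) ^ 2) := by
    intro k
    have hpos : 0 < ‖w k‖ := hν0.trans_le (hwν k)
    have ht : ‖(w k)⁻¹‖ < r := by
      rw [norm_inv, inv_lt_comm₀ hpos hr, ← one_div]
      exact hνr.trans_le (hwν k)
    have h1 := hC _ ht
    rw [norm_inv] at h1
    have h2 : ‖w k‖⁻¹ ≤ ν⁻¹ := inv_anti₀ hν0 (hwν k)
    have h3 : ‖w k‖⁻¹ ≤ ((k : ℝ) + 1)⁻¹ := inv_anti₀ (by positivity) (succ_le_norm_factor ν k)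
    calc ‖w k * defectFun M (w k)⁻¹‖ ≤ ‖w k‖ * (C * ‖w k‖⁻¹ ^ (M + 3)) := by
          rw [norm_mul]; gcongr
      _ = C * ‖w k‖⁻¹ ^ M * ‖w k‖⁻¹ ^ 2 := by
          rw [show M + 3 = M + 2 + 1 by ring, pow_succ, pow_add]
          field_simp
      _ ≤ C * ν⁻¹ ^ M * ((k : ℝ) + 1)⁻¹ ^ 2 := by gcongr
      _ = _ := by rw [one_div, inv_pow ((k : ℝ) + 1)]
  calc ∑ k ∈ Finset.range n, ‖w k * defectFun M (w k)⁻¹‖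
      ≤ ∑ k ∈ Finset.range n, C * ν⁻¹ ^ M * (1 / ((k : ℝ) + 1) ^ 2) :=
        Finset.sum_le_sum fun k _ => hb k
    _ = C * ν⁻¹ ^ M * ∑ k ∈ Finset.range n, 1 / ((k : ℝ) + 1) ^ 2 := by rw [Finset.mul_sum]
    _ ≤ C * ν⁻¹ ^ M * ∑' k : ℕ, 1 / ((k : ℝ) + 1) ^ 2 := by
        gcongr
        exact summable_one_div_succ_sq.sum_le_tsum _ fun k _ => by positivity
    _ = _ := by ring

/-- The asymptotic behaviour of the truncated Stirling series matches the normalization of the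
partial sums of `gammaArg`, so that no constant of integration is left over. -/
theorem tendsto_stirlingApprox_im (M : ℕ) (ν : ℝ) :
    Tendsto (fun n : ℕ => (stirlingApprox M (n + Complex.I * ν)).im - ν * Real.log (n + 1))
      atTop (𝓝 0) := by
  have hinvR := tendsto_inv_atTop_nhds_zero_nat (𝕜 := ℝ)
  have hinv : Tendsto (fun n : ℕ => ((n : ℂ))⁻¹) atTop (𝓝 0) := tendsto_inv_atTop_nhds_zero_nat
  set L : ℕ → ℂ := fun n => Complex.log (1 + Complex.I * ν * ((n : ℂ))⁻¹) with hL
  have hL0 : Tendsto L atTop (𝓝 0) := by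
    have h1 : Tendsto (fun n : ℕ => 1 + Complex.I * ν * ((n : ℂ))⁻¹) atTop (𝓝 1) := by
      simpa using (hinv.const_mul (Complex.I * ν)).const_add 1
    have h2 : ContinuousAt Complex.log 1 := continuousAt_clog (by simp)
    simpa [Function.comp_def, hL] using h2.tendsto.comp h1
  have hnL : Tendsto (fun n : ℕ => (n : ℂ) * L n) atTop (𝓝 (Complex.I * ν)) := by
    refine Complex.tendsto_nat_mul_log_one_add_of_tendsto (tendsto_const_nhds.congr' ?_)
    filter_upwards [eventually_gt_atTop 0] with n hn
    have : (n : ℂ) ≠ 0 := by exact_mod_cast hn.ne'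
    field_simp
  have hsum : Tendsto (fun n : ℕ => ∑ k ∈ Finset.range M,
      stirlingBeta k * ((n : ℂ) + Complex.I * ν)⁻¹ ^ (k + 1)) atTop (𝓝 0) := by
    have hz : Tendsto (fun n : ℕ => ((n : ℂ) + Complex.I * ν)⁻¹) atTop (𝓝 0) := by
      rw [tendsto_zero_iff_norm_tendsto_zero]
      refine squeeze_zero' (Eventually.of_forall fun n => norm_nonneg _) ?_ hinvR
      filter_upwards [eventually_gt_atTop 0] with n hn
      rw [norm_inv]
      refine inv_anti₀ (by exact_mod_cast hn) ?_
      simpa using Complex.re_le_norm ((n : ℂ) + Complex.I * ν)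
    have := tendsto_finsetSum (Finset.range M) fun k _ =>
      (hz.pow (k + 1)).const_mul (stirlingBeta k)
    simpa using this
  have hlogdiff : Tendsto (fun n : ℕ => ν * Real.log (1 + ((n : ℝ))⁻¹)) atTop (𝓝 0) := by
    have a1 : Tendsto (fun n : ℕ => 1 + ((n : ℝ))⁻¹) atTop (𝓝 1) := by
      simpa using hinvR.const_add 1
    simpa using ((Real.continuousAt_log one_ne_zero).tendsto.comp a1).const_mul ν
  have hmain := ((hnL.add (hL0.const_mul (Complex.I * ν + 1 / 2))).sub_const (Complex.I * ν)).add
    hsum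
  have hmain' := ((Complex.continuous_im.tendsto _).comp hmain).sub hlogdiff
  simp only [mul_zero, add_zero, sub_self, Complex.zero_im] at hmain'
  refine hmain'.congr' ?_
  filter_upwards [eventually_gt_atTop 0] with n hn
  have hnr : (0 : ℝ) < n := by exact_mod_cast hn
  have hn0 : (n : ℂ) ≠ 0 := by exact_mod_cast hn.ne'
  have hl : Real.log ((n : ℝ) + 1) = Real.log n + Real.log (1 + ((n : ℝ))⁻¹) := by
    rw [← Real.log_mul hnr.ne' (by positivity)]
    congr 1
    field_simp
  have hne : 1 + Complex.I * ν * ((n : ℂ))⁻¹ ≠ 0 := fun h => by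
    have := congrArg Complex.re h
    simp at this
  have hlog : Complex.log ((n : ℂ) + Complex.I * ν) = (Real.log n : ℝ) + L n := by
    have := Complex.log_ofReal_mul hnr hne
    rw [← this]
    congr 1
    push_cast
    field_simp
  have hexp : stirlingApprox M (n + Complex.I * ν) =
      ((n : ℂ) * L n + (Complex.I * ν + 1 / 2) * L n - Complex.I * ν +
      ∑ k ∈ Finset.range M, stirlingBeta k * ((n : ℂ) + Complex.I * ν)⁻¹ ^ (k + 1)) +
      (((n : ℝ) * Real.log n + 1 / 2 * Real.log n - n : ℝ) : ℂ) +
        Complex.I * (ν * Real.log n : ℝ) := by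
    rw [stirlingApprox, hlog]
    push_cast
    ring
  rw [hexp, hl]
  simp only [Function.comp_apply, Complex.add_im, Complex.ofReal_im, Complex.I_mul_im,
    Complex.ofReal_re]
  ring

theorem gammaArg_bound (M : ℕ) : ∃ C R : ℝ, 0 < R ∧ ∀ ν : ℝ, R < ν →
    |gammaArg ν - (stirlingApprox M (Complex.I * ν)).im| ≤ C * ν⁻¹ ^ M := by
  obtain ⟨C, R, hR, h⟩ := stirling_partial_bound M
  refine ⟨C, R, hR, fun ν hν => ?_⟩
  have hν0 : 0 ≤ ν := (hR.trans hν).le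
  have h1 := (summable_gammaArgTerm hν0).hasSum.tendsto_sum_nat
  have h2 := ((h1.add (tendsto_stirlingApprox_im M ν)).sub_const
    (stirlingApprox M (Complex.I * ν)).im).abs
  rw [add_zero] at h2
  refine le_of_tendsto h2 (Eventually.of_forall fun n => ?_)
  refine le_trans (le_of_eq ?_) (h ν hν n)
  rw [sum_gammaArgTerm]
  congr 1
  ring

/-- The expansion variable `1/(iν)`. -/
noncomputable def imInv (ν : ℝ) : ℂ := (Complex.I * ν)⁻¹

theorem norm_imInv (ν : ℝ) : ‖imInv ν‖ = |ν|⁻¹ := by simp [imInv]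

theorem tendsto_imInv : Tendsto imInv atTop (𝓝 0) := by
  rw [tendsto_zero_iff_norm_tendsto_zero]
  simp only [norm_imInv]
  exact tendsto_inv_atTop_zero.comp tendsto_abs_atTop_atTop

theorem imInv_pow_re {k : ℕ} (hk : Even k) (ν : ℝ) : (imInv ν ^ (k + 1)).re = 0 := by
  obtain ⟨m, rfl⟩ := hk
  have : imInv ν ^ (m + m + 1) = (((-1) ^ m * (ν⁻¹) ^ (2 * m + 1) : ℝ) : ℂ) * (-Complex.I) := by
    rw [imInv, mul_inv, Complex.inv_I, mul_pow, ← two_mul, pow_succ (-Complex.I), pow_mul, neg_sq,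
      Complex.I_sq]
    push_cast
    ring
  rw [this, Complex.re_ofReal_mul]
  simp

/-- Stirling's series for the argument of `Γ(1 + iν)`. -/
theorem hasExpansion_gammaArg : HasExpansion atTop imInv
    (fun ν => -(Complex.I * (gammaArg ν - (ν * Real.log ν - ν + Real.pi / 4) : ℝ)))
    (fun _ => PowerSeries.map Complex.ofRealHom stirlingLog) := by
  have hcoef : ∀ k, PowerSeries.coeff (k + 1) (PowerSeries.map Complex.ofRealHom stirlingLog) =
      -stirlingBeta k := fun k => by
    rw [PowerSeries.coeff_map, stirlingLog, PowerSeries.coeff_mk, if_neg (by omega), stirlingBeta]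
    simp
    ring
  have hcoef0 : PowerSeries.coeff 0 (PowerSeries.map Complex.ofRealHom stirlingLog) = 0 := by
    rw [PowerSeries.coeff_map, stirlingLog, PowerSeries.coeff_mk]
    simp
  refine ⟨fun k => isBigO_const_const _ one_ne_zero _, fun N => ?_⟩
  obtain ⟨C, R, hR, hC⟩ := gammaArg_bound N
  have hbig : (fun ν : ℝ => -(Complex.I * (gammaArg ν - (ν * Real.log ν - ν + Real.pi / 4) : ℝ)) -
      ∑ k ∈ Finset.range (N + 1), PowerSeries.coeff k
        (PowerSeries.map Complex.ofRealHom stirlingLog) * imInv ν ^ k) =O[atTop]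
      (fun ν => imInv ν ^ N) := by
    refine IsBigO.of_bound C ?_
    filter_upwards [eventually_gt_atTop R] with ν hν
    have hν0 : 0 < ν := hR.trans hν
    rw [norm_pow, norm_imInv, abs_of_pos hν0]
    refine le_trans (le_of_eq ?_) (hC ν hν)
    rw [Finset.sum_range_succ', hcoef0, zero_mul, add_zero]
    set T : ℂ := ∑ k ∈ Finset.range N, stirlingBeta k * imInv ν ^ (k + 1) with hT
    have hTre : T.re = 0 := by
      rw [hT, Complex.re_sum]
      refine Finset.sum_eq_zero fun k _ => ?_
      rcases Nat.even_or_odd k with hk | hk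
      · have : stirlingBeta k =
            ((((bernoulli (k + 2) : ℚ) : ℝ) / (((k : ℝ) + 1) * (k + 2)) : ℝ) : ℂ) := by
          rw [stirlingBeta]; push_cast; rfl
        rw [this, Complex.re_ofReal_mul, imInv_pow_re hk, mul_zero]
      · rw [stirlingBeta, bernoulli_eq_zero_of_odd (by
          obtain ⟨m, rfl⟩ := hk; exact ⟨m + 1, by ring⟩) (by omega)]
        simp
    have hTim : T = Complex.I * T.im := by
      conv_lhs => rw [← Complex.re_add_im T, hTre]
      push_cast
      ring
    have hlog : Complex.log (Complex.I * ν) = (Real.log ν : ℝ) + Complex.I * (Real.pi / 2 : ℝ) := by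
      rw [mul_comm, Complex.log_ofReal_mul hν0 Complex.I_ne_zero, Complex.log_I]
      push_cast
      ring
    have hs : stirlingApprox N (Complex.I * ν) =
        ((-(ν * (Real.pi / 2)) + 1 / 2 * Real.log ν : ℝ) : ℂ) +
        Complex.I * (ν * Real.log ν - ν + Real.pi / 4 + T.im : ℝ) := by
      rw [stirlingApprox, hlog]
      change _ + T = _
      rw [hTim]
      simp only [Complex.I_mul_im, Complex.ofReal_re]
      push_cast
      linear_combination (ν * (Real.pi / 2) : ℂ) * Complex.I_sq
    have him : (stirlingApprox N (Complex.I * ν)).im =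
        ν * Real.log ν - ν + Real.pi / 4 + T.im := by
      rw [hs, Complex.add_im, Complex.ofReal_im, Complex.I_mul_im, Complex.ofReal_re, zero_add]
    have hsum : ∑ k ∈ Finset.range N, PowerSeries.coeff (k + 1)
        (PowerSeries.map Complex.ofRealHom stirlingLog) * imInv ν ^ (k + 1) = -T := by
      rw [hT, ← Finset.sum_neg_distrib]
      exact Finset.sum_congr rfl fun k _ => by rw [hcoef, neg_mul]
    rw [hsum, him, hTim]
    have : -(Complex.I * (gammaArg ν - (ν * Real.log ν - ν + Real.pi / 4) : ℝ)) -
        -(Complex.I * (T.im : ℂ)) =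
        -(Complex.I * (gammaArg ν - (ν * Real.log ν - ν + Real.pi / 4 + T.im) : ℝ)) := by
      push_cast
      ring
    simp only [Complex.I_mul_im, Complex.ofReal_re]
    rw [this, norm_neg, norm_mul, Complex.norm_I, one_mul, Complex.norm_real, Real.norm_eq_abs]
  refine (hbig.add (isBigO_mul_of_bdd (isBigO_const_const (PowerSeries.coeff N
    (PowerSeries.map Complex.ofRealHom stirlingLog)) one_ne_zero _)
    (isBigO_refl (fun ν => imInv ν ^ N) atTop))).congr_left fun ν => ?_
  rw [Finset.sum_range_succ]
  ring

/-! ### The expansion of the phase -/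

theorem map_inv_of_constantCoeff_one {p : PowerSeries ℝ} (h : PowerSeries.constantCoeff p = 1) :
    PowerSeries.map Complex.ofRealHom p⁻¹ = (PowerSeries.map Complex.ofRealHom p)⁻¹ := by
  have h1 : PowerSeries.constantCoeff (PowerSeries.map Complex.ofRealHom p) ≠ 0 := by
    rw [← PowerSeries.coeff_zero_eq_constantCoeff_apply, PowerSeries.coeff_map,
      PowerSeries.coeff_zero_eq_constantCoeff_apply, h, map_one]
    exact one_ne_zero
  rw [PowerSeries.eq_inv_iff_mul_eq_one h1, ← map_mul,
    PowerSeries.inv_mul_cancel _ (by simp [h]), map_one]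

/-- The terms of the formal series that defines the coefficients `C_k`. -/
noncomputable def coeffCTerm {R : Type*} [Field R] (χ : R) (j : ℕ) : PowerSeries R :=
  PowerSeries.C (χ ^ j / (j.factorial : R)) * PowerSeries.X ^ j *
    (∏ i ∈ Finset.range j, (1 + PowerSeries.C ((i : R) + 1) * PowerSeries.X))⁻¹

theorem map_coeffCTerm (χ : ℝ) (j : ℕ) :
    PowerSeries.map Complex.ofRealHom (coeffCTerm χ j) = coeffCTerm (χ : ℂ) j := by
  rw [coeffCTerm, map_mul, map_inv_of_constantCoeff_one (by simp [map_prod]), coeffCTerm]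
  simp [map_prod]

theorem coeff_sum_coeffCTerm (χ : ℝ) {k N : ℕ} (h : k < N) :
    PowerSeries.coeff k (∑ j ∈ Finset.range N, coeffCTerm (χ : ℂ) j) = (coeffC χ k : ℂ) := by
  have h1 : coeffC χ k = PowerSeries.coeff k (∑ j ∈ Finset.range N, coeffCTerm χ j) := by
    change PowerSeries.coeff k (∑ j ∈ Finset.range (k + 1), coeffCTerm χ j) = _
    rw [map_sum, map_sum]
    refine Finset.sum_subset (by intro j; simp; omega) fun j _ hj => ?_
    simp only [Finset.mem_range, not_lt] at hj
    rw [coeffCTerm, mul_assoc, PowerSeries.coeff_C_mul, PowerSeries.coeff_X_pow_mul',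
      if_neg (by omega), mul_zero]
  rw [h1]
  change _ = Complex.ofRealHom _
  rw [← PowerSeries.coeff_map]
  congr 1
  rw [map_sum (PowerSeries.map Complex.ofRealHom)]
  exact Finset.sum_congr rfl fun j _ => (map_coeffCTerm χ j).symm

theorem pow_le_norm_poch (ν : ℝ) (k : ℕ) : |ν| ^ k ≤ ‖poch ν k‖ := by
  induction k with
  | zero => simp [poch_zero]
  | succ k ih =>
    rw [poch_succ, norm_mul, pow_succ]
    exact mul_le_mul ih (abs_le_norm_factor ν k) (abs_nonneg _) (norm_nonneg _)

theorem poch_inv_eq {ν : ℝ} (hν : ν ≠ 0) (k : ℕ) : (poch ν k)⁻¹ =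
    imInv ν ^ k * (∏ i ∈ Finset.range k, (1 + ((i : ℂ) + 1) * imInv ν))⁻¹ := by
  have hz : Complex.I * (ν : ℂ) ≠ 0 := mul_ne_zero Complex.I_ne_zero (by exact_mod_cast hν)
  induction k with
  | zero => simp [poch_zero]
  | succ k ih =>
    have hν' : (ν : ℂ) ≠ 0 := by exact_mod_cast hν
    have : (k : ℂ) + 1 + Complex.I * ν = (Complex.I * ν) * (1 + ((k : ℂ) + 1) * imInv ν) := by
      rw [imInv]
      field_simp
      ring
    rw [poch_succ, mul_inv, ih, Finset.prod_range_succ, mul_inv, this, mul_inv, pow_succ, ← imInv]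
    ring

/-- The expansion of `H(ν, s)` for large order. -/
theorem hasExpansion_hyp {s : ℝ} (hs : 0 ≤ s) : HasExpansion atTop imInv (fun ν => hyp ν s)
    (fun _ => PowerSeries.map Complex.ofRealHom (PowerSeries.mk (coeffC s))) := by
  have ht := tendsto_imInv
  have hc : ∀ c : ℂ, HasExpansion atTop imInv (fun _ => c) (fun _ => PowerSeries.C c) :=
    fun c => HasExpansion.const (isBigO_const_const _ one_ne_zero _)
  refine HasExpansion.of_forall (fun k => isBigO_const_const _ one_ne_zero _) fun N => ?_
  refine ⟨fun _ => ∑ j ∈ Finset.range N, coeffCTerm (s : ℂ) j,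
    fun ν => ∑ j ∈ Finset.range N, hcoef ν j * (s : ℂ) ^ j, ?_, fun _ k hk => ?_, ?_⟩
  · refine HasExpansion.sum _ fun j _ => ?_
    have hprod := HasExpansion.prod ht (Finset.range j) fun i _ =>
      HasExpansion.one.add ((hc ((i : ℂ) + 1)).mul ht (HasExpansion.X ht))
    have h := ((hc ((s : ℂ) ^ j / (j.factorial : ℂ))).mul ht ((HasExpansion.X ht).pow ht j)).mul ht
      (hprod.inv ht one_ne_zero (fun _ => by simp [map_prod]))
    refine h.congr' ?_
    filter_upwards [eventually_gt_atTop 0] with ν hν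
    rw [hcoef, one_div, mul_inv, poch_inv_eq hν.ne']
    ring
  · rw [coeff_sum_coeffCTerm s hk]
    simp
  · refine IsBigO.of_bound (∑' j : ℕ, s ^ (j + N) / ((j + N).factorial : ℝ)) ?_
    filter_upwards [eventually_ge_atTop 1] with ν hν
    have hν0 : 0 < ν := by linarith
    have hsum := (hasSum_nat_add_iff' N).2 (hasSum_powerSum (norm_hcoef_le' ν) s)
    change HasSum _ (hyp ν s - _) at hsum
    have hb : HasSum (fun j : ℕ => s ^ (j + N) / ((j + N).factorial : ℝ) * ν⁻¹ ^ N) _ :=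
      (((summable_nat_add_iff N).2 (Real.summable_pow_div_factorial s)).hasSum).mul_right (ν⁻¹ ^ N)
    rw [← hsum.tsum_eq, norm_pow, norm_imInv, abs_of_pos hν0]
    refine tsum_of_norm_bounded hb fun j => ?_
    rw [norm_mul, norm_hcoef, norm_pow, Complex.norm_real, Real.norm_eq_abs, abs_of_nonneg hs]
    have h1 : ν ^ N ≤ ‖poch ν (j + N)‖ := by
      have := pow_le_norm_poch ν (j + N)
      rw [abs_of_pos hν0] at this
      exact (pow_le_pow_right₀ hν (Nat.le_add_left N j)).trans this
    calc 1 / ((j + N).factorial * ‖poch ν (j + N)‖) * s ^ (j + N)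
        ≤ 1 / ((j + N).factorial * ν ^ N) * s ^ (j + N) := by gcongr
      _ = s ^ (j + N) / ((j + N).factorial : ℝ) * ν⁻¹ ^ N := by
        rw [inv_pow]
        field_simp

theorem hasTaylor_cexp : HasTaylor Complex.exp (fun j => 1 / (j.factorial : ℂ)) :=
  hasTaylor_of_hasSum one_pos fun z _ => by
    rw [Complex.exp_eq_exp_ℂ]
    exact hasSum_of_eq (NormedSpace.expSeries_div_hasSum_exp z) (fun k => by ring) rfl

/-- The coefficients `a_k` are those of the product of the series for `1/Γ` and for `H`. -/
theorem mul_series_eq_coeffa (x : ℝ) :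
    fcomp (fun j => 1 / (j.factorial : ℝ)) stirlingLog * PowerSeries.mk (coeffC (x ^ 2 / 4)) =
      PowerSeries.mk (coeffa x) := by
  ext k
  rw [PowerSeries.coeff_mul, Finset.Nat.sum_antidiagonal_eq_sum_range_succ_mk, PowerSeries.coeff_mk]
  simp only [PowerSeries.coeff_mk]
  rfl

/-- The deviation of the phase from its leading terms `ν log (λν) + π/4`. -/
noncomputable def phaseDev (x ν : ℝ) : ℝ :=
  phase ν (x ^ 2 / 4) - ν * Real.log (lam x * ν) - Real.pi / 4

theorem lam_pos {x : ℝ} (hx : 0 < x) : 0 < lam x := by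
  rw [lam]; positivity

theorem phaseDev_eq {x ν : ℝ} (hx : 0 < x) (hν : 0 < ν) : phaseDev x ν =
    (gammaArg ν - (ν * Real.log ν - ν + Real.pi / 4)) - (hypLog ν (x ^ 2 / 4)).im := by
  have h1 : Real.log (lam x * ν) = Real.log 2 - 1 - Real.log x + Real.log ν := by
    rw [Real.log_mul (lam_pos hx).ne' hν.ne', lam, Real.log_div two_ne_zero (by positivity),
      Real.log_mul (Real.exp_ne_zero 1) hx.ne', Real.log_exp]
    ring
  have h2 : Real.log (x ^ 2 / 4) = 2 * Real.log x - 2 * Real.log 2 := by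
    rw [show x ^ 2 / 4 = (x / 2) ^ 2 by ring, Real.log_pow, Real.log_div hx.ne' two_ne_zero]
    push_cast
    ring
  rw [phaseDev, phase, h1, h2]
  ring

/-- The factor `H` of `I_{iν}(x)`, rotated by the deviation of `arg Γ(1 + iν)` from the leading
terms of Stirling's formula. Its argument is `-phaseDev`, and it has the expansion
`∑ a_k (iν)^{-k}`. -/
noncomputable def besselAmp (x ν : ℝ) : ℂ :=
  Complex.exp (-(Complex.I * (gammaArg ν - (ν * Real.log ν - ν + Real.pi / 4) : ℝ))) *
    hyp ν (x ^ 2 / 4)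

theorem hasExpansion_besselAmp (x : ℝ) : HasExpansion atTop imInv (besselAmp x)
    (fun _ => PowerSeries.map Complex.ofRealHom (PowerSeries.mk (coeffa x))) := by
  have h0 : PowerSeries.constantCoeff (PowerSeries.map Complex.ofRealHom stirlingLog) = 0 := by
    rw [← PowerSeries.coeff_zero_eq_constantCoeff_apply, PowerSeries.coeff_map, stirlingLog,
      PowerSeries.coeff_mk]
    simp
  have h := (hasExpansion_gammaArg.comp tendsto_imInv (fun _ => h0) hasTaylor_cexp).mul
    tendsto_imInv (hasExpansion_hyp (by positivity : 0 ≤ x ^ 2 / 4))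
  refine h.congr_coeff fun _ => ?_
  rw [← mul_series_eq_coeffa, map_mul, map_fcomp]
  simp

theorem besselAmp_eq {x ν : ℝ} (hx : 0 < x) (hν : 0 < ν) : besselAmp x ν =
    ‖hyp ν (x ^ 2 / 4)‖ * Complex.exp ((-phaseDev x ν : ℝ) * Complex.I) := by
  have hs : 0 ≤ x ^ 2 / 4 := by positivity
  have hH : hyp ν (x ^ 2 / 4) = ‖hyp ν (x ^ 2 / 4)‖ *
      Complex.exp (Complex.I * (hypLog ν (x ^ 2 / 4)).im) := by
    rw [hyp_eq_exp ν hs, Complex.norm_exp, Complex.ofReal_exp, ← Complex.exp_add]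
    congr 1
    conv_lhs => rw [← Complex.re_add_im (hypLog ν (x ^ 2 / 4))]
    ring
  rw [besselAmp]
  conv_lhs => rw [hH]
  rw [mul_left_comm, ← Complex.exp_add, phaseDev_eq hx hν]
  congr 2
  push_cast
  ring

theorem imInv_eq (ν : ℝ) : imInv ν = (ν⁻¹ : ℝ) * (-Complex.I) := by
  rw [imInv, mul_inv, Complex.inv_I]
  push_cast
  ring

theorem neg_I_pow_even {k : ℕ} (h : Even k) : (-Complex.I) ^ k = (((-1) ^ (k / 2) : ℝ) : ℂ) := by
  obtain ⟨m, rfl⟩ := h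
  rw [← two_mul, pow_mul, neg_sq, Complex.I_sq, Nat.mul_div_cancel_left m two_pos]
  push_cast
  rfl

theorem neg_I_pow_odd {k : ℕ} (h : ¬Even k) :
    (-Complex.I) ^ k = (((-1) ^ (k / 2) : ℝ) : ℂ) * (-Complex.I) := by
  obtain ⟨m, rfl⟩ := Nat.not_even_iff_odd.1 h
  rw [pow_succ, neg_I_pow_even (even_two_mul m), show (2 * m + 1) / 2 = 2 * m / 2 by omega]

/-- Taking real and imaginary parts of an expansion in powers of `1/(iν)` with real
coefficients. -/
theorem HasExpansion.re_im {G : ℝ → ℂ} {a : ℕ → ℝ} (h : HasExpansion atTop imInv G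
    (fun _ => PowerSeries.map Complex.ofRealHom (PowerSeries.mk a))) :
    HasExpansion atTop (fun ν : ℝ => ν⁻¹) (fun ν => (G ν).re)
      (fun _ => PowerSeries.mk fun k => if Even k then (-1) ^ (k / 2) * a k else 0) ∧
    HasExpansion atTop (fun ν : ℝ => ν⁻¹) (fun ν => -(G ν).im)
      (fun _ => PowerSeries.mk fun k => if Even k then 0 else (-1) ^ (k / 2) * a k) := by
  have hnorm : ∀ N : ℕ, (fun ν : ℝ => imInv ν ^ N) =O[atTop] (fun ν : ℝ => (ν⁻¹) ^ N) := fun N =>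
    IsBigO.of_bound 1 (Eventually.of_forall fun ν => by simp [norm_imInv])
  have hterm : ∀ (k : ℕ) (ν : ℝ), PowerSeries.coeff k (PowerSeries.map Complex.ofRealHom
      (PowerSeries.mk a)) * imInv ν ^ k = ((a k * (ν⁻¹) ^ k : ℝ) : ℂ) * (-Complex.I) ^ k := by
    intro k ν
    rw [PowerSeries.coeff_map, PowerSeries.coeff_mk, imInv_eq, mul_pow, Complex.ofRealHom_eq_coe]
    push_cast
    ring
  constructor
  · refine ⟨fun k => isBigO_const_const _ one_ne_zero _, fun N => ?_⟩
    refine IsBigO.trans (IsBigO.of_bound 1 (Eventually.of_forall fun ν => ?_))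
      ((h.sub_isBigO N).trans (hnorm N))
    rw [one_mul, Real.norm_eq_abs]
    refine le_trans (le_of_eq ?_) (Complex.abs_re_le_norm _)
    rw [Complex.sub_re, Complex.re_sum]
    congr 2
    refine Finset.sum_congr rfl fun k _ => ?_
    rw [hterm, PowerSeries.coeff_mk, Complex.re_ofReal_mul]
    split_ifs with hk
    · rw [neg_I_pow_even hk, Complex.ofReal_re]
      ring
    · rw [neg_I_pow_odd hk, Complex.re_ofReal_mul]
      simp
  · refine ⟨fun k => isBigO_const_const _ one_ne_zero _, fun N => ?_⟩
    refine IsBigO.trans (IsBigO.of_bound 1 (Eventually.of_forall fun ν => ?_))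
      ((h.sub_isBigO N).trans (hnorm N))
    rw [one_mul, Real.norm_eq_abs]
    refine le_trans (le_of_eq ?_) (Complex.abs_im_le_norm _)
    rw [← abs_neg, Complex.sub_im, Complex.im_sum, neg_sub_left, neg_neg, add_comm, sub_eq_add_neg]
    congr 2
    rw [← Finset.sum_neg_distrib]
    refine Finset.sum_congr rfl fun k _ => ?_
    rw [hterm, PowerSeries.coeff_mk, Complex.im_ofReal_mul]
    split_ifs with hk
    · rw [neg_I_pow_even hk, Complex.ofReal_im]
      ring
    · rw [neg_I_pow_odd hk, Complex.im_ofReal_mul]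
      simp
      ring

theorem hasTaylor_arctan : HasTaylor Real.arctan arctanCoeff := by
  refine hasTaylor_of_hasSum one_pos fun z hz => ?_
  have h := Real.hasSum_arctan hz
  have hinj : Function.Injective fun n : ℕ => 2 * n + 1 := fun a b hab => by
    simp only at hab; omega
  rw [← hinj.hasSum_iff]
  · refine hasSum_of_eq h (fun k => ?_) rfl
    have h1 : ¬Even (2 * k + 1) := by simp
    have h2 : (2 * k + 1) / 2 = k := by omega
    simp only [Function.comp_apply, arctanCoeff, if_neg h1, h2]
    push_cast
    ring
  · intro k hk
    have : Even k := by
      by_contra h1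
      obtain ⟨m, rfl⟩ := Nat.not_even_iff_odd.1 h1
      exact hk ⟨m, rfl⟩
    simp [arctanCoeff, this]

theorem tendsto_phaseDev {x : ℝ} (hx : 0 < x) : Tendsto (phaseDev x) atTop (𝓝 0) := by
  have h0 : PowerSeries.constantCoeff (PowerSeries.map Complex.ofRealHom stirlingLog) = 0 := by
    rw [← PowerSeries.coeff_zero_eq_constantCoeff_apply, PowerSeries.coeff_map, stirlingLog,
      PowerSeries.coeff_mk]
    simp
  have h1 := (hasExpansion_gammaArg.tendsto tendsto_imInv (fun _ => h0)).norm
  simp only [norm_neg, norm_mul, Complex.norm_I, one_mul, Complex.norm_real, norm_zero] at h1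
  have h1' := tendsto_zero_iff_norm_tendsto_zero.2 h1
  have h2 : Tendsto (fun ν => (hypLog ν (x ^ 2 / 4)).im) atTop (𝓝 0) := by
    rw [tendsto_zero_iff_norm_tendsto_zero]
    have hlim : Tendsto (fun ν : ℝ => x ^ 2 / 4 * Real.exp (x ^ 2 / 4) / ν) atTop (𝓝 0) :=
      tendsto_const_nhds.div_atTop tendsto_id
    refine squeeze_zero' (Eventually.of_forall fun ν => norm_nonneg _) ?_ hlim
    filter_upwards [eventually_gt_atTop 0] with ν hν
    exact (Complex.abs_im_le_norm _).trans (norm_hypLog_le hν (by positivity))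
  have h3 := h1'.sub h2
  rw [sub_zero] at h3
  refine h3.congr' ?_
  filter_upwards [eventually_gt_atTop 0] with ν hν
  rw [phaseDev_eq hx hν]

theorem hasExpansion_phaseDev {x : ℝ} (hx : 0 < x) :
    HasExpansion atTop (fun ν : ℝ => ν⁻¹) (phaseDev x)
      (fun _ => fcomp arctanCoeff (oddSeries x * (evenSeries x)⁻¹)) := by
  have ht : Tendsto (fun ν : ℝ => ν⁻¹) atTop (𝓝 0) := tendsto_inv_atTop_zero
  obtain ⟨hre, him⟩ := (hasExpansion_besselAmp x).re_im
  have hE := constantCoeff_evenSeries x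
  have hratio := him.mul ht (hre.inv ht one_ne_zero (fun _ => hE))
  have h0 : PowerSeries.constantCoeff (oddSeries x * (evenSeries x)⁻¹) = 0 := by
    rw [map_mul, constantCoeff_oddSeries, zero_mul]
  refine (hratio.comp ht (fun _ => h0) hasTaylor_arctan).congr' ?_
  have hsmall : ∀ᶠ ν in atTop, |phaseDev x ν| < Real.pi / 2 := by
    have := (tendsto_phaseDev hx).abs
    rw [abs_zero] at this
    exact this.eventually_lt_const (by positivity)
  filter_upwards [hsmall, eventually_gt_atTop 0] with ν hν hν0
  have hn : ‖hyp ν (x ^ 2 / 4)‖ ≠ 0 := norm_ne_zero_iff.2 (hyp_ne_zero ν (by positivity))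
  have e1 : (besselAmp x ν).re = ‖hyp ν (x ^ 2 / 4)‖ * Real.cos (phaseDev x ν) := by
    rw [besselAmp_eq hx hν0, Complex.re_ofReal_mul, Complex.exp_ofReal_mul_I_re, Real.cos_neg]
  have e2 : -(besselAmp x ν).im = ‖hyp ν (x ^ 2 / 4)‖ * Real.sin (phaseDev x ν) := by
    rw [besselAmp_eq hx hν0, Complex.im_ofReal_mul, Complex.exp_ofReal_mul_I_im, Real.sin_neg]
    ring
  rw [e1, e2, mul_inv, mul_mul_mul_comm, mul_inv_cancel₀ hn, one_mul, ← div_eq_mul_inv,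
    ← Real.tan_eq_sin_div_cos]
  have := abs_lt.1 hν
  exact Real.arctan_tan this.1 this.2

/-- The expansion of the phase to all orders, with the coefficients `A_k`. -/
theorem phaseDev_sub_isBigO {x : ℝ} (hx : 0 < x) (M : ℕ) :
    (fun ν => phaseDev x ν - ∑ k ∈ Finset.range M, coeffA x k * (ν⁻¹) ^ (2 * k + 1))
      =O[atTop] (fun ν : ℝ => (ν⁻¹) ^ (2 * M + 1)) := by
  refine ((hasExpansion_phaseDev hx).sub_isBigO (2 * M + 1)).congr_left fun ν => ?_
  congr 1
  have heven : ∀ k, Even k →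
      PowerSeries.coeff k (fcomp arctanCoeff (oddSeries x * (evenSeries x)⁻¹)) = 0 := fun k hk =>
    coeff_fcomp_eq_zero_of_odd (fun j hj => if_pos hj) (rescale_ratio x) hk
  induction M with
  | zero => simp [heven 0 Even.zero]
  | succ M ih =>
    rw [show 2 * (M + 1) + 1 = 2 * M + 1 + 1 + 1 by ring, Finset.sum_range_succ,
      Finset.sum_range_succ, ih, Finset.sum_range_succ, heven (2 * M + 1 + 1) ⟨M + 1, by ring⟩,
      zero_mul, add_zero]
    rfl

/-! ### The Lambert function -/

theorem lambertW_pos {z : ℝ} (hz : 0 < z) : 0 < lambertW z := by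
  rw [lambertW, dif_pos hz]
  exact (exists_lambert z hz).choose_spec.1

theorem lambertW_mul_exp {z : ℝ} (hz : 0 < z) : lambertW z * Real.exp (lambertW z) = z := by
  rw [lambertW, dif_pos hz]
  exact (exists_lambert z hz).choose_spec.2

theorem mPlus_pos (n : ℕ) : 0 < mPlus n := by
  rw [mPlus]
  have := Real.pi_pos
  positivity

theorem tendsto_mPlus : Tendsto mPlus atTop atTop :=
  (tendsto_atTop_add_const_right _ _ tendsto_natCast_atTop_atTop).atTop_mul_const Real.pi_pos

section Zeros

variable {x : ℝ}

theorem wPlus_pos (hx : 0 < x) (n : ℕ) : 0 < wPlus x n :=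
  lambertW_pos (mul_pos (lam_pos hx) (mPlus_pos n))

theorem xiPlus_pos (hx : 0 < x) (n : ℕ) : 0 < xiPlus x n := div_pos (mPlus_pos n) (wPlus_pos hx n)

theorem lam_mul_xiPlus (hx : 0 < x) (n : ℕ) : lam x * xiPlus x n = Real.exp (wPlus x n) := by
  have h := lambertW_mul_exp (mul_pos (lam_pos hx) (mPlus_pos n))
  change wPlus x n * Real.exp (wPlus x n) = _ at h
  rw [xiPlus, ← mul_div_assoc, ← h, mul_div_cancel_left₀ _ (wPlus_pos hx n).ne']

theorem log_lam_mul_xiPlus (hx : 0 < x) (n : ℕ) : Real.log (lam x * xiPlus x n) = wPlus x n := by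
  rw [lam_mul_xiPlus hx, Real.log_exp]

theorem xiPlus_mul_wPlus (hx : 0 < x) (n : ℕ) : xiPlus x n * wPlus x n = mPlus n := by
  rw [xiPlus, div_mul_cancel₀ _ (wPlus_pos hx n).ne']

theorem tendsto_wPlus (hx : 0 < x) : Tendsto (wPlus x) atTop atTop := by
  rw [tendsto_atTop]
  intro B
  have h := tendsto_mPlus.const_mul_atTop (lam_pos hx)
  filter_upwards [h.eventually_gt_atTop (B * Real.exp B)] with n hn
  by_contra hlt
  have hlt := not_le.1 hlt
  have hW := wPlus_pos hx n
  have h2 := lambertW_mul_exp (mul_pos (lam_pos hx) (mPlus_pos n))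
  change wPlus x n * Real.exp (wPlus x n) = _ at h2
  have : wPlus x n * Real.exp (wPlus x n) ≤ B * Real.exp B := by
    have := hW.trans hlt
    gcongr
  linarith

theorem tendsto_xiPlus (hx : 0 < x) : Tendsto (xiPlus x) atTop atTop := by
  have h1 := (Real.tendsto_exp_atTop.comp (tendsto_wPlus hx)).const_mul_atTop
    (inv_pos.2 (lam_pos hx))
  refine h1.congr fun n => ?_
  rw [Function.comp_apply, ← lam_mul_xiPlus hx, inv_mul_cancel_left₀ (lam_pos hx).ne']

/-! ### Existence and enumeration of the zeros -/

theorem tendsto_phase_left (hx : 0 < x) :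
    Tendsto (fun ν => phase ν (x ^ 2 / 4)) atTop atTop := by
  have h1 : Tendsto (fun ν => ν * Real.log (lam x * ν)) atTop atTop :=
    tendsto_id.atTop_mul_atTop₀
      (Real.tendsto_log_atTop.comp (tendsto_id.const_mul_atTop (lam_pos hx)))
  refine ((h1.atTop_add ((tendsto_phaseDev hx).add_const (Real.pi / 4)))).congr fun ν => ?_
  rw [phaseDev]
  ring

theorem exists_phase_eq (hx : 0 < x) {c : ℝ} (hc : 0 < c) :
    ∃ ν : ℝ, 0 < ν ∧ phase ν (x ^ 2 / 4) = c := by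
  obtain ⟨V, hV0, hV⟩ := ((eventually_ge_atTop (0 : ℝ)).and
    ((tendsto_phase_left hx).eventually_ge_atTop c)).exists
  obtain ⟨ν, hν, h⟩ := intermediate_value_Icc hV0 (continuousOn_phase (x ^ 2 / 4) V)
    (show c ∈ Set.Icc _ _ from ⟨by rw [phase_zero_left]; exact hc.le, hV⟩)
  refine ⟨ν, lt_of_le_of_ne hν.1 ?_, h⟩
  rintro rfl
  simp only [phase_zero_left] at h
  exact hc.ne h

/-- The sequence of solutions of `Φ(ν) = (n + 1/2) π`. -/
theorem exists_zeros (hx : 0 < x) : ∃ ν : ℕ → ℝ, (∀ n, 0 < ν n) ∧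
    ∀ n : ℕ, phase (ν n) (x ^ 2 / 4) = ((n : ℝ) + 1 / 2) * Real.pi := by
  have h : ∀ n : ℕ, 0 < ((n : ℝ) + 1 / 2) * Real.pi := fun n => by
    have := Real.pi_pos
    positivity
  choose ν h1 h2 using fun n => exists_phase_eq hx (h n)
  exact ⟨ν, h1, h2⟩

theorem phase_lt_iff (hx : 0 < x) {ν₁ ν₂ : ℝ} (h1 : 0 ≤ ν₁) (h2 : 0 ≤ ν₂) :
    phase ν₁ (x ^ 2 / 4) < phase ν₂ (x ^ 2 / 4) ↔ ν₁ < ν₂ := by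
  have hmono : StrictMonoOn (fun ν => phase ν (x ^ 2 / 4)) (Set.Ici 0) := fun a ha b _ hab =>
    phase_strictMono ha hab (by positivity)
  exact hmono.lt_iff_lt h1 h2

theorem zeros_strictMono (hx : 0 < x) {ν : ℕ → ℝ} (h0 : ∀ n, 0 < ν n)
    (hν : ∀ n : ℕ, phase (ν n) (x ^ 2 / 4) = ((n : ℝ) + 1 / 2) * Real.pi) : StrictMono ν := by
  intro a b hab
  rw [← phase_lt_iff hx (h0 a).le (h0 b).le, hν, hν]
  have : (a : ℝ) < b := by exact_mod_cast hab
  have := Real.pi_pos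
  gcongr

/-- There are no other zeros: the phase is injective, and positive for `ν > 0`. -/
theorem range_zeros (hx : 0 < x) {ν : ℕ → ℝ} (h0 : ∀ n, 0 < ν n)
    (hν : ∀ n : ℕ, phase (ν n) (x ^ 2 / 4) = ((n : ℝ) + 1 / 2) * Real.pi) :
    Set.range ν = {t : ℝ | 0 < t ∧ besselL t x = 0} := by
  ext t
  constructor
  · rintro ⟨n, rfl⟩
    refine ⟨h0 n, (besselL_eq_zero_iff (h0 n) hx).2 ?_⟩
    rw [hν, Real.cos_eq_zero_iff]
    exact ⟨n, by push_cast; ring⟩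
  · rintro ⟨ht, hL⟩
    obtain ⟨k, hk⟩ := Real.cos_eq_zero_iff.1 ((besselL_eq_zero_iff ht hx).1 hL)
    have hpos : 0 < phase t (x ^ 2 / 4) := by
      have := phase_strictMono (s := x ^ 2 / 4) le_rfl ht (by positivity)
      rwa [phase_zero_left] at this
    have hk0 : 0 ≤ k := by
      rw [hk] at hpos
      have h1 : 0 < (2 * (k : ℝ) + 1) := by
        by_contra hcon
        have := mul_nonpos_of_nonpos_of_nonneg (not_lt.1 hcon) Real.pi_pos.le
        linarith
      have h2 : (0 : ℤ) < 2 * k + 1 := by exact_mod_cast h1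
      omega
    obtain ⟨n, rfl⟩ := Int.eq_ofNat_of_zero_le hk0
    refine ⟨n, ?_⟩
    have heq : phase (ν n) (x ^ 2 / 4) = phase t (x ^ 2 / 4) := by
      rw [hν, hk]
      push_cast
      ring
    rcases lt_trichotomy (ν n) t with h | h | h
    · exact absurd heq ((phase_lt_iff hx (h0 n).le ht.le).2 h).ne
    · exact h
    · exact absurd heq ((phase_lt_iff hx ht.le (h0 n).le).2 h).ne'

theorem tendsto_zeros (hx : 0 < x) {ν : ℕ → ℝ} (h0 : ∀ n, 0 < ν n)
    (hν : ∀ n : ℕ, phase (ν n) (x ^ 2 / 4) = ((n : ℝ) + 1 / 2) * Real.pi) :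
    Tendsto ν atTop atTop := by
  rw [tendsto_atTop]
  intro B
  have h : Tendsto (fun n : ℕ => ((n : ℝ) + 1 / 2) * Real.pi) atTop atTop :=
    (tendsto_atTop_add_const_right _ _ tendsto_natCast_atTop_atTop).atTop_mul_const Real.pi_pos
  filter_upwards [h.eventually_gt_atTop (phase (max B 0) (x ^ 2 / 4))] with n hn
  rw [← hν, phase_lt_iff hx (le_max_right _ _) (h0 n).le] at hn
  exact (le_max_left _ _).trans hn.le

/-! ### Asymptotic inversion -/

/-- `(1 + y) log (1 + y) - y` -/
noncomputable def entropyFun (y : ℝ) : ℝ := (1 + y) * Real.log (1 + y) - y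

theorem hasTaylor_log : HasTaylor (fun z : ℝ => Real.log (1 + z))
    (fun n => (-1) ^ (n + 1) / (n : ℝ)) := by
  refine hasTaylor_of_hasSum one_pos fun z hz => ?_
  have h := (Real.hasSum_pow_div_log_of_abs_lt_one (x := -z) (by simpa using hz)).neg
  rw [neg_neg, sub_neg_eq_add] at h
  refine (hasSum_nat_add_iff' 1).1 (hasSum_of_eq h (fun k => ?_) (by simp))
  rw [neg_pow z]
  push_cast
  ring

theorem hasTaylor_entropyFun : HasTaylor entropyFun entropyCoeff := by
  have ht : Tendsto (fun z : ℝ => z) (𝓝 0) (𝓝 0) := tendsto_id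
  have hX := HasExpansion.X ht
  have h := (((HasExpansion.one.add hX).mul ht (hasTaylor_log.hasExpansion ht)).sub hX).hasTaylor
  have hc : (fun j => PowerSeries.coeff j ((1 + PowerSeries.X) *
      PowerSeries.mk (fun n : ℕ => (-1) ^ (n + 1) / (n : ℝ)) - PowerSeries.X)) = entropyCoeff := by
    ext j
    rcases j with _ | _ | k
    · simp [entropyCoeff]
    · simp [entropyCoeff, add_mul, PowerSeries.coeff_succ_X_mul]
    · have hk : (k : ℝ) + 1 ≠ 0 := by positivity
      have hk2 : (k : ℝ) + 2 ≠ 0 := by positivity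
      rw [map_sub, add_mul, one_mul, map_add, PowerSeries.coeff_mk, PowerSeries.coeff_succ_X_mul,
        PowerSeries.coeff_mk, PowerSeries.coeff_X, if_neg (by omega), entropyCoeff,
        if_neg (by omega)]
      push_cast
      rw [show (k : ℝ) + 1 + 1 = k + 2 by ring, show (k : ℝ) + 2 - 1 = k + 1 by ring]
      field_simp
      ring
  rw [hc] at h
  exact h

theorem hasStrictDerivAt_entropyFun : HasStrictDerivAt entropyFun 0 0 := by
  have h1 : HasStrictDerivAt (fun y : ℝ => 1 + y) 1 0 := (hasStrictDerivAt_id 0).const_add 1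
  have h2 : HasStrictDerivAt (fun y : ℝ => Real.log (1 + y)) (1 / (1 + 0)) 0 :=
    h1.log (by norm_num)
  have h := (h1.mul h2).sub (hasStrictDerivAt_id 0)
  exact h.congr_deriv (by simp)

/-- The right-hand side of the inversion equation, with `N` terms of the phase correction. -/
noncomputable def inversionFun (A : ℕ → ℝ) (N : ℕ) (u y : ℝ) : ℝ :=
  -(∑ j ∈ Finset.range N, A j * u ^ (j + 1) * ((1 + y)⁻¹) ^ (2 * j + 1)) - entropyFun y

section Inversion

variable {A : ℕ → ℝ} {ℓ u : ℕ → ℝ}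

theorem hasExpansion_inversionFun (hu : Tendsto u atTop (𝓝 0)) {y : ℕ → ℝ}
    {p : ℕ → PowerSeries ℝ} (hy : HasExpansion atTop u y p)
    (hp : ∀ n, PowerSeries.constantCoeff (p n) = 0) (N : ℕ) :
    HasExpansion atTop u (fun n => inversionFun A N (u n) (y n))
      (fun n => inversionRhs A N (p n)) :=
  (HasExpansion.sum _ fun j _ => ((HasExpansion.const (isBigO_const_const (A j) one_ne_zero _)).mul
    hu ((HasExpansion.X hu).pow hu (j + 1))).mul hu
    (((HasExpansion.one.add hy).inv hu one_ne_zero (fun n => by simp [hp n])).pow hu _)).neg.sub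
    (hy.comp hu hp hasTaylor_entropyFun)

/-- The truncations of the formal inversion have coefficients that stay bounded as long as `1/ℓ`
does. -/
theorem hasExpansion_inversionPartial (hu : Tendsto u atTop (𝓝 0))
    (hℓ : (fun n => (ℓ n)⁻¹) =O[atTop] (fun _ => (1 : ℝ))) (N : ℕ) :
    HasExpansion atTop u (fun n => ∑ k ∈ Finset.range N, inversionb A (ℓ n) k * u n ^ (k + 1))
      (fun n => inversionPartial A (ℓ n) N) := by
  induction N with
  | zero => simpa [inversionPartial] using HasExpansion.zero
  | succ N ih =>
    have hb : (fun n => inversionb A (ℓ n) N) =O[atTop] (fun _ => (1 : ℝ)) := by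
      have h1 := (hasExpansion_inversionFun (A := A) hu ih
        (fun n => constantCoeff_inversionPartial A (ℓ n) N) (N + 1)).coeff_bdd (N + 1)
      refine (isBigO_mul_of_bdd h1 hℓ).congr_left fun n => ?_
      rw [coeff_inversionRhs A le_rfl, inversionb, div_eq_mul_inv]
    simp only [Finset.sum_range_succ]
    exact ih.add ((HasExpansion.const hb).mul hu ((HasExpansion.X hu).pow hu (N + 1)))

/-- The truncations of the formal inversion solve the equation up to `O(u^(N+1))`. -/
theorem inversionPartial_residual (hu : Tendsto u atTop (𝓝 0))
    (hℓ : (fun n => (ℓ n)⁻¹) =O[atTop] (fun _ => (1 : ℝ))) (hℓ0 : ∀ n, ℓ n ≠ 0) (N : ℕ) :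
    (fun n => inversionFun A N (u n) (∑ k ∈ Finset.range N, inversionb A (ℓ n) k * u n ^ (k + 1)) -
      ℓ n * ∑ k ∈ Finset.range N, inversionb A (ℓ n) k * u n ^ (k + 1))
      =O[atTop] (fun n => u n ^ (N + 1)) := by
  have h := (hasExpansion_inversionFun (A := A) hu (hasExpansion_inversionPartial hu hℓ N)
    (fun n => constantCoeff_inversionPartial A (ℓ n) N) N).sub_isBigO (N + 1)
  refine h.congr_left fun n => ?_
  congr 1
  rw [Finset.sum_range_succ', coeff_inversionRhs_inversionPartial A (hℓ0 n) (Nat.zero_le N),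
    PowerSeries.coeff_zero_eq_constantCoeff_apply, constantCoeff_inversionPartial, mul_zero,
    zero_mul, add_zero, Finset.mul_sum]
  refine Finset.sum_congr rfl fun k hk => ?_
  have hk := Finset.mem_range.1 hk
  rw [coeff_inversionRhs_inversionPartial A (hℓ0 n) hk, coeff_succ_inversionPartial A _ hk]
  ring

/-- The right-hand side of the inversion equation is a contraction with small constant. -/
theorem inversionFun_sub_isLittleO (hu : Tendsto u atTop (𝓝 0)) {y z : ℕ → ℝ}
    (hy : Tendsto y atTop (𝓝 0)) (hz : Tendsto z atTop (𝓝 0)) (N : ℕ) :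
    (fun n => inversionFun A N (u n) (y n) - inversionFun A N (u n) (z n))
      =o[atTop] (fun n => y n - z n) := by
  have hyz : Tendsto (fun n => (y n, z n)) atTop (𝓝 ((0 : ℝ), (0 : ℝ))) := hy.prodMk_nhds hz
  have hent : (fun n => entropyFun (y n) - entropyFun (z n)) =o[atTop] (fun n => y n - z n) := by
    have h := (hasStrictDerivAt_entropyFun.hasStrictFDerivAt.isLittleO).comp_tendsto hyz
    simpa [Function.comp_def] using h
  have hterm : ∀ j : ℕ, (fun n => A j * u n ^ (j + 1) * ((1 + y n)⁻¹) ^ (2 * j + 1) -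
      A j * u n ^ (j + 1) * ((1 + z n)⁻¹) ^ (2 * j + 1)) =o[atTop] (fun n => y n - z n) := by
    intro j
    have hd : ContDiffAt ℝ 1 (fun y : ℝ => ((1 + y)⁻¹) ^ (2 * j + 1)) 0 :=
      ((contDiffAt_const.add contDiffAt_id).inv (by simp)).pow (2 * j + 1)
    have h1 := (hd.hasStrictFDerivAt one_ne_zero).isBigO_sub.comp_tendsto hyz
    have h2 : (fun n => A j * u n ^ (j + 1)) =o[atTop] (fun _ => (1 : ℝ)) := by
      rw [isLittleO_one_iff]
      simpa using (hu.pow (j + 1)).const_mul (A j)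
    have h3 := h2.mul_isBigO h1
    simp only [Function.comp_def, one_mul] at h3
    exact h3.congr_left fun n => by ring
  have hsum := IsLittleO.sum (s := Finset.range N) fun j _ => hterm j
  refine (hsum.neg_left.sub hent).congr_left fun n => ?_
  simp only [inversionFun, Finset.sum_apply, Finset.sum_sub_distrib]
  ring

/-- An approximate solution of the inversion equation is approximated by the partial sums of the
formal solution; the large factor `ℓ` improves the error. -/
theorem inversion_error (hu : Tendsto u atTop (𝓝 0)) (hℓ : Tendsto ℓ atTop atTop)
    (hℓ0 : ∀ n, ℓ n ≠ 0) {y : ℕ → ℝ} (hy : Tendsto y atTop (𝓝 0)) (N : ℕ)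
    (heq : (fun n => inversionFun A N (u n) (y n) - ℓ n * y n) =O[atTop] (fun n => u n ^ (N + 1))) :
    (fun n => y n - ∑ k ∈ Finset.range N, inversionb A (ℓ n) k * u n ^ (k + 1))
      =O[atTop] (fun n => u n ^ (N + 1) / (ℓ n - 1)) := by
  have hℓb : (fun n => (ℓ n)⁻¹) =O[atTop] (fun _ => (1 : ℝ)) :=
    (tendsto_inv_atTop_zero.comp hℓ).isBigO_one ℝ
  have hexp := hasExpansion_inversionPartial (A := A) hu hℓb N
  have hz := hexp.tendsto hu (fun n => constantCoeff_inversionPartial A (ℓ n) N)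
  have hres := inversionPartial_residual (A := A) hu hℓb hℓ0 N
  set z : ℕ → ℝ := fun n => ∑ k ∈ Finset.range N, inversionb A (ℓ n) k * u n ^ (k + 1)
  have hlip := inversionFun_sub_isLittleO (A := A) hu hy hz N
  obtain ⟨C, hC⟩ := (hres.sub heq).bound
  refine IsBigO.of_bound C ?_
  filter_upwards [hC, hlip.bound one_pos, hℓ.eventually_gt_atTop 1] with n h1 h2 h3
  simp only [Real.norm_eq_abs, one_mul] at h1 h2 ⊢
  have h4 : ℓ n * |y n - z n| ≤ |inversionFun A N (u n) (z n) - ℓ n * z n -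
      (inversionFun A N (u n) (y n) - ℓ n * y n)| + |inversionFun A N (u n) (y n) -
      inversionFun A N (u n) (z n)| := by
    have : ℓ n * |y n - z n| = |ℓ n * (y n - z n)| := by
      rw [abs_mul, abs_of_pos (by linarith : 0 < ℓ n)]
    rw [this]
    refine le_trans (le_of_eq ?_) (abs_add_le _ _)
    congr 1
    ring
  rw [abs_div, abs_of_pos (by linarith : 0 < ℓ n - 1), ← mul_div_assoc,
    le_div_iff₀ (by linarith)]
  linarith

end Inversion

/-! ### The expansion of the zeros -/

/-- The equation `Φ = (n + 1/2) π` rewritten with `m₊ = (n + 1/4) π`. -/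
theorem zeros_equation {ν : ℕ → ℝ}
    (hν : ∀ n : ℕ, phase (ν n) (x ^ 2 / 4) = ((n : ℝ) + 1 / 2) * Real.pi) (n : ℕ) :
    ν n * Real.log (lam x * ν n) + phaseDev x (ν n) = mPlus n := by
  rw [phaseDev, hν, mPlus]
  ring

/-- The zeros differ from `ξ_n` by `o(1)`, because `r log (λr)` grows at least linearly. -/
theorem tendsto_zeros_sub_xiPlus (hx : 0 < x) {ν : ℕ → ℝ} (h0 : ∀ n, 0 < ν n)
    (hν : ∀ n : ℕ, phase (ν n) (x ^ 2 / 4) = ((n : ℝ) + 1 / 2) * Real.pi) :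
    Tendsto (fun n => ν n - xiPlus x n) atTop (𝓝 0) := by
  have hlam := lam_pos hx
  have hexpand : ∀ r₁ r₂ : ℝ, 0 < r₁ → r₁ ≤ r₂ → Real.exp 1 ≤ lam x * r₂ →
      r₂ - r₁ ≤ r₂ * Real.log (lam x * r₂) - r₁ * Real.log (lam x * r₁) := by
    intro r₁ r₂ h1 h12 h2
    have hl : 1 ≤ Real.log (lam x * r₂) := by
      rw [Real.le_log_iff_exp_le (by have := h1.trans_le h12; positivity)]
      exact h2
    have hm : Real.log (lam x * r₁) ≤ Real.log (lam x * r₂) :=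
      Real.log_le_log (by positivity) (by gcongr)
    nlinarith [mul_nonneg (sub_nonneg.2 h12) (sub_nonneg.2 hl),
      mul_nonneg h1.le (sub_nonneg.2 hm)]
  have hνt := tendsto_zeros hx h0 hν
  have hdev := ((tendsto_phaseDev hx).comp hνt).abs
  rw [abs_zero] at hdev
  rw [tendsto_zero_iff_abs_tendsto_zero]
  refine squeeze_zero' (Eventually.of_forall fun n => abs_nonneg _) ?_ hdev
  filter_upwards [(hνt.const_mul_atTop hlam).eventually_ge_atTop (Real.exp 1),
    ((tendsto_xiPlus hx).const_mul_atTop hlam).eventually_ge_atTop (Real.exp 1)] with n h1 h2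
  have e1 := zeros_equation hν n
  have e2 := xiPlus_mul_wPlus hx n
  rw [← log_lam_mul_xiPlus hx] at e2
  simp only [Function.comp_apply]
  rcases le_total (ν n) (xiPlus x n) with h | h
  · have := hexpand _ _ (h0 n) h h2
    rw [abs_sub_comm, abs_of_nonneg (by linarith)]
    refine le_trans ?_ (le_abs_self _)
    linarith
  · have := hexpand _ _ (xiPlus_pos hx n) h h1
    rw [abs_of_nonneg (by linarith)]
    refine le_trans ?_ (neg_le_abs _)
    linarith

theorem zeros_expansion (hx : 0 < x) {ν : ℕ → ℝ} (h0 : ∀ n, 0 < ν n)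
    (hν : ∀ n : ℕ, phase (ν n) (x ^ 2 / 4) = ((n : ℝ) + 1 / 2) * Real.pi) (N : ℕ) :
    (fun n : ℕ => ν n - (mPlus n / lambertW (lam x * mPlus n) +
        ∑ k ∈ Finset.range N, coeffB x n k / mPlus n ^ (2 * k + 1))) =O[atTop]
      (fun n : ℕ => lambertW (lam x * mPlus n) ^ (2 * N) / mPlus n ^ (2 * N + 1)) := by
  have hξ0 := xiPlus_pos hx
  have hξt := tendsto_xiPlus hx
  have hW0 := wPlus_pos hx
  set ξ := xiPlus x with hξ
  set W := wPlus x with hW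
  set u : ℕ → ℝ := fun n => (ξ n)⁻¹ ^ 2 with hu
  set y : ℕ → ℝ := fun n => (ν n - ξ n) * (ξ n)⁻¹ with hy
  set ℓ : ℕ → ℝ := fun n => 1 + Real.log (lam x * ξ n) with hℓ
  have hinv : Tendsto (fun n => (ξ n)⁻¹) atTop (𝓝 0) := tendsto_inv_atTop_zero.comp hξt
  have hut : Tendsto u atTop (𝓝 0) := by
    have h := hinv.pow 2
    rwa [zero_pow two_ne_zero] at h
  have hyt : Tendsto y atTop (𝓝 0) := by
    simpa using (tendsto_zeros_sub_xiPlus hx h0 hν).mul hinv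
  have hℓW : ∀ n, ℓ n = 1 + W n := fun n => by rw [hℓ]; simp only [hξ, log_lam_mul_xiPlus hx]; rfl
  have hℓt : Tendsto ℓ atTop atTop := by
    rw [funext hℓW]
    exact tendsto_atTop_add_const_left _ _ (tendsto_wPlus hx)
  have hℓ0 : ∀ n, ℓ n ≠ 0 := fun n => by rw [hℓW]; have := hW0 n; positivity
  have h1y : ∀ n, 1 + y n = ν n / ξ n := fun n => by
    have := (hξ0 n).ne'
    simp only [hy]
    field_simp
    ring
  have hratio : Tendsto (fun n => (1 + y n)⁻¹) atTop (𝓝 1) := by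
    simpa using (hyt.const_add 1).inv₀ (by simp)
  have hνinv : ∀ n, (ν n)⁻¹ = (ξ n)⁻¹ * (1 + y n)⁻¹ := fun n => by
    rw [h1y, inv_div]
    have := (hξ0 n).ne'
    have := (h0 n).ne'
    field_simp
  -- the exact equation for `y` is `ℓ y = -phaseDev/ξ - entropyFun y`
  have hexact : ∀ n, ℓ n * y n = -(phaseDev x (ν n) * (ξ n)⁻¹) - entropyFun (y n) := by
    intro n
    have e1 := zeros_equation hν n
    have e2 := xiPlus_mul_wPlus hx n
    have hν' : ν n = ξ n * (1 + y n) := by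
      rw [h1y, mul_div_cancel₀ _ (hξ0 n).ne']
    have hpos : 0 < 1 + y n := by rw [h1y]; exact div_pos (h0 n) (hξ0 n)
    have hlog : Real.log (lam x * ν n) = W n + Real.log (1 + y n) := by
      rw [hν', ← mul_assoc, Real.log_mul (mul_pos (lam_pos hx) (hξ0 n)).ne' hpos.ne',
        log_lam_mul_xiPlus hx]
    have hdev : phaseDev x (ν n) = -(ξ n * (W n * y n + (1 + y n) * Real.log (1 + y n))) := by
      rw [hlog] at e1
      have : ν n * (W n + Real.log (1 + y n)) = ξ n * (1 + y n) * (W n + Real.log (1 + y n)) := by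
        rw [← hν']
      change ξ n * W n = mPlus n at e2
      linear_combination e1 - this - e2
    rw [hdev, hℓW, entropyFun]
    have := (hξ0 n).ne'
    field_simp
    ring
  have heq : (fun n => inversionFun (coeffA x) N (u n) (y n) - ℓ n * y n) =O[atTop]
      (fun n => u n ^ (N + 1)) := by
    have h1 := ((phaseDev_sub_isBigO hx N).comp_tendsto (tendsto_zeros hx h0 hν)).mul
      (isBigO_refl (fun n => (ξ n)⁻¹) atTop)
    have h2 : (fun n => (ν n)⁻¹ ^ (2 * N + 1) * (ξ n)⁻¹) =O[atTop] (fun n => u n ^ (N + 1)) := by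
      have h3 : (fun n => (1 + y n)⁻¹ ^ (2 * N + 1)) =O[atTop] (fun _ => (1 : ℝ)) :=
        (hratio.pow _).isBigO_one ℝ
      refine (isBigO_mul_of_bdd h3 (isBigO_refl (fun n => u n ^ (N + 1)) atTop)).congr_left fun n => ?_
      rw [hνinv, mul_pow]
      simp only [hu]
      ring
    refine (h1.trans h2).congr_left fun n => ?_
    simp only [Function.comp_apply]
    rw [hexact, inversionFun, sub_mul, Finset.sum_mul]
    have : ∑ j ∈ Finset.range N, coeffA x j * u n ^ (j + 1) * (1 + y n)⁻¹ ^ (2 * j + 1) =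
        ∑ j ∈ Finset.range N, coeffA x j * (ν n)⁻¹ ^ (2 * j + 1) * (ξ n)⁻¹ := by
      refine Finset.sum_congr rfl fun j _ => ?_
      rw [hνinv, mul_pow]
      simp only [hu]
      ring
    rw [this]
    ring
  have herr := (isBigO_refl ξ atTop).mul (inversion_error hut hℓt hℓ0 hyt N heq)
  refine (herr.congr_left fun n => ?_).congr_right fun n => ?_
  · have hξn := (hξ0 n).ne'
    have hmn := (mPlus_pos n).ne'
    have hν' : ν n = ξ n + ξ n * y n := by
      simp only [hy]
      field_simp
      ring
    have hsum : ∑ k ∈ Finset.range N, coeffB x n k / mPlus n ^ (2 * k + 1) =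
        ξ n * ∑ k ∈ Finset.range N, inversionb (coeffA x) (ℓ n) k * u n ^ (k + 1) := by
      rw [Finset.mul_sum]
      refine Finset.sum_congr rfl fun k _ => ?_
      rw [coeffB, div_div, ← mul_pow, ← hξ, div_mul_cancel₀ _ hmn]
      change inversionb (coeffA x) (ℓ n) k / _ = _
      simp only [hu]
      rw [← pow_mul, inv_pow, show 2 * (k + 1) = 2 * k + 1 + 1 by ring, pow_succ _ (2 * k + 1)]
      field_simp
    rw [hsum]
    change _ = ν n - (ξ n + _)
    rw [hν']
    ring
  · have hξn := (hξ0 n).ne'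
    have hWn := (hW0 n).ne'
    have hm : mPlus n = ξ n * W n := (xiPlus_mul_wPlus hx n).symm
    change _ = W n ^ (2 * N) / mPlus n ^ (2 * N + 1)
    rw [hℓW, add_sub_cancel_left, hm, mul_pow]
    simp only [hu]
    rw [← pow_mul, inv_pow, show 2 * (N + 1) = 2 * N + 1 + 1 by ring, pow_succ (ξ n) (2 * N + 1),
      pow_succ (W n)]
    field_simp

theorem coeffB_explicit (hx : 0 < x) (n : ℕ) :
    let A : ℕ → ℝ := coeffA x
    let ξ : ℝ := mPlus n / lambertW (lam x * mPlus n)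
    let ℓ : ℝ := 1 + Real.log (lam x * ξ)
    let χ : ℝ := ξ / mPlus n
    let b₀ : ℝ := -A 0 / ℓ
    let b₁ : ℝ := (A 0 * b₀ - A 1 - 1 / 2 * b₀ ^ 2) / ℓ
    coeffB x n 0 = -A 0 / (1 + χ) ∧
    coeffB x n 1 = (A 0 * b₀ - A 1 - 1 / 2 * b₀ ^ 2) / (χ ^ 2 * (1 + χ)) ∧
    coeffB x n 2 = (3 * A 1 * b₀ - A 0 * (b₀ ^ 2 - b₁) - A 2 - b₀ * b₁
      + 1 / 6 * b₀ ^ 3) / (χ ^ 4 * (1 + χ)) := by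
  intro A ξ ℓ χ b₀ b₁
  have hW := wPlus_pos hx n
  have hm := mPlus_pos n
  have hℓ : ℓ = 1 + wPlus x n := by
    change 1 + Real.log (lam x * xiPlus x n) = _
    rw [log_lam_mul_xiPlus hx]
  have hχ : χ = (wPlus x n)⁻¹ := by
    change mPlus n / wPlus x n / mPlus n = _
    field_simp
  have hχ0 : χ ≠ 0 := by rw [hχ]; positivity
  -- the factor `ℓ` in the denominators of `b_k` combines with `χ = 1/W`
  have hprod : ℓ * χ = 1 + χ := by
    rw [hℓ, hχ, add_mul, one_mul, mul_inv_cancel₀ hW.ne', add_comm]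
  obtain ⟨h0, h1, h2⟩ := inversionb_explicit A ℓ
  refine ⟨?_, ?_, ?_⟩
  · change inversionb A ℓ 0 / χ ^ 1 = _
    rw [h0, div_div, pow_one, hprod]
  · change inversionb A ℓ 1 / χ ^ 3 = _
    rw [h1, div_div, ← hprod]
    congr 1
    ring
  · change inversionb A ℓ 2 / χ ^ 5 = _
    rw [h2, div_div, ← hprod]
    congr 1
    ring

end Zeros

end Dunster

end

theorem theorem1 (x : ℝ) (hx : 0 < x) :
    -- the positive zeros, in increasing order, and their expansion to all orders
    (∃ ν : ℕ → ℝ, StrictMono ν ∧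
      Set.range ν = {t : ℝ | 0 < t ∧ Dunster.besselL t x = 0} ∧
      ∀ N : ℕ,
        (fun n : ℕ => ν n - (Dunster.mPlus n / Dunster.lambertW (Dunster.lam x * Dunster.mPlus n) +
            ∑ k ∈ Finset.range N, Dunster.coeffB x n k / Dunster.mPlus n ^ (2 * k + 1)))
          =O[Filter.atTop]
        (fun n : ℕ => Dunster.lambertW (Dunster.lam x * Dunster.mPlus n) ^ (2 * N) /
            Dunster.mPlus n ^ (2 * N + 1))) ∧
    -- the explicit form of `A₀`, `A₁`, `A₂`
    (let a : ℕ → ℝ := Dunster.coeffa x;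
      Dunster.coeffA x 0 = a 1 ∧
      Dunster.coeffA x 1 = a 1 * a 2 - a 3 - 1 / 3 * a 1 ^ 3 ∧
      Dunster.coeffA x 2 = a 1 * a 2 ^ 2 + a 1 ^ 2 * a 3 - a 1 ^ 3 * a 2 - a 2 * a 3 - a 1 * a 4
        + a 5 + 1 / 5 * a 1 ^ 5) ∧
    -- the explicit form of `B₀`, `B₁`, `B₂`
    (∀ n : ℕ,
      let A : ℕ → ℝ := Dunster.coeffA x
      let ξ : ℝ := Dunster.mPlus n / Dunster.lambertW (Dunster.lam x * Dunster.mPlus n)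
      let ℓ : ℝ := 1 + Real.log (Dunster.lam x * ξ)
      let χ : ℝ := ξ / Dunster.mPlus n
      let b₀ : ℝ := -A 0 / ℓ
      let b₁ : ℝ := (A 0 * b₀ - A 1 - 1 / 2 * b₀ ^ 2) / ℓ
      Dunster.coeffB x n 0 = -A 0 / (1 + χ) ∧
      Dunster.coeffB x n 1 = (A 0 * b₀ - A 1 - 1 / 2 * b₀ ^ 2) / (χ ^ 2 * (1 + χ)) ∧
      Dunster.coeffB x n 2 = (3 * A 1 * b₀ - A 0 * (b₀ ^ 2 - b₁) - A 2 - b₀ * b₁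
        + 1 / 6 * b₀ ^ 3) / (χ ^ 4 * (1 + χ))) := by
  obtain ⟨ν, h0, hν⟩ := Dunster.exists_zeros hx
  exact ⟨⟨ν, Dunster.zeros_strictMono hx h0 hν, Dunster.range_zeros hx h0 hν,
    Dunster.zeros_expansion hx h0 hν⟩, Dunster.coeffA_explicit x, Dunster.coeffB_explicit hx⟩
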